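/- **Setting.** Let $\mathfrak g$ be a finite-dimensional real Lie algebra with an inner product satisfying $\langle [X,Y],Z\rangle=-\langle Y,[X,Z]\rangle$; for instance, the Lie algebra of a compact Lie group $G$ with an $\mathrm{Ad}$-invariant inner product. On $\mathbb R^3$ (where every principal $G$-bundle $P$ is trivial) let $\nabla_0=d+A$ be a smooth connection, $A\in\Omega^1(\mathbb R^3,\mathfrak g)$, and let $\Phi_0:\mathbb R^3\to\mathfrak g$ be smooth. For a section $s:\mathbb R^3\to\mathfrak g$ of the adjoint bundle, $\nabla_0 s=d_{\nabla_0}s=ds+[A,s]$. Assume that $m_0=(\nabla_0,\Phi_0)$ is a finite energy Bogomolny monopole, that is, $*F_{\nabla_0}=d_{\nabla_0}\Phi_0\in L^2$, with the following two properties. Put $r=|x|$ and $\pi_\infty(x)=x/|x|$. 1. *Asymptotics.* There are a smooth connection $\nabla^\infty$ on the trivial bundle over $\mathbb S^2$ and smooth sections $\Phi_\infty,\kappa:\mathbb S^2\to\mathfrak g$, neither identically zero, such that $\nabla^\infty\Phi_\infty=0$, $F_{\nabla^\infty}=\tfrac12\kappa\otimes\mathrm{vol}_{\mathbb S^2}$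 and $[\Phi_\infty,\kappa]=0$. There are also $R>0$ and a smooth family $u(x)$, $|x|>R$, of isometric Lie algebra automorphisms of $\mathfrak g$ (for instance $u=\mathrm{Ad}(g)$ for a smooth $G$-valued function $g$, i.e. an identification of $P$ with $\pi_\infty^*P_\infty$ near infinity) such that, as $r\to\infty$, $$u\,\Phi_0=\pi_\infty^*\Phi_\infty-\tfrac1{2r}\pi_\infty^*\kappa+O(r^{-2}),\qquad u\,d_{\nabla_0}\Phi_0=\tfrac1{2r^2}\,\pi_\infty^*\kappa\otimes dr+O(r^{-3}).$$ 2. *Maximal symmetry breaking.* $\ker(\mathrm{ad}\,\Phi_\infty(\omega))$ is Abelian for every $\omega\in\mathbb S^2$. **Operators and spaces.** For smooth compactly supported $(a,\Psi)\in\Omega^1(\mathbb R^3,\mathfrak g)\oplus\Omega^0(\mathbb R^3,\mathfrak g)$ put $$D(a,\Psi)=\bigl(*d_{\nabla_0}a-d_{\nabla_0}\Psi-[a,\Phi_0],\; d_{\nabla_0}^*a-[\Phi_0,\Psi]\bigr),$$ and let $$D^*(a,\Psi)=\bigl(*d_{\nabla_0}a+d_{\nabla_0}\Psi+[a,\Phi_0],\;-d_{\nabla_0}^*a+[\Phi_0,\Psi]\bigr)$$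 be its formal $L^2$-adjoint. With $\rho=(1+|x|^2)^{1/2}$ and $\|\cdot\|$ the $L^2$-norm, let $\mathcal H_0,\mathcal H_1,\mathcal H_2$ be the completions of the space of smooth compactly supported sections $c$ of $(\Lambda^1\oplus\Lambda^0)\otimes\mathfrak g$ in the norms $$\|c\|_{\mathcal H_0}^2=\|c\|^2,\qquad \|c\|_{\mathcal H_1}^2=\|\nabla_0c\|^2+\|\rho^{-1}c\|^2+\|[\Phi_0,c]\|^2,$$ $$\|c\|_{\mathcal H_2}^2=\|\nabla_0^2c\|^2+\|\rho^{-1}\nabla_0c\|^2+\|[\Phi_0,\nabla_0c]\|^2+\|[\Phi_0,[\Phi_0,c]]\|^2+\|[\Phi_0,\rho^{-1}c]\|^2+\|\rho^{-2}c\|^2 .$$ **Claim.** For $k=0,1$ the operators $D$ and $D^*$ extend to bounded operators $\mathcal H_{k+1}\to\mathcal H_k$, and these are Fredholm (finite-dimensional kernel, closed range of finite codimension). Likewise $DD^*$ and $D^*D$ extend to bounded Fredholm operators $\mathcal H_2\to\mathcal H_0$. -/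

import Mathlib

open MeasureTheory Set
open scoped ContDiff Asymptotics

noncomputable section

/-- Euclidean three-space. -/
abbrev E3 : Type := EuclideanSpace ℝ (Fin 3)

/-- A real Lie algebra with an inner product for which every `ad X` is skew.  The finite-dimensional
ones are exactly the Lie algebras of compact Lie groups with an `Ad`-invariant inner product. -/
class InvariantLieAlgebra (𝔤 : Type*) extends
    NormedAddCommGroup 𝔤, InnerProductSpace ℝ 𝔤, LieRing 𝔤, LieAlgebra ℝ 𝔤 where
  inner_lie_left : ∀ X Y Z : 𝔤, Inner.inner ℝ ⁅X, Y⁆ Z = -Inner.inner ℝ Y ⁅X, Z⁆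

namespace BogomolnyMonopole

/-- The standard basis vectors of `ℝ³`. -/
def e (i : Fin 3) : E3 := EuclideanSpace.single i 1

section Pointwise

variable {𝔤 : Type*} [InvariantLieAlgebra 𝔤]

/-- Covariant derivative `∇ᵢ s = ∂ᵢ s + [Aᵢ, s]` of a section `s` of the adjoint bundle, for the
connection `∇ = d + A`, `A = ∑ Aᵢ dxⁱ`. -/
def covDeriv (A : Fin 3 → E3 → 𝔤) (i : Fin 3) (s : E3 → 𝔤) (x : E3) : 𝔤 :=
  fderiv ℝ s x (e i) + ⁅A i x, s x⁆

/-- The component `F_{ij} = ∂ᵢ Aⱼ - ∂ⱼ Aᵢ + [Aᵢ, Aⱼ]` of the curvature of `∇ = d + A`. -/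
def curvature (A : Fin 3 → E3 → 𝔤) (i j : Fin 3) (x : E3) : 𝔤 :=
  fderiv ℝ (A j) x (e i) - fderiv ℝ (A i) x (e j) + ⁅A i x, A j x⁆

end Pointwise

/-- A smooth pair `(∇, Φ)`: a connection `∇ = d + A` on the (trivialised) principal bundle
over `ℝ³` and a Higgs field, that is, a section `Φ` of the adjoint bundle. -/
structure Configuration (𝔤 : Type*) [InvariantLieAlgebra 𝔤] where
  A : Fin 3 → E3 → 𝔤
  Φ : E3 → 𝔤
  smooth_A : ∀ i, ContDiff ℝ ∞ (A i)
  smooth_Φ : ContDiff ℝ ∞ Φ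

section Hypotheses

variable {𝔤 : Type*} [InvariantLieAlgebra 𝔤]

/-- The Bogomolny equation `*F = d_∇ Φ`.  Indices in `Fin 3` are cyclic,
so `(*F)ᵢ = F_{i+1,i+2}`. -/
def Configuration.IsBogomolny (m : Configuration 𝔤) : Prop :=
  ∀ (i : Fin 3) (x : E3), curvature m.A (i + 1) (i + 2) x = covDeriv m.A i m.Φ x

/-- Finite energy: `|d_∇ Φ|` (which is `|F|` for a monopole) is in `L²(ℝ³)`. -/
def Configuration.FiniteEnergy (m : Configuration 𝔤) : Prop :=
  ∀ i : Fin 3, MemLp (covDeriv m.A i m.Φ) 2 volume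

/-- `u` is a smooth field of isometric Lie algebra automorphisms on the exterior region
`‖x‖ > R`; this is the map induced on adjoint bundles by an isomorphism `P ≅ π_∞^* P_∞`. -/
structure IsExteriorFraming (R : ℝ) (u : E3 → 𝔤 →L[ℝ] 𝔤) : Prop where
  smooth : ContDiffOn ℝ ∞ u {x | R < ‖x‖}
  bijective : ∀ x, R < ‖x‖ → Function.Bijective (u x)
  norm_map : ∀ x, R < ‖x‖ → ∀ X, ‖u x X‖ = ‖X‖
  map_lie : ∀ x, R < ‖x‖ → ∀ X Y, u x ⁅X, Y⁆ = ⁅u x X, u x Y⁆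

/-- `s` is (the pull-back to `ℝ³ \ {0}` along `x ↦ x / ‖x‖` of) a smooth section of the adjoint
bundle over the unit sphere: it is smooth and constant on rays. -/
structure IsSphereSection (s : E3 → 𝔤) : Prop where
  smooth : ContDiffOn ℝ ∞ s {0}ᶜ
  homogeneous : ∀ (t : ℝ) (x : E3), 0 < t → x ≠ 0 → s (t • x) = s x

/-- `d + ∑ aᵢ dxⁱ` is (the pull-back to `ℝ³ \ {0}` along `x ↦ x / ‖x‖` of) a smooth connection over
the unit sphere: `a` is smooth, annihilates the radial direction and is invariant under dilations. -/
structure IsSphereConnection (a : Fin 3 → E3 → 𝔤) : Prop where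
  smooth : ∀ i, ContDiffOn ℝ ∞ (a i) {0}ᶜ
  horizontal : ∀ x : E3, x ≠ 0 → ∑ i, x i • a i x = 0
  homogeneous : ∀ (i : Fin 3) (t : ℝ) (x : E3), 0 < t → x ≠ 0 → t • a i (t • x) = a i x

/-- The asymptotic expansion of a monopole, with limit `(∇^∞, Φ_∞, κ)` over the sphere at infinity:
in an exterior framing, `Φ = Φ_∞ - κ / (2r) + O(r⁻²)` and `d_∇ Φ = κ / (2r²) ⊗ dr + O(r⁻³)`, where
`∇^∞ Φ_∞ = 0`, `F_{∇^∞} = κ / 2 ⊗ vol` and `[Φ_∞, κ] = 0`.  On `ℝ³ \ {0}`, `dr = ∑ xᵢ / r dxⁱ` and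
the pull-back of `vol` is `∑ xᵢ / r³ dx^{i+1} ∧ dx^{i+2}`. -/
structure Configuration.HasAsymptotics (m : Configuration 𝔤) (R : ℝ) (u : E3 → 𝔤 →L[ℝ] 𝔤)
    (a : Fin 3 → E3 → 𝔤) (Φinf κ : E3 → 𝔤) : Prop where
  R_pos : 0 < R
  framing : IsExteriorFraming R u
  connection : IsSphereConnection a
  section_Φinf : IsSphereSection Φinf
  section_κ : IsSphereSection κ
  Φinf_ne_zero : ∃ x, x ≠ 0 ∧ Φinf x ≠ 0
  κ_ne_zero : ∃ x, x ≠ 0 ∧ κ x ≠ 0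
  higgs : (fun x => u x (m.Φ x) - (Φinf x - (1 / (2 * ‖x‖)) • κ x))
    =O[Bornology.cobounded E3] fun x => ‖x‖ ^ (-2 : ℤ)
  covDeriv_higgs : ∀ i : Fin 3,
    (fun x => u x (covDeriv m.A i m.Φ x) - ((1 / (2 * ‖x‖ ^ 2)) * (x i / ‖x‖)) • κ x)
      =O[Bornology.cobounded E3] fun x => ‖x‖ ^ (-3 : ℤ)
  parallel : ∀ (i : Fin 3) (x : E3), x ≠ 0 → covDeriv a i Φinf x = 0
  curvature_eq : ∀ (i : Fin 3) (x : E3), x ≠ 0 →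
    curvature a (i + 1) (i + 2) x = ((1 / 2 : ℝ) * (x i / ‖x‖ ^ 3)) • κ x
  commute : ∀ x : E3, x ≠ 0 → ⁅Φinf x, κ x⁆ = 0

/-- Maximal symmetry breaking: `ker (ad Φ_∞)` is Abelian at every point of the sphere at infinity
(equivalently, `Φ_∞` takes values in the interior of a Weyl chamber). -/
def MaximalSymmetryBreaking (Φinf : E3 → 𝔤) : Prop :=
  ∀ x : E3, x ≠ 0 → ∀ X Y : 𝔤, ⁅Φinf x, X⁆ = 0 → ⁅Φinf x, Y⁆ = 0 → ⁅X, Y⁆ = 0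

end Hypotheses

section TestFunctions

variable (𝔤 : Type*) [InvariantLieAlgebra 𝔤]

/-- Smooth compactly supported functions `ℝ³ → 𝔤`, i.e. sections of the adjoint bundle. -/
def TestFun : Submodule ℝ (E3 → 𝔤) where
  carrier := {s | ContDiff ℝ ∞ s ∧ HasCompactSupport s}
  zero_mem' := ⟨contDiff_const, HasCompactSupport.zero⟩
  add_mem' hs ht := ⟨hs.1.add ht.1, hs.2.add ht.2⟩
  smul_mem' r _ hs := ⟨contDiff_const.smul hs.1, hs.2.smul_left (f := fun _ => r)⟩

/-- Smooth compactly supported sections `(a, Ψ)` of `(Λ¹ ⊕ Λ⁰) ⊗ 𝔤_P`, with `a = ∑ aᵢ dxⁱ`. -/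
abbrev TestSection : Type _ := (Fin 3 → TestFun 𝔤) × TestFun 𝔤

end TestFunctions

section Operators

variable {𝔤 : Type*} [InvariantLieAlgebra 𝔤]

theorem hasCompactSupport_lie {s t : E3 → 𝔤} (ht : HasCompactSupport t) :
    HasCompactSupport fun x => ⁅s x, t x⁆ :=
  ht.mono fun x hx => by
    simp only [Function.mem_support] at hx ⊢
    exact fun h => hx (by rw [h, lie_zero])

/-- The `L²` inner product on `𝔤`-valued test functions. -/
def l2 (s t : TestFun 𝔤) : ℝ := ∫ x, inner ℝ (s.1 x) (t.1 x)

theorem integrable_inner (s t : TestFun 𝔤) : Integrable fun x => inner ℝ (s.1 x) (t.1 x) := by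
  refine (s.2.1.continuous.inner t.2.1.continuous).integrable_of_hasCompactSupport ?_
  refine t.2.2.mono fun x hx => ?_
  simp only [Function.mem_support] at hx ⊢
  exact fun h => hx (by rw [h, inner_zero_right])

theorem l2_symm (s t : TestFun 𝔤) : l2 s t = l2 t s := by
  simp only [l2, real_inner_comm]

theorem l2_nonneg (s : TestFun 𝔤) : 0 ≤ l2 s s :=
  integral_nonneg fun _ => real_inner_self_nonneg

theorem l2_add (s s' t : TestFun 𝔤) : l2 (s + s') t = l2 s t + l2 s' t := by
  simp only [l2, Submodule.coe_add, Pi.add_apply, inner_add_left]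
  exact integral_add (integrable_inner s t) (integrable_inner s' t)

theorem l2_smul (r : ℝ) (s t : TestFun 𝔤) : l2 (r • s) t = r * l2 s t := by
  simp only [l2, Submodule.coe_smul, Pi.smul_apply, real_inner_smul_left]
  exact integral_const_mul _ _

variable [FiniteDimensional ℝ 𝔤]

/-- The Lie bracket as a continuous bilinear map. -/
def bracketL : 𝔤 →L[ℝ] 𝔤 →L[ℝ] 𝔤 :=
  (LinearMap.toContinuousLinearMap (𝕜 := ℝ) (E := 𝔤) (F' := 𝔤)).toLinearMap.comp
    (LieAlgebra.ad ℝ 𝔤 : 𝔤 →ₗ[ℝ] Module.End ℝ 𝔤) |>.toContinuousLinearMap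

@[simp] theorem bracketL_apply (X Y : 𝔤) : bracketL X Y = ⁅X, Y⁆ := rfl

theorem contDiff_lie {s t : E3 → 𝔤} (hs : ContDiff ℝ ∞ s) (ht : ContDiff ℝ ∞ t) :
    ContDiff ℝ ∞ fun x => ⁅s x, t x⁆ := by
  simpa using (bracketL.contDiff.comp hs).clm_apply ht

/-- Bracket `s ↦ [Φ, s]` with the Higgs field. -/
def Configuration.adΦ (m : Configuration 𝔤) : TestFun 𝔤 →ₗ[ℝ] TestFun 𝔤 where
  toFun s := ⟨fun x => ⁅m.Φ x, s.1 x⁆, contDiff_lie m.smooth_Φ s.2.1, hasCompactSupport_lie s.2.2⟩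
  map_add' s t := by ext x; exact lie_add _ _ _
  map_smul' r s := by ext x; exact lie_smul _ _ _

/-- The covariant derivative `∇ᵢ` on compactly supported smooth sections. -/
def Configuration.nabla (m : Configuration 𝔤) (i : Fin 3) : TestFun 𝔤 →ₗ[ℝ] TestFun 𝔤 where
  toFun s := ⟨covDeriv m.A i s.1,
    ((s.2.1.fderiv_right (m := ∞) (by simp)).clm_apply contDiff_const).add
      (contDiff_lie (m.smooth_A i) s.2.1),
    (s.2.2.fderiv_apply (𝕜 := ℝ) (e i)).add (hasCompactSupport_lie s.2.2)⟩
  map_add' s t := by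
    ext x
    have hs := (s.2.1.differentiable (by simp)) x
    have ht := (t.2.1.differentiable (by simp)) x
    simp only [covDeriv, Submodule.coe_add, Pi.add_apply, lie_add, fderiv_add hs ht,
      add_apply]
    abel
  map_smul' r s := by
    ext x
    have hs := (s.2.1.differentiable (by simp)) x
    simp only [covDeriv, Submodule.coe_smul, Pi.smul_apply, lie_smul, fderiv_const_smul hs,
      smul_apply, RingHom.id_apply, smul_add]

/-- The weight `ρ = (1 + |x|²)^{1/2}`. -/
def rho (x : E3) : ℝ := √(1 + ‖x‖ ^ 2)

theorem rho_pos (x : E3) : 0 < rho x := Real.sqrt_pos.2 (by positivity)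

theorem contDiff_rho : ContDiff ℝ ∞ rho :=
  (contDiff_const.add (contDiff_norm_sq ℝ)).sqrt fun x => by positivity

/-- Multiplication by `ρ⁻ⁿ`. -/
def wt (n : ℕ) : TestFun 𝔤 →ₗ[ℝ] TestFun 𝔤 where
  toFun s := ⟨fun x => (rho x ^ n)⁻¹ • s.1 x,
    ((contDiff_rho.pow n).inv fun x => (pow_pos (rho_pos x) n).ne').smul s.2.1,
    s.2.2.smul_left (f := fun x => (rho x ^ n)⁻¹)⟩
  map_add' s t := by ext x; exact smul_add _ _ _
  map_smul' r s := by ext x; exact smul_comm _ _ _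

/-- The operator `D = d₂ ⊕ d₁^*`,
`D (a, Ψ) = (* d_∇ a - d_∇ Ψ - [a, Φ], d_∇^* a - [Φ, Ψ])`. -/
def Configuration.D (m : Configuration 𝔤) : TestSection 𝔤 →ₗ[ℝ] TestSection 𝔤 where
  toFun c := (fun i => m.nabla (i + 1) (c.1 (i + 2)) - m.nabla (i + 2) (c.1 (i + 1))
      - m.nabla i c.2 + m.adΦ (c.1 i), -(∑ i, m.nabla i (c.1 i)) - m.adΦ c.2)
  map_add' c c' := by
    refine Prod.ext (funext fun i => ?_) ?_
    · simp only [Prod.fst_add, Prod.snd_add, Pi.add_apply, map_add]; abel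
    · simp only [Prod.fst_add, Prod.snd_add, Pi.add_apply, map_add, Finset.sum_add_distrib]; abel
  map_smul' r c := by
    refine Prod.ext (funext fun i => ?_) ?_
    · simp [smul_add, smul_sub]
    · simp [smul_sub, Finset.smul_sum]

/-- The formal adjoint of `D` (see `l2Section_D`),
`D^* (b, χ) = (* d_∇ b + d_∇ χ + [b, Φ], - d_∇^* b + [Φ, χ])`. -/
def Configuration.Dstar (m : Configuration 𝔤) : TestSection 𝔤 →ₗ[ℝ] TestSection 𝔤 where
  toFun c := (fun i => m.nabla (i + 1) (c.1 (i + 2)) - m.nabla (i + 2) (c.1 (i + 1))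
      + m.nabla i c.2 - m.adΦ (c.1 i), ∑ i, m.nabla i (c.1 i) + m.adΦ c.2)
  map_add' c c' := by
    refine Prod.ext (funext fun i => ?_) ?_
    · simp only [Prod.fst_add, Prod.snd_add, Pi.add_apply, map_add]; abel
    · simp only [Prod.fst_add, Prod.snd_add, Pi.add_apply, map_add, Finset.sum_add_distrib]; abel
  map_smul' r c := by
    refine Prod.ext (funext fun i => ?_) ?_
    · simp [smul_add, smul_sub]
    · simp [Finset.smul_sum]

/-- The inner products of `H₀`, `H₁`, `H₂` on one component (all of `∇`, `ρ⁻¹` and `[Φ, ·]` act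
componentwise in the parallel frame `dx¹, dx², dx³, 1` of `Λ¹ ⊕ Λ⁰`). -/
def Configuration.form (m : Configuration 𝔤) : Fin 3 → TestFun 𝔤 → TestFun 𝔤 → ℝ
  | 0, s, t => l2 s t
  | 1, s, t => ∑ i, l2 (m.nabla i s) (m.nabla i t) + l2 (wt 1 s) (wt 1 t)
      + l2 (m.adΦ s) (m.adΦ t)
  | 2, s, t => ∑ i, ∑ j, l2 (m.nabla i (m.nabla j s)) (m.nabla i (m.nabla j t))
      + ∑ i, l2 (wt 1 (m.nabla i s)) (wt 1 (m.nabla i t))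
      + ∑ i, l2 (m.adΦ (m.nabla i s)) (m.adΦ (m.nabla i t))
      + l2 (m.adΦ (m.adΦ s)) (m.adΦ (m.adΦ t))
      + l2 (m.adΦ (wt 1 s)) (m.adΦ (wt 1 t))
      + l2 (wt 2 s) (wt 2 t)

/-- The inner product of `H_k`, `k = 0, 1, 2`, on test sections. -/
def Configuration.sectionForm (m : Configuration 𝔤) (k : Fin 3) (c c' : TestSection 𝔤) : ℝ :=
  ∑ i, m.form k (c.1 i) (c'.1 i) + m.form k c.2 c'.2

/-! ### `Dstar` is the formal adjoint of `D` -/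

theorem l2_adΦ (m : Configuration 𝔤) (s t : TestFun 𝔤) :
    l2 (m.adΦ s) t = -l2 s (m.adΦ t) := by
  simp only [l2, ← integral_neg]
  exact integral_congr_ae (.of_forall fun x => InvariantLieAlgebra.inner_lie_left _ _ _)

theorem l2_nabla (m : Configuration 𝔤) (i : Fin 3) (s t : TestFun 𝔤) :
    l2 (m.nabla i s) t = -l2 s (m.nabla i t) := by
  have cd : ∀ s : TestFun 𝔤, ContDiff ℝ ∞ fun x => fderiv ℝ s.1 x (e i) := fun s =>
    (s.2.1.fderiv_right (m := ∞) (by simp)).clm_apply contDiff_const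
  let d : TestFun 𝔤 → TestFun 𝔤 := fun s =>
    ⟨fun x => fderiv ℝ s.1 x (e i), cd s, s.2.2.fderiv_apply (𝕜 := ℝ) (e i)⟩
  let b : TestFun 𝔤 → TestFun 𝔤 := fun s =>
    ⟨fun x => ⁅m.A i x, s.1 x⁆, contDiff_lie (m.smooth_A i) s.2.1, hasCompactSupport_lie s.2.2⟩
  have hn : ∀ s, m.nabla i s = d s + b s := fun s => rfl
  have hb : l2 (b s) t = -l2 s (b t) := by
    simp only [l2, ← integral_neg]
    exact integral_congr_ae (.of_forall fun x => InvariantLieAlgebra.inner_lie_left _ _ _)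
  have hd : l2 (d s) t = -l2 s (d t) := by
    have h := integral_bilinear_fderiv_right_eq_neg_left_of_integrable (μ := (volume : Measure E3))
      (f := s.1) (g := t.1) (v := e i) (B := innerSL ℝ)
      (integrable_inner (d s) t) (integrable_inner s (d t)) (integrable_inner s t)
      (fun x _ => s.2.1.differentiable (by simp) x) (fun x _ => t.2.1.differentiable (by simp) x)
    change ∫ x, inner ℝ (s.1 x) (fderiv ℝ t.1 x (e i))
      = -∫ x, inner ℝ (fderiv ℝ s.1 x (e i)) (t.1 x) at h
    change ∫ x, inner ℝ (fderiv ℝ s.1 x (e i)) (t.1 x)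
      = -∫ x, inner ℝ (s.1 x) (fderiv ℝ t.1 x (e i))
    rw [h, neg_neg]
  rw [hn, hn, l2_add, l2_symm s (d t + b t), l2_add, l2_symm (d t), l2_symm (b t), hb, hd]
  ring

theorem l2Section_D (m : Configuration 𝔤) (c c' : TestSection 𝔤) :
    m.sectionForm 0 (m.D c) c' = m.sectionForm 0 c (m.Dstar c') := by
  have hneg : ∀ s t : TestFun 𝔤, l2 (-s) t = -l2 s t := fun s t => by
    rw [← neg_one_smul ℝ s, l2_smul, neg_one_mul]
  have hadd' : ∀ s t t' : TestFun 𝔤, l2 s (t + t') = l2 s t + l2 s t' := fun s t t' => by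
    rw [l2_symm, l2_add, l2_symm t, l2_symm t']
  have hneg' : ∀ s t : TestFun 𝔤, l2 s (-t) = -l2 s t := fun s t => by
    rw [l2_symm, hneg, l2_symm]
  have e1 : (1 + 1 : Fin 3) = 2 := rfl
  have e2 : (1 + 2 : Fin 3) = 0 := rfl
  have e3 : (2 + 1 : Fin 3) = 0 := rfl
  have e4 : (2 + 2 : Fin 3) = 1 := rfl
  simp only [Configuration.sectionForm, Configuration.form, Configuration.D, Configuration.Dstar,
    LinearMap.coe_mk, AddHom.coe_mk, Fin.sum_univ_three, sub_eq_add_neg, l2_add, hneg, hadd', hneg',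
    l2_nabla, l2_adΦ, e1, e2, e3, e4, zero_add]
  ring

/-! ### The Hilbert spaces `H_k` and operators between them -/

theorem Configuration.form_symm (m : Configuration 𝔤) (k : Fin 3) (s t : TestFun 𝔤) :
    m.form k s t = m.form k t s := by
  fin_cases k <;> simp only [Configuration.form, l2_symm]

theorem Configuration.form_nonneg (m : Configuration 𝔤) (k : Fin 3) (s : TestFun 𝔤) :
    0 ≤ m.form k s s := by
  have h := l2_nonneg (𝔤 := 𝔤)
  have h1 : ∀ f : Fin 3 → TestFun 𝔤, 0 ≤ ∑ i, l2 (f i) (f i) := fun f =>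
    Finset.sum_nonneg fun i _ => h _
  have h2 : ∀ f : Fin 3 → Fin 3 → TestFun 𝔤, 0 ≤ ∑ i, ∑ j, l2 (f i j) (f i j) := fun f =>
    Finset.sum_nonneg fun i _ => h1 _
  fin_cases k
  · exact h s
  · exact add_nonneg (add_nonneg (h1 _) (h _)) (h _)
  · exact add_nonneg (add_nonneg (add_nonneg (add_nonneg (add_nonneg (h2 _) (h1 _)) (h1 _)) (h _))
      (h _)) (h _)

theorem Configuration.form_add (m : Configuration 𝔤) (k : Fin 3) (s s' t : TestFun 𝔤) :
    m.form k (s + s') t = m.form k s t + m.form k s' t := by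
  fin_cases k <;> simp only [Configuration.form, map_add, l2_add, Finset.sum_add_distrib] <;> ring

theorem Configuration.form_smul (m : Configuration 𝔤) (k : Fin 3) (r : ℝ) (s t : TestFun 𝔤) :
    m.form k (r • s) t = r * m.form k s t := by
  fin_cases k <;> simp only [Configuration.form, map_smul, l2_smul, ← Finset.mul_sum] <;> ring

/-- The space of test sections, endowed below with the norm of `H_k`. -/
def PreH (_m : Configuration 𝔤) (_k : Fin 3) : Type _ := TestSection 𝔤

variable (m : Configuration 𝔤) (k : Fin 3)

instance : AddCommGroup (PreH m k) := inferInstanceAs (AddCommGroup (TestSection 𝔤))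

instance : Module ℝ (PreH m k) := inferInstanceAs (Module ℝ (TestSection 𝔤))

instance instCorePreH : PreInnerProductSpace.Core ℝ (PreH m k) where
  inner c c' := m.sectionForm k c c'
  conj_inner_symm c c' := by
    simp only [Configuration.sectionForm, m.form_symm k, conj_trivial]
  re_inner_nonneg c :=
    add_nonneg (Finset.sum_nonneg fun i _ => m.form_nonneg k _) (m.form_nonneg k _)
  add_left c c' d := by
    change ∑ i, m.form k (c.1 i + c'.1 i) (d.1 i) + m.form k (c.2 + c'.2) d.2 = _
    simp only [Configuration.sectionForm, m.form_add, Finset.sum_add_distrib]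
    ring
  smul_left c c' r := by
    change ∑ i, m.form k (r • c.1 i) (c'.1 i) + m.form k (r • c.2) c'.2 = _
    simp only [Configuration.sectionForm, m.form_smul, ← Finset.mul_sum, conj_trivial]
    ring

instance : SeminormedAddCommGroup (PreH m k) :=
  InnerProductSpace.Core.toSeminormedAddCommGroup (𝕜 := ℝ)

instance : InnerProductSpace ℝ (PreH m k) := InnerProductSpace.ofCore (instCorePreH m k)

/-- The norm of `H_k` on test sections. -/
theorem norm_preH_sq (c : PreH m k) : ‖c‖ ^ 2 = m.sectionForm k c c := by
  rw [← real_inner_self_eq_norm_sq]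
  rfl

/-- The Hilbert space `H_k`, `k = 0, 1, 2`: the completion of the space of test sections. -/
abbrev H : Type _ := UniformSpace.Completion (PreH m k)

/-- The inclusion of the test sections as a dense subspace of `H_k`. -/
def toH (c : TestSection 𝔤) : H m k :=
  UniformSpace.Completion.coe' (α := PreH m k) c

theorem norm_toH_sq (c : TestSection 𝔤) : ‖toH m k c‖ ^ 2 = m.sectionForm k c c :=
  (congrArg (· ^ 2) (UniformSpace.Completion.norm_coe (E := PreH m k) c)).trans
    (norm_preH_sq m k c)

theorem denseRange_toH : DenseRange (toH m k) :=
  UniformSpace.Completion.denseRange_coe (α := PreH m k)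

/-- The operator `T`, given on test sections, is continuous and Fredholm from `H_j` to `H_k`:
it has a (necessarily unique) bounded linear extension `H_j → H_k`, which is a Fredholm operator. -/
def ContinuousFredholm (j k : Fin 3) (T : TestSection 𝔤 →ₗ[ℝ] TestSection 𝔤) : Prop :=
  ∃ T' : H m j →L[ℝ] H m k, (∀ c, T' (toH m j c) = toH m k (T c)) ∧ T'.IsFredholm

end Operators

end BogomolnyMonopole

end

/-!
The proof rests on a comparison of `D D^*` and `D^* D` with the Laplacian
`∇^*∇ - (ad Φ)²`, called `lap` below, which acts separately on the four components of a section.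
For a monopole `D D^*` is equal to it (`D_Dstar`), and `D^* D` differs from it by a zeroth order
term, twice the bracket with `d_∇ Φ` (`Dstar_D`).

The asymptotic hypotheses enter through the size of that term (`HasDecay`). It is `O(ρ⁻²)`, which
is not enough for compactness in the scale of spaces `H_k`. But the leading part
of `d_∇ Φ` is a multiple of `κ`, which lies in `ker (ad Φ_∞)`; as this kernel is Abelian, `ad κ`
vanishes on it, so that `|[κ, X]| ≤ C |[Φ_∞, X]|` (`exists_norm_lie_kappa_le`). The constant is
uniform over the sphere because `Φ_∞` is parallel: one polynomial in `ad Φ_∞` gives the projection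
to the kernel at all points. Hence
`|[∇ᵢΦ, X]| ≤ C (ρ⁻² |[Φ, X]| + ρ⁻³ |X|)`, and since the bracket with `Φ` is part of the norms,
both terms decay faster than the norms require.

*A priori estimates.* By Hardy's inequality `hardy` the energy `‖∇c‖² + ‖[Φ, c]‖²` controls the
`H₁` norm. It equals `‖D^* c‖²`, and it equals `‖D c‖²` up to the curvature term, which gives
`estimate_Dstar` and, with a remainder `ρ⁻² c`, `estimate_D`. Commuting with `∇ⱼ` and `[Φ, ·]` turns
these into estimates of the `H₂` norm (`estimate_two`), where the term `ρ⁻² c` of the norm is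
recovered from `hardy_two`. All remainders are compact by a weighted form of Rellich's theorem
(`exists_rellich`). Compactness is expressed by `FiniteRankControlled`: up to a small multiple of
the norm, the remainder is bounded by finitely many continuous functionals. This form passes
to completions without describing their elements. The estimates make the ranges closed and, as soon
as the range has finite codimension, the operator Fredholm (`isFredholm_of_estimate`).

*Cokernels.* The Laplacian has dense range in `L²` (`exists_nrm_zero_lap_sub_le`). Dirichlet's
principle gives a test function which solves the equation up to a small error in the dual of `H₁`,
with an `H₁` norm bounded independently of that error. A cutoff at a large radius and a
mollification turn this into a small error in `L²`: the cutoff commutes with the Laplacian up to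
`O(1/R)`, and mollification almost commutes with it on bounded regions by Friedrichs' lemma
(`almostCommutes_lap`). Thus `D D^*` is onto. As `D^* D` is a compact perturbation of it
with closed range, the range of `D^* D` has finite codimension (`cofg_range_of_perturbation`). The
first-order operators `H₁ → H₀` inherit this from the products, in which their ranges
contain those of `D D^*` and `D^* D`; the operators `H₂ → H₁` are Fredholm because their products
with Fredholm operators are (`isFredholm_of_comp`).
-/
noncomputable section
set_option linter.unusedSectionVars false

namespace BogomolnyMonopole

/-! ### Finite-rank control and Fredholm operators -/

section FredholmCriteria

/-- A nonnegative quantity `p` on a seminormed space is controlled by finite-rank maps if, up to an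
arbitrarily small multiple of the norm, it is bounded by finitely many continuous functionals.
For `p = ‖K ·‖` with `K` linear into a Hilbert space this is compactness of `K`. -/
def FiniteRankControlled {X : Type*} [SeminormedAddCommGroup X] [NormedSpace ℝ X]
    (p : X → ℝ) : Prop :=
  ∀ ε : ℝ, 0 < ε → ∃ (ι : Type) (_ : Fintype ι) (l : ι → X →L[ℝ] ℝ),
    ∀ x, p x ≤ ε * ‖x‖ + ∑ i, |l i x|

namespace FiniteRankControlled

variable {X Y : Type*} [SeminormedAddCommGroup X] [NormedSpace ℝ X]
  [SeminormedAddCommGroup Y] [NormedSpace ℝ Y]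

theorem mono {p q : X → ℝ} (hp : FiniteRankControlled p) (h : ∀ x, q x ≤ p x) :
    FiniteRankControlled q := fun ε hε => by
  obtain ⟨ι, _, l, hl⟩ := hp ε hε
  exact ⟨ι, inferInstance, l, fun x => (h x).trans (hl x)⟩

theorem add {p q : X → ℝ} (hp : FiniteRankControlled p) (hq : FiniteRankControlled q) :
    FiniteRankControlled fun x => p x + q x := fun ε hε => by
  obtain ⟨ι, _, l, hl⟩ := hp (ε / 2) (half_pos hε)
  obtain ⟨κ, _, k, hk⟩ := hq (ε / 2) (half_pos hε)
  refine ⟨ι ⊕ κ, inferInstance, Sum.elim l k, fun x => ?_⟩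
  have h1 := hl x
  have h2 := hk x
  simp only [Fintype.sum_sum_type, Sum.elim_inl, Sum.elim_inr]
  linarith

theorem const_mul {p : X → ℝ} (hp : FiniteRankControlled p) {C : ℝ} (hC : 0 ≤ C) :
    FiniteRankControlled fun x => C * p x := fun ε hε => by
  obtain ⟨ι, _, l, hl⟩ := hp (ε / (C + 1)) (by positivity)
  refine ⟨ι, inferInstance, fun i => C • l i, fun x => ?_⟩
  have h2 : C * (ε / (C + 1) * ‖x‖) ≤ ε * ‖x‖ := by
    rw [← mul_assoc]
    refine mul_le_mul_of_nonneg_right ?_ (norm_nonneg x)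
    rw [mul_div_assoc', div_le_iff₀ (by positivity)]
    nlinarith
  calc C * p x ≤ C * (ε / (C + 1) * ‖x‖ + ∑ i, |l i x|) := mul_le_mul_of_nonneg_left (hl x) hC
    _ ≤ ε * ‖x‖ + ∑ i, |(C • l i) x| := by
      simp only [FunLike.coe_smul, Pi.smul_apply, smul_eq_mul, abs_mul, abs_of_nonneg hC,
        ← Finset.mul_sum, mul_add]
      linarith

theorem sum {α : Type*} (s : Finset α) {p : α → X → ℝ}
    (hp : ∀ a ∈ s, FiniteRankControlled (p a)) :
    FiniteRankControlled fun x => ∑ a ∈ s, p a x := by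
  classical
  induction s using Finset.induction_on with
  | empty =>
    exact fun ε hε => ⟨Empty, inferInstance, Empty.elim, fun x => by simpa using by positivity⟩
  | insert a s ha ih =>
    simp only [Finset.sum_insert ha]
    exact (hp a (by simp)).add (ih fun b hb => hp b (by simp [hb]))

theorem comp {p : Y → ℝ} (hp : FiniteRankControlled p) (f : X →ₗ[ℝ] Y) {C : ℝ}
    (hC : ∀ x, ‖f x‖ ≤ C * ‖x‖) : FiniteRankControlled fun x => p (f x) := fun ε hε => by
  obtain ⟨ι, _, l, hl⟩ := hp (ε / (|C| + 1)) (by positivity)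
  refine ⟨ι, inferInstance, fun i => (l i).comp (f.mkContinuous C hC), fun x => (hl (f x)).trans ?_⟩
  refine add_le_add ?_ le_rfl
  rw [div_mul_eq_mul_div, div_le_iff₀ (by positivity), mul_assoc]
  refine mul_le_mul_of_nonneg_left ((hC x).trans ?_) hε.le
  nlinarith [le_abs_self C, norm_nonneg x]

end FiniteRankControlled

variable {X Z : Type*} [NormedAddCommGroup X] [NormedSpace ℝ X]
  [NormedAddCommGroup Z] [NormedSpace ℝ Z]

/-- The common kernel of the functionals in an a priori estimate is closed and of finite
codimension, and the operator is bounded below on it. -/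
theorem exists_closed_cofg_of_estimate (T : X →L[ℝ] Z) {C : ℝ} {ι : Type} [Fintype ι]
    (l : ι → X →L[ℝ] ℝ) (h : ∀ x, ‖x‖ ≤ C * ‖T x‖ + ∑ i, |l i x|) :
    ∃ X₀ : Submodule ℝ X, IsClosed (X₀ : Set X) ∧ X₀.CoFG ∧ ∀ x ∈ X₀, ‖x‖ ≤ C * ‖T x‖ := by
  refine ⟨(ContinuousLinearMap.pi l).ker, (ContinuousLinearMap.pi l).isClosed_ker,
    Submodule.CoFG.ker _, fun x hx => ?_⟩
  have hx' : ∀ i, l i x = 0 := fun i => congrFun (show ContinuousLinearMap.pi l x = 0 from hx) i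
  simpa [hx'] using h x

/-- If the range of `T` has finite codimension, so has the image of a subspace of finite
codimension. -/
theorem cofg_map_of_cofg (T : X →ₗ[ℝ] Z) {X₀ : Submodule ℝ X} (h₀ : X₀.CoFG)
    (hT : (LinearMap.range T).CoFG) : (X₀.map T).CoFG := by
  obtain ⟨W, hW⟩ := Submodule.exists_isCompl X₀
  obtain ⟨V, hV⟩ := Submodule.exists_isCompl (LinearMap.range T)
  have hWf := h₀.fg_of_isCompl hW
  have hVf := hT.fg_of_isCompl hV
  refine ((hWf.map T).sup hVf).cofg_of_codisjoint (codisjoint_iff.2 ?_)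
  rw [sup_comm, ← sup_assoc, ← Submodule.map_sup, hW.sup_eq_top, Submodule.map_top,
    hV.sup_eq_top]

variable [CompleteSpace X]

theorem isClosed_map_of_bounded_below (T : X →L[ℝ] Z) {C : ℝ} {X₀ : Submodule ℝ X}
    (hc : IsClosed (X₀ : Set X)) (h : ∀ x ∈ X₀, ‖x‖ ≤ C * ‖T x‖) :
    IsClosed (X₀.map (T : X →ₗ[ℝ] Z) : Set Z) := by
  have : CompleteSpace X₀ := hc.completeSpace_coe
  have ha : AntilipschitzWith C.toNNReal (T.comp X₀.subtypeL) :=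
    AddMonoidHomClass.antilipschitz_of_bound _ fun x => (h x x.2).trans
      (mul_le_mul_of_nonneg_right (Real.le_coe_toNNReal C) (norm_nonneg _))
  have := ha.isClosed_range (T.comp X₀.subtypeL).uniformContinuous
  convert this using 1
  ext z
  simp

/-- A semi-Fredholm estimate makes the range closed: it is the sum of the closed image of a subspace
on which `T` is bounded below and a finite-dimensional space. -/
theorem isClosed_range_of_estimate (T : X →L[ℝ] Z) {C : ℝ} {ι : Type} [Fintype ι]
    (l : ι → X →L[ℝ] ℝ) (h : ∀ x, ‖x‖ ≤ C * ‖T x‖ + ∑ i, |l i x|) :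
    IsClosed (T.range : Set Z) := by
  obtain ⟨X₀, hc, hf, hb⟩ := exists_closed_cofg_of_estimate T l h
  have h1 := isClosed_map_of_bounded_below T hc hb
  obtain ⟨W, hW⟩ := Submodule.exists_isCompl X₀
  have : FiniteDimensional ℝ (W.map (T : X →ₗ[ℝ] Z)) :=
    Module.Finite.iff_fg.2 ((hf.fg_of_isCompl hW).map _)
  have h2 := Submodule.isClosed_sup_finiteDimensional (X₀.map (T : X →ₗ[ℝ] Z))
    (W.map (T : X →ₗ[ℝ] Z)) h1
  rwa [← Submodule.map_sup, hW.sup_eq_top, Submodule.map_top] at h2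

/-- A semi-Fredholm estimate and a range of finite codimension give a Fredholm operator: `T`
restricts to an isomorphism between closed subspaces of finite codimension. -/
theorem isFredholm_of_estimate (T : X →L[ℝ] Z) {C : ℝ} {ι : Type} [Fintype ι]
    (l : ι → X →L[ℝ] ℝ) (h : ∀ x, ‖x‖ ≤ C * ‖T x‖ + ∑ i, |l i x|) (hT : T.range.CoFG) :
    T.IsFredholm := by
  obtain ⟨X₀, hc, hf, hb⟩ := exists_closed_cofg_of_estimate T l h
  have h1 := isClosed_map_of_bounded_below T hc hb
  have h2 : (X₀.map (T : X →ₗ[ℝ] Z)).CoFG := cofg_map_of_cofg _ hf hT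
  have hm : MapsTo T X₀ (X₀.map (T : X →ₗ[ℝ] Z)) := fun x hx => ⟨x, hx, rfl⟩
  refine ContinuousLinearMap.IsFredholm.of_isInvertible_restrict hc h1 hm ?_
  have hinj : Function.Injective (T.restrict hm) := by
    refine (injective_iff_map_eq_zero _).2 fun x hx => ?_
    have hx' : T x = 0 := congrArg Subtype.val hx
    have := hb x x.2
    rw [hx', norm_zero, mul_zero] at this
    exact Subtype.ext (norm_le_zero_iff.1 this)
  have hsurj : Function.Surjective (T.restrict hm) := by
    rintro ⟨_, x, hx, rfl⟩
    exact ⟨⟨x, hx⟩, rfl⟩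
  let e := LinearEquiv.ofBijective (T.restrict hm : X₀ →ₗ[ℝ] X₀.map (T : X →ₗ[ℝ] Z)) ⟨hinj, hsurj⟩
  have hes : ∀ y, ‖e.symm y‖ ≤ C * ‖y‖ := fun y => by
    have := hb (e.symm y) (e.symm y).2
    have h3 : T (e.symm y) = y := congrArg Subtype.val (e.apply_symm_apply y)
    rwa [h3] at this
  exact ⟨ContinuousLinearEquiv.mk e (T.restrict hm).continuous
    (AddMonoidHomClass.continuous_of_bound e.symm C hes), rfl⟩

/-- A perturbation of a surjective operator between Hilbert spaces by an operator which is
controlled by finite-rank maps has range of finite codimension, provided the range is closed.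
With a right inverse `R` of `T`, an element `y` orthogonal to the range of `S` satisfies
`‖y‖² = ⟪y, (T - S) R y⟫`, so that `y` is determined by finitely many functionals. -/
theorem cofg_range_of_perturbation {X Y : Type*} [NormedAddCommGroup X] [InnerProductSpace ℝ X]
    [CompleteSpace X] [NormedAddCommGroup Y] [InnerProductSpace ℝ Y] [CompleteSpace Y]
    (T S : X →L[ℝ] Y) (hT : Function.Surjective T)
    (hTS : FiniteRankControlled fun x => ‖T x - S x‖) (hS : IsClosed (S.range : Set Y)) :
    S.range.CoFG := by
  obtain ⟨R, hR⟩ : ∃ R : Y →L[ℝ] X, ∀ y, T (R y) = y := by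
    have : CompleteSpace T.ker := T.isClosed_ker.completeSpace_coe
    have hc := Submodule.isCompl_orthogonal (K := T.ker)
    let T₁ : T.kerᗮ →L[ℝ] Y := T.comp T.kerᗮ.subtypeL
    have hi : T₁.ker = ⊥ := by
      refine (Submodule.eq_bot_iff _).2 fun x hx => Subtype.ext ?_
      exact (Submodule.disjoint_def.1 hc.disjoint) x hx x.2
    have hs : T₁.range = ⊤ := by
      refine LinearMap.range_eq_top.2 fun y => ?_
      obtain ⟨x, rfl⟩ := hT y
      obtain ⟨a, ha, b, hb, rfl⟩ := Submodule.mem_sup.1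
        (show x ∈ T.ker ⊔ T.kerᗮ from hc.sup_eq_top ▸ Submodule.mem_top)
      refine ⟨⟨b, hb⟩, ?_⟩
      change T b = T (a + b)
      rw [map_add, show T a = 0 from ha, zero_add]
    let e := ContinuousLinearEquiv.ofBijective T₁ hi hs
    exact ⟨T.kerᗮ.subtypeL.comp (e.symm : Y →L[ℝ] T.kerᗮ), fun y => e.apply_symm_apply y⟩
  obtain ⟨ι, _, l, hl⟩ := hTS (1 / (2 * (‖R‖ + 1))) (by positivity)
  have : CompleteSpace S.range := hS.completeSpace_coe
  let f : S.rangeᗮ →ₗ[ℝ] (ι → ℝ) :=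
    (ContinuousLinearMap.pi fun i => (l i).comp R : Y →L[ℝ] (ι → ℝ)).toLinearMap.domRestrict _
  have hf : Function.Injective f := by
    refine (injective_iff_map_eq_zero _).2 fun y hy => ?_
    have hy' : ∀ i, l i (R y) = 0 := fun i => congrFun hy i
    have h1 : ‖(y : Y)‖ ^ 2 = inner ℝ (y : Y) (T (R y) - S (R y)) := by
      have h0 : inner ℝ (y : Y) (S (R y)) = 0 :=
        Submodule.inner_left_of_mem_orthogonal (K := S.range) ⟨R y, rfl⟩ y.2
      rw [inner_sub_right, hR, real_inner_self_eq_norm_sq, h0, sub_zero]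
    have h2 := hl (R y)
    simp only [hy', abs_zero, Finset.sum_const_zero, add_zero] at h2
    have h3 : 1 / (2 * (‖R‖ + 1)) * ‖R y‖ ≤ 1 / 2 * ‖(y : Y)‖ := by
      rw [div_mul_eq_mul_div, div_le_iff₀ (by positivity)]
      nlinarith [R.le_opNorm y, norm_nonneg (y : Y), norm_nonneg R]
    have h4 := real_inner_le_norm (y : Y) (T (R y) - S (R y))
    have h5 : ‖(y : Y)‖ ^ 2 ≤ ‖(y : Y)‖ * (1 / 2 * ‖(y : Y)‖) :=
      (h1.le.trans h4).trans (mul_le_mul_of_nonneg_left (h2.trans h3) (norm_nonneg _))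
    have h6 : ‖(y : Y)‖ ^ 2 = 0 := le_antisymm (by nlinarith) (sq_nonneg _)
    exact Subtype.ext (norm_eq_zero.1 (pow_eq_zero_iff two_ne_zero |>.1 h6))
  have : FiniteDimensional ℝ S.rangeᗮ := FiniteDimensional.of_injective f hf
  exact (Module.Finite.iff_fg.1 this).cofg_of_isCompl
    (Submodule.isCompl_orthogonal (K := S.range)).symm

section Completion

open UniformSpace

variable {P Q : Type*} [SeminormedAddCommGroup P] [InnerProductSpace ℝ P]
  [SeminormedAddCommGroup Q] [InnerProductSpace ℝ Q]

/-- A bounded operator extends to the completions. -/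
theorem exists_completion_extension (T : P →ₗ[ℝ] Q) {C : ℝ} (hT : ∀ c, ‖T c‖ ≤ C * ‖c‖) :
    ∃ T' : Completion P →L[ℝ] Completion Q, ∀ c : P, T' c = (T c : Completion Q) := by
  let T₀ : P →L[ℝ] Completion Q := Completion.toComplL.comp (T.mkContinuous C hT)
  refine ⟨T₀.extend Completion.toComplL, fun c => ?_⟩
  exact T₀.extend_eq (e := Completion.toComplL) Completion.denseRange_coe
    (Completion.isUniformInducing_coe P) c

/-- A bound by finitely many functionals extends from a space to its completion. -/
theorem extend_bound_to_completion {g : Completion P → ℝ} (hg : Continuous g) {ι : Type}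
    [Fintype ι] (l : ι → P →L[ℝ] ℝ) {ε : ℝ} (h : ∀ c : P, g c ≤ ε * ‖c‖ + ∑ i, |l i c|) :
    ∃ l' : ι → Completion P →L[ℝ] ℝ, ∀ x, g x ≤ ε * ‖x‖ + ∑ i, |l' i x| := by
  let l' : ι → Completion P →L[ℝ] ℝ := fun i => (l i).extend Completion.toComplL
  have hl' : ∀ i (c : P), l' i c = l i c := fun i c =>
    (l i).extend_eq (e := Completion.toComplL) Completion.denseRange_coe
      (Completion.isUniformInducing_coe P) c
  refine ⟨l', fun x => ?_⟩
  induction x using Completion.induction_on with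
  | hp => exact isClosed_le hg (by fun_prop)
  | ih c => simpa [hl'] using h c

theorem FiniteRankControlled.completion {g : Completion P → ℝ} (hg : Continuous g)
    (h : FiniteRankControlled fun c : P => g c) : FiniteRankControlled g := fun ε hε => by
  obtain ⟨ι, _, l, hl⟩ := h ε hε
  obtain ⟨l', hl'⟩ := extend_bound_to_completion hg l hl
  exact ⟨ι, inferInstance, l', hl'⟩

/-- An a priori estimate with a compact remainder, known on a dense subspace, becomes on the
completion an estimate with finitely many functionals: half of the norm absorbs the rest. -/
theorem exists_estimate_on_completion (T : P → Q) (T' : Completion P →L[ℝ] Completion Q)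
    (hT : ∀ c : P, T' c = (T c : Completion Q)) {C : ℝ} {p : P → ℝ}
    (hp : FiniteRankControlled p) (h : ∀ c, ‖c‖ ≤ C * ‖T c‖ + p c) :
    ∃ (ι : Type) (_ : Fintype ι) (l : ι → Completion P →L[ℝ] ℝ),
      ∀ x, ‖x‖ ≤ (2 * C) * ‖T' x‖ + ∑ i, |l i x| := by
  obtain ⟨ι, _, l, hl⟩ := hp (1 / 2) (by norm_num)
  have hg : Continuous fun x : Completion P => ‖x‖ - C * ‖T' x‖ := by fun_prop
  obtain ⟨l', hl'⟩ := extend_bound_to_completion hg l (ε := 1 / 2) fun c => by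
    have h1 := h c
    have h2 := hl c
    simp only [hT, Completion.norm_coe]
    linarith
  refine ⟨ι, inferInstance, fun i => (2 : ℝ) • l' i, fun x => ?_⟩
  have := hl' x
  simp only [FunLike.coe_smul, Pi.smul_apply, smul_eq_mul, abs_mul, ← Finset.mul_sum,
    abs_two]
  linarith

end Completion

end FredholmCriteria

/-! ### Pointwise decay of the derivative of the Higgs field -/

section PointwiseDecay

open Polynomial

variable {𝔤 : Type*} [InvariantLieAlgebra 𝔤]

theorem inner_lie_self_left (X Y Z : 𝔤) : inner ℝ ⁅X, Y⁆ Z = -inner ℝ Y ⁅X, Z⁆ :=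
  InvariantLieAlgebra.inner_lie_left X Y Z

theorem endL_mul_apply (S T : 𝔤 →L[ℝ] 𝔤) (X : 𝔤) : (S * T) X = S (T X) := rfl

variable [FiniteDimensional ℝ 𝔤]

theorem norm_lie_le (X Y : 𝔤) : ‖⁅X, Y⁆‖ ≤ ‖bracketL (𝔤 := 𝔤)‖ * ‖X‖ * ‖Y‖ := by
  simpa using (bracketL (𝔤 := 𝔤)).le_opNorm₂ X Y

/-- As `ad Φ` is skew, its generalised kernel is its kernel. -/
theorem lie_pow_ker (Φ : 𝔤) (k : ℕ) (X : 𝔤) (h : (bracketL Φ ^ (k + 1)) X = 0) : ⁅Φ, X⁆ = 0 := by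
  induction k generalizing X with
  | zero => simpa using h
  | succ k ih =>
    have h1 : ⁅Φ, ⁅Φ, X⁆⁆ = 0 := ih ⁅Φ, X⁆ (by
      rw [pow_succ] at h
      simpa using h)
    have h2 : inner ℝ ⁅Φ, X⁆ ⁅Φ, X⁆ = 0 := by
      rw [inner_lie_self_left, h1, inner_zero_right, neg_zero]
    exact inner_self_eq_zero.1 h2

/-- Since `ad Φ` is skew, `0` is at most a simple root of its minimal polynomial. -/
theorem exists_polynomial_ker_projection (Φ : 𝔤) :
    ∃ r : ℝ[X], r.eval 0 = 1 ∧ bracketL Φ * aeval (bracketL Φ) r = 0 := by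
  have hint : IsIntegral ℝ (bracketL Φ) := by
    have : Module.Finite ℝ (𝔤 →L[ℝ] 𝔤) := inferInstance
    exact Algebra.IsIntegral.isIntegral _
  have hp0 : minpoly ℝ (bracketL Φ) ≠ 0 := minpoly.ne_zero hint
  obtain ⟨q, hq, hnd⟩ := exists_eq_pow_rootMultiplicity_mul_and_not_dvd _ hp0 (0 : ℝ)
  set k := rootMultiplicity 0 (minpoly ℝ (bracketL Φ))
  have hq0 : q.eval 0 ≠ 0 := fun h => hnd (dvd_iff_isRoot.2 h)
  have hann : bracketL Φ ^ k * aeval (bracketL Φ) q = 0 := by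
    have := minpoly.aeval ℝ (bracketL Φ)
    rw [hq] at this
    simpa using this
  refine ⟨C (q.eval 0)⁻¹ * q, by simp [hq0], ?_⟩
  ext X
  simp only [map_mul, aeval_C, Algebra.algebraMap_eq_smul_one, smul_mul_assoc, one_mul,
    mul_smul_comm, smul_apply, zero_apply]
  rw [smul_eq_zero]
  refine Or.inr (lie_pow_ker Φ k _ ?_)
  have := DFunLike.congr_fun hann X
  rw [pow_succ', endL_mul_apply]
  exact (congrArg (bracketL Φ) this).trans (map_zero _)

/-- The transpose of `p(ad Φ)` is `p(-ad Φ)`. -/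
theorem inner_aeval_bracketL (Φ : 𝔤) (p : ℝ[X]) (X Y : 𝔤) :
    inner ℝ (aeval (bracketL Φ) (p.comp (-Polynomial.X)) X) Y
      = inner ℝ X (aeval (bracketL Φ) p Y) := by
  induction p using Polynomial.induction_on' with
  | add p q hp hq => simp [inner_add_left, inner_add_right, hp, hq]
  | monomial n c =>
    have h : ∀ (n : ℕ) (X Y : 𝔤), inner ℝ (((-bracketL Φ) ^ n) X) Y
        = inner ℝ X ((bracketL Φ ^ n) Y) := fun n => by
      induction n with
      | zero => simp
      | succ n ih =>
        intro X Y
        rw [pow_succ', pow_succ]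
        simp only [endL_mul_apply, neg_apply, bracketL_apply, inner_neg_left,
          inner_lie_self_left, neg_neg]
        exact ih X _
    simp only [← C_mul_X_pow_eq_monomial, Algebra.algebraMap_eq_smul_one, mul_comp, C_comp,
      pow_comp, X_comp, map_mul, map_pow, map_neg, aeval_C, aeval_X, smul_mul_assoc, one_mul,
      smul_apply, inner_smul_left, inner_smul_right, h, conj_trivial]

/-- The trace as a continuous functional on `End 𝔤`. -/
def traceL : (𝔤 →L[ℝ] 𝔤) →L[ℝ] ℝ :=
  LinearMap.toContinuousLinearMap
    ((LinearMap.trace ℝ 𝔤).comp (ContinuousLinearMap.coeLM ℝ))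

theorem traceL_apply (T : 𝔤 →L[ℝ] 𝔤) : traceL T = LinearMap.trace ℝ 𝔤 (T : 𝔤 →ₗ[ℝ] 𝔤) := rfl

theorem traceL_mul_comm (S T : 𝔤 →L[ℝ] 𝔤) : traceL (S * T) = traceL (T * S) :=
  LinearMap.trace_mul_comm ℝ (S : Module.End ℝ 𝔤) (T : Module.End ℝ 𝔤)

/-- A polynomial `p(ad Φ)` in the skew map `ad Φ` vanishes as soon as the trace of
`p(ad Φ)ᵀ p(ad Φ)`, its Hilbert–Schmidt norm, does. -/
theorem traceL_aeval_eq_zero_iff (Φ : 𝔤) (p : ℝ[X]) :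
    traceL (aeval (bracketL Φ) (p.comp (-Polynomial.X) * p)) = 0 ↔ aeval (bracketL Φ) p = 0 := by
  let b := stdOrthonormalBasis ℝ 𝔤
  have h : traceL (aeval (bracketL Φ) (p.comp (-Polynomial.X) * p))
      = ∑ i, ‖aeval (bracketL Φ) p (b i)‖ ^ 2 := by
    rw [traceL_apply, LinearMap.trace_eq_sum_inner _ b]
    refine Finset.sum_congr rfl fun i _ => ?_
    rw [← real_inner_self_eq_norm_sq, ← inner_aeval_bracketL, real_inner_comm, map_mul]
    rfl
  rw [h, Finset.sum_eq_zero_iff_of_nonneg fun _ _ => sq_nonneg _]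
  refine ⟨fun h0 => ?_, fun h0 => by simp [h0]⟩
  have : (aeval (bracketL Φ) p : 𝔤 →ₗ[ℝ] 𝔤) = 0 := b.toBasis.ext fun i => by
    simpa using h0 i (Finset.mem_univ i)
  exact ContinuousLinearMap.coe_injective this

variable {a : Fin 3 → E3 → 𝔤} {Φinf κ : E3 → 𝔤}

theorem eq_sum_smul_e (v : E3) : v = ∑ i, v i • e i := by
  ext j
  simp [e, Finset.sum_apply, Pi.single_apply]

/-- If `Φ_∞` is parallel, every polynomial in `ad Φ_∞` is parallel too. -/
theorem hasFDerivAt_aeval_bracketL (hs : IsSphereSection Φinf)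
    (hp : ∀ (i : Fin 3) (x : E3), x ≠ 0 → covDeriv a i Φinf x = 0) (p : ℝ[X]) {x : E3}
    (hx : x ≠ 0) : ∃ G : E3 →L[ℝ] 𝔤 →L[ℝ] 𝔤,
      HasFDerivAt (fun y => aeval (bracketL (Φinf y)) p) G x ∧ ∀ v,
        G v = aeval (bracketL (Φinf x)) p * bracketL (∑ i, v i • a i x)
          - bracketL (∑ i, v i • a i x) * aeval (bracketL (Φinf x)) p := by
  have hd : DifferentiableAt ℝ Φinf x := (hs.smooth.contDiffAt
    (isOpen_compl_singleton.mem_nhds hx)).differentiableAt (by simp)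
  have hN : HasFDerivAt (fun y => bracketL (Φinf y))
      ((bracketL (𝔤 := 𝔤)).comp (fderiv ℝ Φinf x)) x :=
    (bracketL (𝔤 := 𝔤)).hasFDerivAt.comp x hd.hasFDerivAt
  have hN' : ∀ v, (bracketL (𝔤 := 𝔤)).comp (fderiv ℝ Φinf x) v
      = bracketL (Φinf x) * bracketL (∑ i, v i • a i x)
        - bracketL (∑ i, v i • a i x) * bracketL (Φinf x) := fun v => by
    have h1 : fderiv ℝ Φinf x v = ⁅Φinf x, ∑ i, v i • a i x⁆ := by
      conv_lhs => rw [eq_sum_smul_e v]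
      simp only [map_sum, map_smul, lie_sum, lie_smul]
      refine Finset.sum_congr rfl fun i _ => ?_
      rw [eq_neg_of_add_eq_zero_left (hp i x hx), lie_skew]
    ext Y
    simp only [ContinuousLinearMap.comp_apply, h1, sub_apply, endL_mul_apply,
      bracketL_apply]
    rw [lie_lie]
  have hpow : ∀ n : ℕ, ∃ G : E3 →L[ℝ] 𝔤 →L[ℝ] 𝔤,
      HasFDerivAt (fun y => bracketL (Φinf y) ^ n) G x ∧ ∀ v,
        G v = bracketL (Φinf x) ^ n * bracketL (∑ i, v i • a i x)
          - bracketL (∑ i, v i • a i x) * bracketL (Φinf x) ^ n := fun n => by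
    induction n with
    | zero => exact ⟨0, by simpa using hasFDerivAt_const _ _, fun v => by simp⟩
    | succ n ih =>
      obtain ⟨G, hG, hG'⟩ := ih
      refine ⟨_, by simp only [pow_succ]; exact hG.mul' hN, fun v => ?_⟩
      simp only [add_apply, smul_apply, smul_eq_mul, hN', hG', op_smul_eq_mul, pow_succ]
      noncomm_ring
  induction p using Polynomial.induction_on' with
  | add p q hp hq =>
    obtain ⟨G, hG, hG'⟩ := hp
    obtain ⟨K, hK, hK'⟩ := hq
    refine ⟨G + K, by simp only [map_add]; exact hG.add hK, fun v => ?_⟩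
    simp only [add_apply, hG', hK', map_add]
    noncomm_ring
  | monomial n c =>
    obtain ⟨G, hG, hG'⟩ := hpow n
    refine ⟨c • G, ?_, fun v => ?_⟩
    · simp only [← C_mul_X_pow_eq_monomial, Algebra.algebraMap_eq_smul_one, map_mul, map_pow,
        aeval_C, aeval_X, smul_mul_assoc, one_mul]
      exact hG.const_smul c
    · simp [← C_mul_X_pow_eq_monomial, Algebra.algebraMap_eq_smul_one, hG', smul_sub]

/-- The polynomials annihilating `ad Φ_∞` at one point of the sphere at infinity annihilate it
everywhere. -/
theorem aeval_bracketL_eq_zero_of_parallel (hs : IsSphereSection Φinf)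
    (hp : ∀ (i : Fin 3) (x : E3), x ≠ 0 → covDeriv a i Φinf x = 0) (p : ℝ[X]) {x y : E3}
    (hx : x ≠ 0) (hy : y ≠ 0) (h : aeval (bracketL (Φinf x)) p = 0) :
    aeval (bracketL (Φinf y)) p = 0 := by
  rw [← traceL_aeval_eq_zero_iff] at h ⊢
  rw [← h]
  have hder : ∀ z : E3, z ≠ 0 → HasFDerivAt
      (fun w => traceL (aeval (bracketL (Φinf w)) (p.comp (-Polynomial.X) * p)))
      (0 : E3 →L[ℝ] ℝ) z := by
    intro z hz
    obtain ⟨G, hG, hG'⟩ := hasFDerivAt_aeval_bracketL hs hp (p.comp (-Polynomial.X) * p) hz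
    have h0 : (traceL (𝔤 := 𝔤)).comp G = 0 := by
      ext v
      simp [hG', traceL_mul_comm]
    exact h0 ▸ (traceL (𝔤 := 𝔤)).hasFDerivAt.comp z hG
  refine IsOpen.is_const_of_fderiv_eq_zero (𝕜 := ℝ) (s := ({0}ᶜ : Set E3)) isOpen_compl_singleton
    (isConnected_compl_singleton_of_one_lt_rank ?_ 0).isPreconnected
    (fun z hz => (hder z hz).differentiableAt.differentiableWithinAt)
    (fun z hz => (hder z hz).fderiv) hy hx
  rw [← Module.finrank_eq_rank]
  simp

/-- A continuous function which is constant on rays is bounded by its maximum over the unit sphere.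
-/
theorem exists_bound_of_homogeneous {V : Type*} [NormedAddCommGroup V] {f : E3 → V}
    (hc : ContinuousOn f {0}ᶜ) (hh : ∀ (t : ℝ) (x : E3), 0 < t → x ≠ 0 → f (t • x) = f x) :
    ∃ C : ℝ, 0 ≤ C ∧ ∀ x, x ≠ 0 → ‖f x‖ ≤ C := by
  obtain ⟨C, hC⟩ := (isCompact_sphere (0 : E3) 1).exists_bound_of_continuousOn
    (hc.mono fun x hx => by
      rintro rfl
      simp at hx)
  refine ⟨max C 0, le_max_right _ _, fun x hx => ?_⟩
  have hn : 0 < ‖x‖ := norm_pos_iff.2 hx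
  rw [← hh ‖x‖⁻¹ x (inv_pos.2 hn) hx]
  refine (hC _ ?_).trans (le_max_left _ _)
  simp [norm_smul, hn.ne']

/-- With `ad Φ_∞` annihilated by `t r(t)`, `r(0) = 1`, the map `r(ad Φ_∞)` projects to
`ker (ad Φ_∞)`, which commutes with `κ`; the rest of `X` is bounded by `[Φ_∞, X]`. -/
theorem exists_norm_lie_kappa_le (hΦ : IsSphereSection Φinf) (hκ : IsSphereSection κ)
    (hp : ∀ (i : Fin 3) (x : E3), x ≠ 0 → covDeriv a i Φinf x = 0)
    (hcomm : ∀ x : E3, x ≠ 0 → ⁅Φinf x, κ x⁆ = 0) (hS : MaximalSymmetryBreaking Φinf) :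
    ∃ C : ℝ, 0 ≤ C ∧ ∀ x, x ≠ 0 → ∀ X : 𝔤, ‖⁅κ x, X⁆‖ ≤ C * ‖⁅Φinf x, X⁆‖ := by
  have h0 : e 0 ≠ 0 := by
    intro h
    simpa [e] using congrArg (fun v : E3 => v 0) h
  obtain ⟨r, hr0, hr⟩ := exists_polynomial_ker_projection (Φinf (e 0))
  have hr' : ∀ x, x ≠ 0 → bracketL (Φinf x) * aeval (bracketL (Φinf x)) r = 0 := fun x hx => by
    have := aeval_bracketL_eq_zero_of_parallel hΦ hp (Polynomial.X * r) h0 hx (by simpa using hr)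
    simpa using this
  obtain ⟨h, hh⟩ : Polynomial.X ∣ 1 - r := by
    rw [X_dvd_iff, coeff_zero_eq_eval_zero]
    simp [hr0]
  have hcont : ContinuousOn (fun x => bracketL (κ x) * aeval (bracketL (Φinf x)) h) {0}ᶜ := by
    refine ((bracketL (𝔤 := 𝔤)).continuous.comp_continuousOn hκ.smooth.continuousOn).mul ?_
    exact (h.continuous_aeval).comp_continuousOn
      ((bracketL (𝔤 := 𝔤)).continuous.comp_continuousOn hΦ.smooth.continuousOn)
  obtain ⟨C, hC0, hC⟩ := exists_bound_of_homogeneous hcont fun t x ht hx => by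
    rw [hκ.homogeneous t x ht hx, hΦ.homogeneous t x ht hx]
  refine ⟨C, hC0, fun x hx X => ?_⟩
  have hX : X = aeval (bracketL (Φinf x)) r X + aeval (bracketL (Φinf x)) h ⁅Φinf x, X⁆ := by
    have h1 : aeval (bracketL (Φinf x)) (1 - r) X
        = aeval (bracketL (Φinf x)) (h * Polynomial.X) X := by rw [hh, mul_comm]
    simp only [map_sub, map_one, map_mul, aeval_X, sub_apply, endL_mul_apply,
      one_apply_eq_self, bracketL_apply] at h1
    rw [← h1]
    abel
  have hker : ⁅κ x, aeval (bracketL (Φinf x)) r X⁆ = 0 :=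
    hS x hx _ _ (hcomm x hx) (by simpa using DFunLike.congr_fun (hr' x hx) X)
  calc ‖⁅κ x, X⁆‖ = ‖(bracketL (κ x) * aeval (bracketL (Φinf x)) h) ⁅Φinf x, X⁆‖ := by
        conv_lhs => rw [hX, lie_add, hker, zero_add]
        rfl
    _ ≤ C * ‖⁅Φinf x, X⁆‖ := (ContinuousLinearMap.le_opNorm _ _).trans
        (mul_le_mul_of_nonneg_right (hC x hx) (norm_nonneg _))

theorem one_le_rho (x : E3) : 1 ≤ rho x := by
  rw [rho, Real.one_le_sqrt]
  nlinarith [sq_nonneg ‖x‖]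

theorem rho_sq (x : E3) : rho x ^ 2 = 1 + ‖x‖ ^ 2 := Real.sq_sqrt (by positivity)

theorem norm_le_rho (x : E3) : ‖x‖ ≤ rho x :=
  Real.le_sqrt_of_sq_le (by linarith)

theorem rho_le_two_mul_norm {x : E3} (hx : 1 ≤ ‖x‖) : rho x ≤ 2 * ‖x‖ := by
  rw [rho, Real.sqrt_le_left (by positivity)]
  nlinarith

theorem rho_le_of_norm_le {x : E3} {r : ℝ} (hr : 0 ≤ r) (hx : ‖x‖ ≤ r) : rho x ≤ 1 + r := by
  rw [rho, Real.sqrt_le_left (by positivity)]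
  nlinarith [norm_nonneg x]

/-- What the asymptotic expansion and maximal symmetry breaking contribute to the analysis:
`d_∇ Φ` decays quadratically and its bracket cubically, up to a quadratically decaying multiple
of the bracket with `Φ`. -/
structure Configuration.HasDecay (m : Configuration 𝔤) (C : ℝ) : Prop where
  nonneg : 0 ≤ C
  norm_covDeriv : ∀ (i : Fin 3) (x : E3), ‖covDeriv m.A i m.Φ x‖ ≤ C * (rho x ^ 2)⁻¹
  norm_lie_covDeriv : ∀ (i : Fin 3) (x : E3) (X : 𝔤), ‖⁅covDeriv m.A i m.Φ x, X⁆‖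
    ≤ C * ((rho x ^ 2)⁻¹ * ‖⁅m.Φ x, X⁆‖ + (rho x ^ 3)⁻¹ * ‖X‖)

theorem Configuration.contDiff_covDeriv (m : Configuration 𝔤) {s : E3 → 𝔤} (hs : ContDiff ℝ ∞ s)
    (i : Fin 3) : ContDiff ℝ ∞ (covDeriv m.A i s) :=
  ((hs.fderiv_right (m := ∞) (by simp)).clm_apply contDiff_const).add
    (contDiff_lie (m.smooth_A i) hs)

theorem abs_apply_div_norm_le_one (x : E3) (i : Fin 3) : |x i / ‖x‖| ≤ 1 := by
  rw [abs_div, abs_norm]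
  exact div_le_one_of_le₀ (by simpa using PiLp.norm_apply_le x i) (norm_nonneg x)

/-- The decay estimate outside a large ball. -/
theorem Configuration.HasAsymptotics.exists_decay_at_infinity {m : Configuration 𝔤} {R : ℝ}
    {u : E3 → 𝔤 →L[ℝ] 𝔤} (hA : m.HasAsymptotics R u a Φinf κ) (hS : MaximalSymmetryBreaking Φinf) :
    ∃ C R₁ : ℝ, 0 ≤ C ∧ 1 ≤ R₁ ∧ ∀ x, R₁ ≤ ‖x‖ → ∀ i : Fin 3,
      ‖covDeriv m.A i m.Φ x‖ ≤ C * (‖x‖ ^ 2)⁻¹ ∧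
      ∀ X : 𝔤, ‖⁅covDeriv m.A i m.Φ x, X⁆‖
        ≤ C * ((‖x‖ ^ 2)⁻¹ * ‖⁅m.Φ x, X⁆‖ + (‖x‖ ^ 3)⁻¹ * ‖X‖) := by
  obtain ⟨C₁, hC₁, hκΦ⟩ := exists_norm_lie_kappa_le hA.section_Φinf hA.section_κ hA.parallel
    hA.commute hS
  obtain ⟨K, hK0, hK⟩ := exists_bound_of_homogeneous hA.section_κ.smooth.continuousOn
    hA.section_κ.homogeneous
  obtain ⟨c₀, hc₀, h₀⟩ := hA.higgs.exists_pos
  choose c hc h₁ using fun i => (hA.covDeriv_higgs i).exists_pos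
  have hev := h₀.bound.and (Filter.eventually_all.2 fun i => (h₁ i).bound)
  obtain ⟨R₂, -, hR₂⟩ := (Filter.hasBasis_cobounded_norm.eventually_iff).1 hev
  set b := ‖bracketL (𝔤 := 𝔤)‖
  have hb : 0 ≤ b := norm_nonneg (bracketL (𝔤 := 𝔤))
  set d := ∑ i, c i
  have hd : ∀ i, c i ≤ d := fun i =>
    Finset.single_le_sum (f := c) (fun j _ => (hc j).le) (Finset.mem_univ i)
  have hd0 : 0 ≤ d := (hc 0).le.trans (hd 0)
  refine ⟨K + d + C₁ + C₁ * (b * (K + c₀)) + b * d, max (R + 1) (max R₂ 1), by positivity,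
    (le_max_right _ _).trans (le_max_right _ _), fun x hx i => ?_⟩
  have hxR : R < ‖x‖ := by linarith [(le_max_left (R + 1) (max R₂ 1)).trans hx]
  have hx1 : 1 ≤ ‖x‖ := ((le_max_right R₂ 1).trans (le_max_right _ _)).trans hx
  have hx2 : R₂ ≤ ‖x‖ := ((le_max_left R₂ 1).trans (le_max_right _ _)).trans hx
  have hx0 : x ≠ 0 := norm_pos_iff.1 (by linarith)
  obtain ⟨hΦ, hder⟩ := hR₂ hx2
  have hnorm := hA.framing.norm_map x hxR
  have hlie := hA.framing.map_lie x hxR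
  set r := ‖x‖
  have hr0 : 0 < r := by linarith
  have hri : r⁻¹ ≤ 1 := inv_le_one_of_one_le₀ hx1
  have hri0 : 0 < r⁻¹ := inv_pos.2 hr0
  rw [Real.norm_of_nonneg (by positivity)] at hΦ
  have hder' := hder i
  rw [Real.norm_of_nonneg (by positivity)] at hder'
  have hz2 : r ^ (-2 : ℤ) = r⁻¹ ^ 2 := by rw [zpow_neg, inv_pow]; rfl
  have hz3 : r ^ (-3 : ℤ) = r⁻¹ ^ 3 := by rw [zpow_neg, inv_pow]; rfl
  rw [hz2] at hΦ
  rw [hz3] at hder'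
  rw [← inv_pow, ← inv_pow]
  set t := r⁻¹
  have ht2 : t ^ 2 ≤ t := by nlinarith
  have ht3 : t ^ 3 ≤ t ^ 2 := by nlinarith [sq_nonneg t]
  set q := 1 / (2 * r ^ 2) * (x i / r)
  have hq : |q| ≤ t ^ 2 := by
    have h2 : 1 / (2 * r ^ 2) = t ^ 2 / 2 := by simp only [t]; field_simp
    rw [abs_mul, h2, abs_of_nonneg (by positivity)]
    nlinarith [abs_apply_div_norm_le_one x i, sq_nonneg t, abs_nonneg (x i / ‖x‖)]
  set w := u x
  set v := covDeriv m.A i m.Φ x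
  have hwv : w v = q • κ x + (w v - q • κ x) := by abel
  have hcd : c i * t ^ 3 ≤ d * t ^ 3 := mul_le_mul_of_nonneg_right (hd i) (by positivity)
  refine ⟨?_, fun X => ?_⟩
  · have h1 : ‖v‖ ≤ t ^ 2 * K + d * t ^ 3 := by
      rw [← hnorm v, hwv]
      refine (norm_add_le _ _).trans (add_le_add ?_ (hder'.trans hcd))
      rw [norm_smul]
      exact mul_le_mul hq (hK x hx0) (norm_nonneg _) (by positivity)
    have h2 : d * t ^ 3 ≤ d * t ^ 2 := mul_le_mul_of_nonneg_left ht3 hd0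
    have h3 : 0 ≤ (C₁ + C₁ * (b * (K + c₀)) + b * d) * t ^ 2 := by positivity
    nlinarith
  · have h1 : ‖⁅v, X⁆‖ ≤ t ^ 2 * ‖⁅κ x, w X⁆‖ + b * d * t ^ 3 * ‖X‖ := by
      rw [← hnorm ⁅v, X⁆, hlie, hwv, add_lie, smul_lie]
      refine (norm_add_le _ _).trans (add_le_add ?_ ?_)
      · rw [norm_smul]
        exact mul_le_mul_of_nonneg_right hq (norm_nonneg _)
      · refine (norm_lie_le _ _).trans ?_
        rw [hnorm X]
        refine mul_le_mul_of_nonneg_right ?_ (norm_nonneg _)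
        rw [mul_assoc]
        exact mul_le_mul_of_nonneg_left (hder'.trans hcd) hb
    have h2 : ‖⁅Φinf x, w X⁆‖ ≤ ‖⁅m.Φ x, X⁆‖ + b * (K + c₀) * t * ‖X‖ := by
      have h3 : Φinf x = w (m.Φ x) + ((1 / (2 * r)) • κ x
          - (w (m.Φ x) - (Φinf x - (1 / (2 * r)) • κ x))) := by abel
      have h4 : ‖⁅w (m.Φ x), w X⁆‖ = ‖⁅m.Φ x, X⁆‖ := by rw [← hlie, hnorm]
      conv_lhs => rw [h3, add_lie]
      refine (norm_add_le _ _).trans (add_le_add h4.le ?_)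
      refine (norm_lie_le _ _).trans ?_
      rw [hnorm X]
      refine mul_le_mul_of_nonneg_right ?_ (norm_nonneg _)
      rw [mul_assoc]
      refine mul_le_mul_of_nonneg_left ((norm_sub_le _ _).trans ?_) hb
      have h5 : ‖(1 / (2 * r)) • κ x‖ ≤ t * K := by
        rw [norm_smul]
        have h6 : 1 / (2 * r) = t / 2 := by simp only [t]; field_simp
        rw [h6, Real.norm_of_nonneg (by positivity)]
        nlinarith [hK x hx0, norm_nonneg (κ x)]
      have h7 : c₀ * t ^ 2 ≤ c₀ * t := mul_le_mul_of_nonneg_left ht2 hc₀.le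
      linarith [hΦ.trans h7]
    have h3 : t ^ 2 * ‖⁅κ x, w X⁆‖ ≤ t ^ 2 * (C₁ * (‖⁅m.Φ x, X⁆‖ + b * (K + c₀) * t * ‖X‖)) :=
      mul_le_mul_of_nonneg_left
        ((hκΦ x hx0 _).trans (mul_le_mul_of_nonneg_left h2 hC₁)) (by positivity)
    have h4 : 0 ≤ (K + d + C₁ * (b * (K + c₀)) + b * d) * (t ^ 2 * ‖⁅m.Φ x, X⁆‖) := by positivity
    have h5 : 0 ≤ (K + d + C₁) * (t ^ 3 * ‖X‖) := by positivity
    calc ‖⁅v, X⁆‖ ≤ _ := h1.trans (add_le_add h3 le_rfl)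
      _ ≤ _ := by linear_combination h4 + h5

/-- Outside a large ball the decay is that of the asymptotic expansion; inside it the weights are
bounded below and the field is continuous. -/
theorem Configuration.HasAsymptotics.exists_hasDecay {m : Configuration 𝔤} {R : ℝ}
    {u : E3 → 𝔤 →L[ℝ] 𝔤} (hA : m.HasAsymptotics R u a Φinf κ) (hS : MaximalSymmetryBreaking Φinf) :
    ∃ C, m.HasDecay C := by
  obtain ⟨C, R₁, hC, hR₁, h⟩ := hA.exists_decay_at_infinity hS
  have hbd : ∀ i, ∃ B, ∀ x ∈ Metric.closedBall (0 : E3) R₁, ‖covDeriv m.A i m.Φ x‖ ≤ B := fun i =>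
    (isCompact_closedBall (0 : E3) R₁).exists_bound_of_continuousOn
      (m.contDiff_covDeriv m.smooth_Φ i).continuous.continuousOn
  choose B hB using hbd
  set K := ∑ i, |B i|
  have hK : ∀ i x, ‖x‖ ≤ R₁ → ‖covDeriv m.A i m.Φ x‖ ≤ K := fun i x hx =>
    ((hB i x (by simpa using hx)).trans (le_abs_self _)).trans
      (Finset.single_le_sum (f := fun i => |B i|) (fun j _ => abs_nonneg _) (Finset.mem_univ i))
  have hK0 : 0 ≤ K := Finset.sum_nonneg fun i _ => abs_nonneg _
  set b := ‖bracketL (𝔤 := 𝔤)‖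
  have hb : 0 ≤ b := norm_nonneg (bracketL (𝔤 := 𝔤))
  have hfar2 : ∀ x : E3, 1 ≤ ‖x‖ → (‖x‖ ^ 2)⁻¹ ≤ 8 * (rho x ^ 2)⁻¹ := fun x hx => by
    have h1 := pow_le_pow_left₀ (rho_pos x).le (rho_le_two_mul_norm hx) 2
    rw [inv_eq_one_div, inv_eq_one_div, mul_one_div, div_le_div_iff₀ (by positivity)
      (pow_pos (rho_pos x) 2)]
    nlinarith [sq_nonneg ‖x‖]
  have hfar3 : ∀ x : E3, 1 ≤ ‖x‖ → (‖x‖ ^ 3)⁻¹ ≤ 8 * (rho x ^ 3)⁻¹ := fun x hx => by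
    have h1 := pow_le_pow_left₀ (rho_pos x).le (rho_le_two_mul_norm hx) 3
    rw [inv_eq_one_div, inv_eq_one_div, mul_one_div, div_le_div_iff₀ (by positivity)
      (pow_pos (rho_pos x) 3)]
    nlinarith [pow_nonneg (norm_nonneg x) 3]
  have hnear : ∀ (n : ℕ) (x : E3), ‖x‖ ≤ R₁ → 1 ≤ (1 + R₁) ^ n * (rho x ^ n)⁻¹ := fun n x hx => by
    rw [← div_eq_mul_inv, one_le_div (pow_pos (rho_pos x) n)]
    exact pow_le_pow_left₀ (rho_pos x).le (rho_le_of_norm_le (by linarith) hx) n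
  have hnn : ∀ (n : ℕ) (x : E3), 0 ≤ (rho x ^ n)⁻¹ := fun n x =>
    inv_nonneg.2 (pow_pos (rho_pos x) n).le
  refine ⟨8 * C + K * (1 + R₁) ^ 2 + b * K * (1 + R₁) ^ 3, by positivity, fun i x => ?_,
    fun i x X => ?_⟩
  · rcases le_total R₁ ‖x‖ with hx | hx
    · refine ((h x hx i).1.trans (mul_le_mul_of_nonneg_left (hfar2 x (hR₁.trans hx)) hC)).trans ?_
      have : 0 ≤ (K * (1 + R₁) ^ 2 + b * K * (1 + R₁) ^ 3) * (rho x ^ 2)⁻¹ :=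
        mul_nonneg (by positivity) (hnn 2 x)
      linarith
    · have h1 := mul_le_mul_of_nonneg_left (hnear 2 x hx) hK0
      have : 0 ≤ (8 * C + b * K * (1 + R₁) ^ 3) * (rho x ^ 2)⁻¹ :=
        mul_nonneg (by positivity) (hnn 2 x)
      linarith [hK i x hx]
  · have hp : 0 ≤ (rho x ^ 2)⁻¹ * ‖⁅m.Φ x, X⁆‖ := mul_nonneg (hnn 2 x) (norm_nonneg _)
    have hp' : 0 ≤ (rho x ^ 3)⁻¹ * ‖X‖ := mul_nonneg (hnn 3 x) (norm_nonneg _)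
    have hc1 : 0 ≤ K * (1 + R₁) ^ 2 := by positivity
    have hc2 : 0 ≤ b * K * (1 + R₁) ^ 3 := by positivity
    rcases le_total R₁ ‖x‖ with hx | hx
    · refine ((h x hx i).2 X).trans ?_
      have h2 := mul_le_mul_of_nonneg_right (hfar2 x (hR₁.trans hx)) (norm_nonneg ⁅m.Φ x, X⁆)
      have h3 := mul_le_mul_of_nonneg_right (hfar3 x (hR₁.trans hx)) (norm_nonneg X)
      have h4 := mul_le_mul_of_nonneg_left (add_le_add h2 h3) hC
      refine h4.trans ?_
      nlinarith [mul_nonneg (add_nonneg hc1 hc2) (add_nonneg hp hp')]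
    · have h1 : ‖⁅covDeriv m.A i m.Φ x, X⁆‖ ≤ b * K * ‖X‖ := (norm_lie_le _ _).trans
        (mul_le_mul_of_nonneg_right (mul_le_mul_of_nonneg_left (hK i x hx) hb) (norm_nonneg _))
      have h2 : b * K * ‖X‖ * 1 ≤ b * K * ‖X‖ * ((1 + R₁) ^ 3 * (rho x ^ 3)⁻¹) :=
        mul_le_mul_of_nonneg_left (hnear 3 x hx) (by positivity)
      have h3 : 0 ≤ (8 * C + K * (1 + R₁) ^ 2) * ((rho x ^ 2)⁻¹ * ‖⁅m.Φ x, X⁆‖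
          + (rho x ^ 3)⁻¹ * ‖X‖) := by positivity
      nlinarith [mul_nonneg hc2 hp]

end PointwiseDecay

/-! ### Components, norms and multiplication operators -/

section Norms

variable {𝔤 : Type*} [InvariantLieAlgebra 𝔤] [FiniteDimensional ℝ 𝔤] (m : Configuration 𝔤)

theorem Configuration.form_zero_left (k : Fin 3) (t : TestFun 𝔤) : m.form k 0 t = 0 := by
  simpa using m.form_smul k 0 0 t

/-- The norm of `H_k` on one component of a test section. -/
def Configuration.nrm (k : Fin 3) : Seminorm ℝ (TestFun 𝔤) :=
  (normSeminorm ℝ (PreH m k)).comp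
    (LinearMap.inr ℝ (Fin 3 → TestFun 𝔤) (TestFun 𝔤) : TestFun 𝔤 →ₗ[ℝ] PreH m k)

theorem Configuration.nrm_sq (k : Fin 3) (s : TestFun 𝔤) : m.nrm k s ^ 2 = m.form k s s := by
  refine (norm_preH_sq m k ((0, s) : TestSection 𝔤)).trans ?_
  simp [Configuration.sectionForm, m.form_zero_left]

theorem Configuration.nrm_zero_sq (s : TestFun 𝔤) : m.nrm 0 s ^ 2 = l2 s s := m.nrm_sq 0 s

/-- The components of a section: `aᵢ` for `some i` and `Ψ` for `none`. -/
def component : Option (Fin 3) → TestSection 𝔤 →ₗ[ℝ] TestFun 𝔤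
  | some i => (LinearMap.proj i).comp (LinearMap.fst ℝ _ _)
  | none => LinearMap.snd ℝ _ _

@[simp] theorem component_some (i : Fin 3) (c : TestSection 𝔤) : component (some i) c = c.1 i := rfl

@[simp] theorem component_none (c : TestSection 𝔤) : component none c = c.2 := rfl

/-- The action of an operator on all components of a section. -/
def lift (T : TestFun 𝔤 →ₗ[ℝ] TestFun 𝔤) : TestSection 𝔤 →ₗ[ℝ] TestSection 𝔤 :=
  (LinearMap.pi fun i => T.comp (LinearMap.proj i)).prodMap T

@[simp] theorem component_lift (T : TestFun 𝔤 →ₗ[ℝ] TestFun 𝔤) (α : Option (Fin 3))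
    (c : TestSection 𝔤) : component α (lift T c) = T (component α c) := by
  cases α <;> rfl

theorem section_ext {c c' : TestSection 𝔤} (h : ∀ α, component α c = component α c') : c = c' :=
  Prod.ext (funext fun i => h (some i)) (h none)

/-- The norm of `H_k` on test sections, as a seminorm. -/
def Configuration.secNrm (k : Fin 3) : Seminorm ℝ (TestSection 𝔤) := normSeminorm ℝ (PreH m k)

theorem Configuration.secNrm_sq (k : Fin 3) (c : TestSection 𝔤) :
    m.secNrm k c ^ 2 = ∑ α, m.nrm k (component α c) ^ 2 := by
  refine (norm_preH_sq m k c).trans ?_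
  simp only [Configuration.sectionForm, Fintype.sum_option, Configuration.nrm_sq, component_some,
    component_none]
  rw [add_comm]

theorem le_of_sq_le_sq {a b : ℝ} (h : a ^ 2 ≤ b ^ 2) (hb : 0 ≤ b) : a ≤ b :=
  (le_abs_self a).trans (abs_le_of_sq_le_sq h hb)

theorem sum_sq_le_sq_sum {ι : Type*} (s : Finset ι) {f : ι → ℝ} (hf : ∀ i, 0 ≤ f i) :
    ∑ i ∈ s, f i ^ 2 ≤ (∑ i ∈ s, f i) ^ 2 :=
  Finset.sum_sq_le_sq_sum_of_nonneg fun i _ => hf i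

theorem Configuration.secNrm_le_sum (k : Fin 3) (c : TestSection 𝔤) :
    m.secNrm k c ≤ ∑ α, m.nrm k (component α c) := by
  refine le_of_sq_le_sq ?_ (Finset.sum_nonneg fun α _ => apply_nonneg _ _)
  rw [m.secNrm_sq]
  exact sum_sq_le_sq_sum _ fun α => apply_nonneg _ _

theorem Configuration.nrm_component_le (k : Fin 3) (α : Option (Fin 3)) (c : TestSection 𝔤) :
    m.nrm k (component α c) ≤ m.secNrm k c := by
  refine le_of_sq_le_sq ?_ (apply_nonneg _ _)
  rw [m.secNrm_sq]
  exact Finset.single_le_sum (f := fun α => m.nrm k (component α c) ^ 2)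
    (fun _ _ => sq_nonneg _) (Finset.mem_univ α)

theorem abs_l2_le (s t : TestFun 𝔤) : |l2 s t| ≤ m.nrm 0 s * m.nrm 0 t := by
  let S : PreH m 0 := ((0, s) : TestSection 𝔤)
  let T : PreH m 0 := ((0, t) : TestSection 𝔤)
  have h : inner ℝ S T = l2 s t := by
    change m.sectionForm 0 (0, s) (0, t) = _
    simp only [Configuration.sectionForm, Pi.zero_apply, m.form_zero_left, Finset.sum_const_zero,
      zero_add]
    rfl
  rw [← h]
  exact abs_real_inner_le_norm S T

theorem l2_add_right (s t t' : TestFun 𝔤) : l2 s (t + t') = l2 s t + l2 s t' := by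
  rw [l2_symm, l2_add, l2_symm t, l2_symm t']

theorem l2_smul_right (r : ℝ) (s t : TestFun 𝔤) : l2 s (r • t) = r * l2 s t := by
  rw [l2_symm, l2_smul, l2_symm]

/-- The `L²` inner product as a bilinear form. -/
def l2B : LinearMap.BilinForm ℝ (TestFun 𝔤) :=
  LinearMap.mk₂ ℝ l2 l2_add (fun r s t => l2_smul r s t) l2_add_right
    (fun r s t => l2_smul_right r s t)

theorem l2_neg_left (s t : TestFun 𝔤) : l2 (-s) t = -l2 s t := LinearMap.map_neg₂ l2B s t

theorem l2_sub_left (s s' t : TestFun 𝔤) : l2 (s - s') t = l2 s t - l2 s' t :=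
  LinearMap.map_sub₂ l2B s s' t

theorem l2_sum_left {ι : Type*} (u : Finset ι) (s : ι → TestFun 𝔤) (t : TestFun 𝔤) :
    l2 (∑ i ∈ u, s i) t = ∑ i ∈ u, l2 (s i) t := LinearMap.map_sum₂ l2B u s t

/-- Pointwise domination by two terms passes to `L²`, at the cost of a factor `2`. -/
theorem nrm_zero_le_of_pointwise {s t t' : TestFun 𝔤} {C : ℝ} (hC : 0 ≤ C)
    (h : ∀ x, ‖s.1 x‖ ≤ C * (‖t.1 x‖ + ‖t'.1 x‖)) :
    m.nrm 0 s ≤ 2 * C * (m.nrm 0 t + m.nrm 0 t') := by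
  have h1 : l2 s s ≤ 2 * C ^ 2 * (l2 t t + l2 t' t') := by
    simp only [l2]
    rw [← integral_add (integrable_inner t t) (integrable_inner t' t'), ← integral_const_mul]
    refine integral_mono (integrable_inner s s)
      (((integrable_inner t t).add (integrable_inner t' t')).const_mul _) fun x => ?_
    simp only [real_inner_self_eq_norm_sq]
    have h2 := pow_le_pow_left₀ (norm_nonneg _) (h x) 2
    nlinarith [sq_nonneg (‖t.1 x‖ - ‖t'.1 x‖),
      mul_nonneg (sq_nonneg C) (sq_nonneg (‖t.1 x‖ - ‖t'.1 x‖))]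
  have ht : 0 ≤ m.nrm 0 t := apply_nonneg _ _
  have ht' : 0 ≤ m.nrm 0 t' := apply_nonneg _ _
  refine le_of_sq_le_sq ?_ (by positivity)
  rw [m.nrm_zero_sq]
  rw [← m.nrm_zero_sq t, ← m.nrm_zero_sq t'] at h1
  refine h1.trans ?_
  have h3 : 0 ≤ C ^ 2 * (m.nrm 0 t * m.nrm 0 t') := by positivity
  nlinarith [mul_nonneg (sq_nonneg C) (sq_nonneg (m.nrm 0 t)),
    mul_nonneg (sq_nonneg C) (sq_nonneg (m.nrm 0 t'))]

theorem nrm_zero_le_of_pointwise' {s t : TestFun 𝔤} {C : ℝ} (hC : 0 ≤ C)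
    (h : ∀ x, ‖s.1 x‖ ≤ C * ‖t.1 x‖) : m.nrm 0 s ≤ C * m.nrm 0 t := by
  have h1 : l2 s s ≤ C ^ 2 * l2 t t := by
    simp only [l2]
    rw [← integral_const_mul]
    refine integral_mono (integrable_inner s s) ((integrable_inner t t).const_mul _) fun x => ?_
    simp only [real_inner_self_eq_norm_sq]
    have h2 := pow_le_pow_left₀ (norm_nonneg _) (h x) 2
    rwa [mul_pow] at h2
  refine le_of_sq_le_sq ?_ (mul_nonneg hC (apply_nonneg _ _))
  rwa [mul_pow, m.nrm_zero_sq, m.nrm_zero_sq]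

/-- Multiplication by a smooth function. -/
def mulFun (f : E3 → ℝ) (hf : ContDiff ℝ ∞ f) : TestFun 𝔤 →ₗ[ℝ] TestFun 𝔤 where
  toFun s := ⟨fun x => f x • s.1 x, hf.smul s.2.1, s.2.2.smul_left (f := f)⟩
  map_add' s t := by ext x; exact smul_add _ _ _
  map_smul' r s := by ext x; exact smul_comm _ _ _

theorem mulFun_apply (f : E3 → ℝ) (hf : ContDiff ℝ ∞ f) (s : TestFun 𝔤) (x : E3) :
    (mulFun f hf s).1 x = f x • s.1 x := rfl

theorem wt_apply (n : ℕ) (s : TestFun 𝔤) (x : E3) : (wt n s).1 x = (rho x ^ n)⁻¹ • s.1 x := rfl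

theorem adΦ_apply (s : TestFun 𝔤) (x : E3) : (m.adΦ s).1 x = ⁅m.Φ x, s.1 x⁆ := rfl

theorem nabla_apply (i : Fin 3) (s : TestFun 𝔤) (x : E3) :
    (m.nabla i s).1 x = fderiv ℝ s.1 x (e i) + ⁅m.A i x, s.1 x⁆ := rfl

theorem testFun_differentiableAt (s : TestFun 𝔤) (x : E3) : DifferentiableAt ℝ s.1 x :=
  s.2.1.differentiable (by simp) x

theorem nabla_mulFun (i : Fin 3) {f : E3 → ℝ} (hf : ContDiff ℝ ∞ f) (s : TestFun 𝔤) (x : E3) :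
    (m.nabla i (mulFun f hf s)).1 x = f x • (m.nabla i s).1 x + fderiv ℝ f x (e i) • s.1 x := by
  have h := fderiv_fun_smul (hf.differentiable (by simp) x) (testFun_differentiableAt s x)
  have h' : fderiv ℝ (mulFun f hf s).1 x = _ := h
  rw [nabla_apply, h', mulFun_apply, nabla_apply]
  simp only [add_apply, smul_apply, ContinuousLinearMap.smulRight_apply, lie_smul, smul_add]
  abel

theorem wt_zero (s : TestFun 𝔤) : wt 0 s = s := by
  ext x
  simp [wt_apply]

theorem wt_wt (k l : ℕ) (s : TestFun 𝔤) : wt k (wt l s) = wt (k + l) s := by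
  ext x
  simp [wt_apply, smul_smul, pow_add, mul_comm]

theorem adΦ_wt (n : ℕ) (s : TestFun 𝔤) : m.adΦ (wt n s) = wt n (m.adΦ s) := by
  ext x
  simp [wt_apply, adΦ_apply]

theorem hasFDerivAt_rho_zpow (n : ℤ) (x : E3) :
    HasFDerivAt (fun y => rho y ^ n) ((n * rho x ^ (n - 2)) • innerSL ℝ x) x := by
  have h1 : HasFDerivAt (fun y : E3 => 1 + ‖y‖ ^ 2) ((2 : ℝ) • innerSL ℝ x) x := by
    have h := (hasStrictFDerivAt_norm_sq x).hasFDerivAt.const_add 1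
    rw [← Nat.cast_smul_eq_nsmul ℝ] at h
    exact_mod_cast h
  have h2 := h1.sqrt (by positivity)
  have h3 : HasFDerivAt rho _ x := h2
  have h4 := (hasDerivAt_zpow n (rho x) (Or.inl (rho_pos x).ne')).comp_hasFDerivAt x h3
  refine h4.congr_fderiv ?_
  rw [smul_smul, smul_smul]
  congr 1
  symm
  change (n : ℝ) * rho x ^ (n - 2) = n * rho x ^ (n - 1) * (1 / (2 * rho x)) * 2
  have hr := (rho_pos x).ne'
  rw [show n - 2 = (n - 1) - 1 by ring, zpow_sub_one₀ hr]
  field_simp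

theorem inner_e (x : E3) (i : Fin 3) : inner ℝ x (e i) = x i := by
  simp [e, EuclideanSpace.inner_single_right]

theorem contDiff_rho_inv_pow (n : ℕ) : ContDiff ℝ ∞ fun x => (rho x ^ n)⁻¹ :=
  (contDiff_rho.pow n).inv fun x => (pow_pos (rho_pos x) n).ne'

theorem fderiv_rho_inv_pow (n : ℕ) (x : E3) (i : Fin 3) :
    fderiv ℝ (fun y => (rho y ^ n)⁻¹) x (e i) = -(n * x i * (rho x ^ (n + 2))⁻¹) := by
  have h := hasFDerivAt_rho_zpow (-(n : ℤ)) x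
  have h' : (fun y => rho y ^ (-(n : ℤ))) = fun y => (rho y ^ n)⁻¹ := by
    funext y
    rw [zpow_neg, zpow_natCast]
  rw [h'] at h
  rw [h.fderiv]
  have h2 : rho x ^ (-(n : ℤ) - 2) = (rho x ^ (n + 2))⁻¹ := by
    rw [← zpow_natCast, ← zpow_neg]
    congr 1
    push_cast
    ring
  simp only [smul_apply, innerSL_apply_apply, inner_e, smul_eq_mul, h2]
  push_cast
  ring

theorem abs_apply_le_norm (x : E3) (i : Fin 3) : |x i| ≤ ‖x‖ := by
  simpa using PiLp.norm_apply_le x i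

end Norms

/-! ### Commutators and the Hardy inequalities -/

section Commutators

variable {𝔤 : Type*} [InvariantLieAlgebra 𝔤] [FiniteDimensional ℝ 𝔤] (m : Configuration 𝔤)

/-- Bracket `s ↦ [∇ᵢ Φ, s]` with the covariant derivative of the Higgs field. -/
def Configuration.adDer (i : Fin 3) : TestFun 𝔤 →ₗ[ℝ] TestFun 𝔤 where
  toFun s := ⟨fun x => ⁅covDeriv m.A i m.Φ x, s.1 x⁆,
    contDiff_lie (m.contDiff_covDeriv m.smooth_Φ i) s.2.1, hasCompactSupport_lie s.2.2⟩
  map_add' s t := by ext x; exact lie_add _ _ _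
  map_smul' r s := by ext x; exact lie_smul _ _ _

theorem adDer_apply (i : Fin 3) (s : TestFun 𝔤) (x : E3) :
    (m.adDer i s).1 x = ⁅covDeriv m.A i m.Φ x, s.1 x⁆ := rfl

theorem fderiv_lie {s t : E3 → 𝔤} {x : E3} (hs : DifferentiableAt ℝ s x)
    (ht : DifferentiableAt ℝ t x) (v : E3) :
    fderiv ℝ (fun y => ⁅s y, t y⁆) x v = ⁅fderiv ℝ s x v, t x⁆ + ⁅s x, fderiv ℝ t x v⁆ := by
  have h := (bracketL (𝔤 := 𝔤)).hasFDerivAt_of_bilinear hs.hasFDerivAt ht.hasFDerivAt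
  have h' : HasFDerivAt (fun y => ⁅s y, t y⁆) _ x := h
  rw [h'.fderiv]
  simp [add_comm]

theorem nabla_adΦ (i : Fin 3) (s : TestFun 𝔤) :
    m.nabla i (m.adΦ s) = m.adΦ (m.nabla i s) + m.adDer i s := by
  ext x
  change (m.nabla i (m.adΦ s)).1 x = (m.adΦ (m.nabla i s)).1 x + (m.adDer i s).1 x
  have h : fderiv ℝ (m.adΦ s).1 x (e i) = _ :=
    fderiv_lie (m.smooth_Φ.differentiable (by simp) x) (testFun_differentiableAt s x) (e i)
  rw [nabla_apply, h]
  simp only [adΦ_apply, nabla_apply, adDer_apply, covDeriv, lie_add, add_lie]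
  rw [leibniz_lie (m.A i x) (m.Φ x) (s.1 x)]
  abel

theorem nabla_nabla_sub (i j : Fin 3) (s : TestFun 𝔤) (x : E3) :
    (m.nabla i (m.nabla j s)).1 x - (m.nabla j (m.nabla i s)).1 x
      = ⁅curvature m.A i j x, s.1 x⁆ := by
  have hd2 : DifferentiableAt ℝ (fderiv ℝ s.1) x :=
    (s.2.1.fderiv_right (m := ∞) (by simp)).differentiable (by simp) x
  have key : ∀ i j : Fin 3, (m.nabla i (m.nabla j s)).1 x
      = fderiv ℝ (fderiv ℝ s.1) x (e i) (e j) + ⁅fderiv ℝ (m.A j) x (e i), s.1 x⁆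
        + ⁅m.A j x, fderiv ℝ s.1 x (e i)⁆ + ⁅m.A i x, fderiv ℝ s.1 x (e j)⁆
        + ⁅m.A i x, ⁅m.A j x, s.1 x⁆⁆ := fun i j => by
    have h1 : HasFDerivAt (fun y => fderiv ℝ s.1 y (e j)) _ x :=
      hd2.hasFDerivAt.clm_apply (hasFDerivAt_const (e j) x)
    have hA : DifferentiableAt ℝ (fun y => ⁅m.A j y, s.1 y⁆) x :=
      (contDiff_lie (m.smooth_A j) s.2.1).differentiable (by simp) x
    have h : fderiv ℝ (m.nabla j s).1 x = _ := (h1.add hA.hasFDerivAt).fderiv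
    rw [nabla_apply, h, add_apply,
      fderiv_lie ((m.smooth_A j).differentiable (by simp) x) (testFun_differentiableAt s x),
      nabla_apply]
    simp only [lie_add, add_apply, ContinuousLinearMap.comp_apply, ContinuousLinearMap.flip_apply,
      zero_apply, map_zero]
    abel
  have hsymm : fderiv ℝ (fderiv ℝ s.1) x (e i) (e j) = fderiv ℝ (fderiv ℝ s.1) x (e j) (e i) :=
    (s.2.1.contDiffAt.isSymmSndFDerivAt (by
      rw [minSmoothness_of_isRCLikeNormedField]
      exact ENat.LEInfty.out)) _ _
  rw [key, key, hsymm, curvature, add_lie, sub_lie, lie_lie]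
  abel

/-- On a monopole the curvature in the commutator of covariant derivatives is `∇Φ`. -/
theorem nabla_comm {m : Configuration 𝔤} (hB : m.IsBogomolny) (i : Fin 3) (s : TestFun 𝔤) :
    m.nabla (i + 1) (m.nabla (i + 2) s) = m.nabla (i + 2) (m.nabla (i + 1) s) + m.adDer i s := by
  ext x
  change (m.nabla (i + 1) (m.nabla (i + 2) s)).1 x
    = (m.nabla (i + 2) (m.nabla (i + 1) s)).1 x + (m.adDer i s).1 x
  rw [← sub_eq_iff_eq_add', nabla_nabla_sub, hB i x, adDer_apply]

/-- The bracket with `∇ᵢΦ` gains a factor `ρ⁻²` over terms of the norm of `H₁`. -/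
theorem nrm_adDer_le {C : ℝ} {m : Configuration 𝔤} (h : m.HasDecay C) (i : Fin 3)
    (s : TestFun 𝔤) :
    m.nrm 0 (m.adDer i s) ≤ 2 * C * (m.nrm 0 (wt 2 (m.adΦ s)) + m.nrm 0 (wt 3 s)) := by
  refine nrm_zero_le_of_pointwise m h.nonneg fun x => ?_
  rw [adDer_apply, wt_apply, wt_apply, norm_smul, norm_smul,
    Real.norm_of_nonneg (inv_nonneg.2 (pow_pos (rho_pos x) 2).le),
    Real.norm_of_nonneg (inv_nonneg.2 (pow_pos (rho_pos x) 3).le)]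
  exact h.norm_lie_covDeriv i x _

/-- The coarse bound, from the quadratic decay of `∇ᵢΦ` alone. -/
theorem nrm_adDer_le' {C : ℝ} {m : Configuration 𝔤} (h : m.HasDecay C) (i : Fin 3)
    (s : TestFun 𝔤) :
    m.nrm 0 (m.adDer i s) ≤ ‖bracketL (𝔤 := 𝔤)‖ * C * m.nrm 0 (wt 2 s) := by
  refine nrm_zero_le_of_pointwise' m
    (mul_nonneg (norm_nonneg (bracketL (𝔤 := 𝔤))) h.nonneg) fun x => ?_
  rw [adDer_apply, wt_apply, norm_smul,
    Real.norm_of_nonneg (inv_nonneg.2 (pow_pos (rho_pos x) 2).le)]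
  refine (norm_lie_le _ _).trans ?_
  rw [← mul_assoc]
  refine mul_le_mul_of_nonneg_right ?_ (norm_nonneg _)
  rw [mul_assoc]
  exact mul_le_mul_of_nonneg_left (h.norm_covDeriv i x) (norm_nonneg (bracketL (𝔤 := 𝔤)))

theorem nrm_wt_le {k l : ℕ} (h : k ≤ l) (s : TestFun 𝔤) :
    m.nrm 0 (wt l s) ≤ m.nrm 0 (wt k s) := by
  rw [← one_mul (m.nrm 0 (wt k s))]
  refine nrm_zero_le_of_pointwise' m zero_le_one fun x => ?_
  rw [wt_apply, wt_apply, norm_smul, norm_smul, one_mul]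
  refine mul_le_mul_of_nonneg_right ?_ (norm_nonneg _)
  rw [Real.norm_of_nonneg (inv_nonneg.2 (pow_pos (rho_pos x) _).le),
    Real.norm_of_nonneg (inv_nonneg.2 (pow_pos (rho_pos x) _).le)]
  exact inv_anti₀ (pow_pos (rho_pos x) _) (pow_le_pow_right₀ (one_le_rho x) h)

theorem contDiff_apply_mul_rho_inv_pow (i : Fin 3) (k : ℕ) :
    ContDiff ℝ ∞ fun x : E3 => x i * (rho x ^ k)⁻¹ :=
  (contDiff_piLp_apply (p := 2)).mul (contDiff_rho_inv_pow k)

/-- Multiplication by the `i`-th component of the radial vector field `x ρ⁻ᵏ`. -/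
def radial (k : ℕ) (i : Fin 3) : TestFun 𝔤 →ₗ[ℝ] TestFun 𝔤 :=
  mulFun (fun x => x i * (rho x ^ k)⁻¹) (contDiff_apply_mul_rho_inv_pow i k)

theorem fderiv_apply_mul_rho_inv_pow (i : Fin 3) (k : ℕ) (x : E3) :
    fderiv ℝ (fun x : E3 => x i * (rho x ^ k)⁻¹) x (e i)
      = (rho x ^ k)⁻¹ - k * x i ^ 2 * (rho x ^ (k + 2))⁻¹ := by
  have h1 : HasFDerivAt (fun x : E3 => x i) (EuclideanSpace.proj (𝕜 := ℝ) i) x :=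
    (EuclideanSpace.proj (𝕜 := ℝ) i).hasFDerivAt
  have h2 := ((contDiff_rho_inv_pow k).differentiable (by simp) x).hasFDerivAt
  have h3 : HasFDerivAt (fun x : E3 => x i * (rho x ^ k)⁻¹) _ x := h1.mul h2
  rw [h3.fderiv]
  simp only [add_apply, smul_apply, fderiv_rho_inv_pow, smul_eq_mul]
  have h4 : (EuclideanSpace.proj (𝕜 := ℝ) i) (e i) = 1 := by simp [e]
  rw [h4]
  ring

/-- Integration by parts against the radial vector field `x ρ⁻²ᵏ`, whose divergence is
`(3 - 2k) ρ⁻²ᵏ + 2k ρ⁻²ᵏ⁻²`. -/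
theorem sum_l2_nabla_radial (k : ℕ) (s : TestFun 𝔤) :
    2 * ∑ i, l2 (m.nabla i s) (radial (2 * k) i s)
      = -((3 - 2 * k) * m.nrm 0 (wt k s) ^ 2 + 2 * k * m.nrm 0 (wt (k + 1) s) ^ 2) := by
  have h1 : ∀ i, 2 * l2 (m.nabla i s) (radial (2 * k) i s)
      = -∫ x, ((rho x ^ (2 * k))⁻¹ - (2 * k) * x i ^ 2 * (rho x ^ (2 * k + 2))⁻¹)
          * inner ℝ (s.1 x) (s.1 x) := fun i => by
    have h2 : l2 (m.nabla i s) (radial (2 * k) i s) = -l2 s (m.nabla i (radial (2 * k) i s)) :=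
      l2_nabla m i s _
    have h3 : l2 s (m.nabla i (radial (2 * k) i s)) = l2 (m.nabla i s) (radial (2 * k) i s)
        + ∫ x, ((rho x ^ (2 * k))⁻¹ - (2 * k) * x i ^ 2 * (rho x ^ (2 * k + 2))⁻¹)
          * inner ℝ (s.1 x) (s.1 x) := by
      have hi : Integrable fun x => ((rho x ^ (2 * k))⁻¹
          - (2 * k) * x i ^ 2 * (rho x ^ (2 * k + 2))⁻¹) * inner ℝ (s.1 x) (s.1 x) := by
        have h4 : ContDiff ℝ ∞ fun x : E3 => (rho x ^ (2 * k))⁻¹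
            - (2 * k) * x i ^ 2 * (rho x ^ (2 * k + 2))⁻¹ :=
          (contDiff_rho_inv_pow _).sub ((contDiff_const.mul
            ((contDiff_piLp_apply (p := 2)).pow 2)).mul (contDiff_rho_inv_pow _))
        refine (integrable_inner (mulFun _ h4 s) s).congr (.of_forall fun x => ?_)
        simp only [mulFun_apply, real_inner_smul_left]
      simp only [l2]
      rw [← integral_add (integrable_inner _ _) hi]
      refine integral_congr_ae (.of_forall fun x => ?_)
      simp only [radial]
      rw [nabla_mulFun, fderiv_apply_mul_rho_inv_pow, mulFun_apply, inner_add_right,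
        real_inner_smul_right, real_inner_smul_right, real_inner_smul_right,
        real_inner_comm ((m.nabla i s).1 x)]
      push_cast
      ring
    linarith
  rw [Finset.mul_sum, Finset.sum_congr rfl fun i _ => h1 i, Finset.sum_neg_distrib, neg_inj,
    m.nrm_zero_sq, m.nrm_zero_sq, ← integral_finsetSum]
  · simp only [l2]
    rw [← integral_const_mul, ← integral_const_mul,
      ← integral_add ((integrable_inner _ _).const_mul _) ((integrable_inner _ _).const_mul _)]
    refine integral_congr_ae (.of_forall fun x => ?_)
    simp only [wt_apply, real_inner_smul_left, real_inner_smul_right]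
    rw [← Finset.sum_mul, Finset.sum_sub_distrib, ← Finset.sum_mul, ← Finset.mul_sum]
    have hx : ∑ i, x i ^ 2 = rho x ^ 2 - 1 := by
      rw [rho_sq, EuclideanSpace.norm_sq_eq]
      simp
    rw [hx]
    have hr := (rho_pos x).ne'
    simp only [Finset.sum_const, Finset.card_univ, Fintype.card_fin, nsmul_eq_mul]
    field_simp
    push_cast
    ring
  · intro i _
    have h4 : ContDiff ℝ ∞ fun x : E3 => (rho x ^ (2 * k))⁻¹
        - (2 * k) * x i ^ 2 * (rho x ^ (2 * k + 2))⁻¹ :=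
      (contDiff_rho_inv_pow _).sub ((contDiff_const.mul
        ((contDiff_piLp_apply (p := 2)).pow 2)).mul (contDiff_rho_inv_pow _))
    refine (integrable_inner (mulFun _ h4 s) s).congr (.of_forall fun x => ?_)
    simp only [mulFun_apply, real_inner_smul_left]

theorem abs_l2_nabla_radial_le (k : ℕ) (i : Fin 3) (s : TestFun 𝔤) :
    |l2 (m.nabla i s) (radial (2 * (k + 1)) i s)|
      ≤ m.nrm 0 (wt k (m.nabla i s)) * m.nrm 0 (wt (k + 1) s) := by
  have h1 : l2 (m.nabla i s) (radial (2 * (k + 1)) i s)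
      = l2 (wt k (m.nabla i s)) (radial 1 i (wt (k + 1) s)) := by
    simp only [l2]
    refine integral_congr_ae (.of_forall fun x => ?_)
    simp only [radial, mulFun_apply, wt_apply, real_inner_smul_left, real_inner_smul_right]
    have hr := (rho_pos x).ne'
    field_simp
    ring
  rw [h1]
  refine (abs_l2_le m _ _).trans (mul_le_mul_of_nonneg_left ?_ (apply_nonneg _ _))
  rw [← one_mul (m.nrm 0 (wt (k + 1) s))]
  refine nrm_zero_le_of_pointwise' m zero_le_one fun x => ?_
  rw [radial, mulFun_apply, norm_smul]
  refine mul_le_mul_of_nonneg_right ?_ (norm_nonneg _)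
  rw [pow_one, Real.norm_eq_abs, abs_mul, abs_inv, abs_of_pos (rho_pos x), ← div_eq_mul_inv]
  exact div_le_one_of_le₀ ((abs_apply_le_norm x i).trans (norm_le_rho x)) (rho_pos x).le

theorem abs_sum_l2_nabla_radial_le (k : ℕ) (s : TestFun 𝔤) :
    |∑ i, l2 (m.nabla i s) (radial (2 * (k + 1)) i s)|
      ≤ (∑ i, m.nrm 0 (wt k (m.nabla i s))) * m.nrm 0 (wt (k + 1) s) := by
  rw [Finset.sum_mul]
  exact (Finset.abs_sum_le_sum_abs _ _).trans
    (Finset.sum_le_sum fun i _ => abs_l2_nabla_radial_le m k i s)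

/-- Hardy's inequality. -/
theorem hardy (s : TestFun 𝔤) : m.nrm 0 (wt 1 s) ≤ 2 * ∑ i, m.nrm 0 (m.nabla i s) := by
  have h1 := sum_l2_nabla_radial m 1 s
  have h2 := (abs_le.1 (abs_sum_l2_nabla_radial_le m 0 s)).1
  simp only [wt_zero, zero_add] at h1 h2
  push_cast at h1
  have h3 : 0 ≤ m.nrm 0 (wt 1 s) := apply_nonneg _ _
  have h4 : 0 ≤ ∑ i, m.nrm 0 (m.nabla i s) := Finset.sum_nonneg fun i _ => apply_nonneg _ _
  rcases h3.eq_or_lt with h5 | h5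
  · rw [← h5]
    positivity
  · have h6 : m.nrm 0 (wt 1 s) * m.nrm 0 (wt 1 s)
        ≤ (2 * ∑ i, m.nrm 0 (m.nabla i s)) * m.nrm 0 (wt 1 s) := by
      nlinarith [sq_nonneg (m.nrm 0 (wt (1 + 1) s))]
    exact le_of_mul_le_mul_right h6 h5

/-- The Hardy inequality with weight `ρ⁻²`.  In dimension three constants violate it without the
last term. -/
theorem hardy_two (s : TestFun 𝔤) : m.nrm 0 (wt 2 s)
    ≤ 2 * m.nrm 0 (wt 3 s) + 2 * ∑ i, m.nrm 0 (wt 1 (m.nabla i s)) := by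
  have h1 := sum_l2_nabla_radial m 2 s
  have h2 := (abs_le.1 (abs_sum_l2_nabla_radial_le m 1 s)).2
  simp only [Nat.reduceAdd] at h1 h2
  push_cast at h1
  have h3 : 0 ≤ m.nrm 0 (wt 2 s) := apply_nonneg _ _
  have h3' : 0 ≤ m.nrm 0 (wt 3 s) := apply_nonneg _ _
  have h4 : 0 ≤ ∑ i, m.nrm 0 (wt 1 (m.nabla i s)) := Finset.sum_nonneg fun i _ => apply_nonneg _ _
  by_contra! h
  nlinarith

end Commutators

/-! ### The Weitzenböck formulas and the a priori estimates -/

section Weitzenbock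

variable {𝔤 : Type*} [InvariantLieAlgebra 𝔤] [FiniteDimensional ℝ 𝔤] (m : Configuration 𝔤)

/-- The first-order operator with the algebraic form of `D`, in which `P i` and `Q` stand for
`∇ᵢ` and `[Φ, ·]`. -/
def dirac (P : Fin 3 → TestFun 𝔤 →ₗ[ℝ] TestFun 𝔤) (Q : TestFun 𝔤 →ₗ[ℝ] TestFun 𝔤)
    (c : TestSection 𝔤) : TestSection 𝔤 :=
  (fun i => P (i + 1) (c.1 (i + 2)) - P (i + 2) (c.1 (i + 1)) - P i c.2 + Q (c.1 i),
    -(∑ i, P i (c.1 i)) - Q c.2)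

/-- The first-order operator with the algebraic form of `D^*`. -/
def diracStar (P : Fin 3 → TestFun 𝔤 →ₗ[ℝ] TestFun 𝔤) (Q : TestFun 𝔤 →ₗ[ℝ] TestFun 𝔤)
    (c : TestSection 𝔤) : TestSection 𝔤 :=
  (fun i => P (i + 1) (c.1 (i + 2)) - P (i + 2) (c.1 (i + 1)) + P i c.2 - Q (c.1 i),
    ∑ i, P i (c.1 i) + Q c.2)

theorem D_eq_dirac (c : TestSection 𝔤) : m.D c = dirac m.nabla m.adΦ c := rfl

theorem Dstar_eq_diracStar (c : TestSection 𝔤) : m.Dstar c = diracStar m.nabla m.adΦ c := rfl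

variable (P : Fin 3 → TestFun 𝔤 →ₗ[ℝ] TestFun 𝔤) (Q T : TestFun 𝔤 →ₗ[ℝ] TestFun 𝔤)

/-- The commutator of a Dirac-type operator with a componentwise operator is the Dirac-type operator
formed from the commutators. -/
theorem dirac_lift (c : TestSection 𝔤) : dirac P Q (lift T c) = lift T (dirac P Q c)
    + dirac (fun i => P i ∘ₗ T - T ∘ₗ P i) (Q ∘ₗ T - T ∘ₗ Q) c := by
  refine section_ext fun α => ?_
  rw [map_add, component_lift]
  cases α with
  | none =>
    simp only [component_none, dirac, Fin.sum_univ_three, map_sub, map_neg, map_add,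
      LinearMap.sub_apply, LinearMap.comp_apply]
    simp only [lift, LinearMap.prodMap_apply, LinearMap.pi_apply, LinearMap.comp_apply,
      LinearMap.proj_apply]
    abel
  | some i =>
    simp only [component_some, dirac, map_sub, map_add,
      LinearMap.sub_apply, LinearMap.comp_apply]
    simp only [lift, LinearMap.prodMap_apply, LinearMap.pi_apply, LinearMap.comp_apply,
      LinearMap.proj_apply]
    abel

theorem diracStar_lift (c : TestSection 𝔤) : diracStar P Q (lift T c) = lift T (diracStar P Q c)
    + diracStar (fun i => P i ∘ₗ T - T ∘ₗ P i) (Q ∘ₗ T - T ∘ₗ Q) c := by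
  refine section_ext fun α => ?_
  rw [map_add, component_lift]
  cases α with
  | none =>
    simp only [component_none, diracStar, Fin.sum_univ_three, map_add,
      LinearMap.sub_apply, LinearMap.comp_apply]
    simp only [lift, LinearMap.prodMap_apply, LinearMap.pi_apply, LinearMap.comp_apply,
      LinearMap.proj_apply]
    abel
  | some i =>
    simp only [component_some, diracStar, map_sub, map_add,
      LinearMap.sub_apply, LinearMap.comp_apply]
    simp only [lift, LinearMap.prodMap_apply, LinearMap.pi_apply, LinearMap.comp_apply,
      LinearMap.proj_apply]
    abel

/-- The sum, over all components of a section, of the sizes of the entries of a Dirac-type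
operator. -/
def diracBound (p : Seminorm ℝ (TestFun 𝔤)) (c : TestSection 𝔤) : ℝ :=
  ∑ β, (∑ i, p (P i (component β c)) + p (Q (component β c)))

variable {P Q} (p : Seminorm ℝ (TestFun 𝔤)) (c : TestSection 𝔤)

theorem le_diracBound_left (i : Fin 3) (β : Option (Fin 3)) :
    p (P i (component β c)) ≤ diracBound P Q p c := by
  have h1 : p (P i (component β c)) ≤ ∑ i, p (P i (component β c)) :=
    Finset.single_le_sum (f := fun i => p (P i (component β c))) (fun _ _ => apply_nonneg _ _)
      (Finset.mem_univ i)
  have h2 : ∑ i, p (P i (component β c)) + p (Q (component β c)) ≤ diracBound P Q p c :=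
    Finset.single_le_sum (f := fun β => ∑ i, p (P i (component β c)) + p (Q (component β c)))
      (fun _ _ => add_nonneg (Finset.sum_nonneg fun _ _ => apply_nonneg _ _) (apply_nonneg _ _))
      (Finset.mem_univ β)
  linarith [apply_nonneg p (Q (component β c))]

theorem le_diracBound_right (β : Option (Fin 3)) :
    p (Q (component β c)) ≤ diracBound P Q p c := by
  have h1 : 0 ≤ ∑ i, p (P i (component β c)) := Finset.sum_nonneg fun _ _ => apply_nonneg _ _
  have h2 : ∑ i, p (P i (component β c)) + p (Q (component β c)) ≤ diracBound P Q p c :=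
    Finset.single_le_sum (f := fun β => ∑ i, p (P i (component β c)) + p (Q (component β c)))
      (fun _ _ => add_nonneg (Finset.sum_nonneg fun _ _ => apply_nonneg _ _) (apply_nonneg _ _))
      (Finset.mem_univ β)
  linarith

theorem seminorm_four_le {K : ℝ} {x y z w : TestFun 𝔤} (hx : p x ≤ K) (hy : p y ≤ K)
    (hz : p z ≤ K) (hw : p w ≤ K) : p (x + y + z + w) ≤ 4 * K := by
  have h1 := map_add_le_add p (x + y + z) w
  have h2 := map_add_le_add p (x + y) z
  have h3 := map_add_le_add p x y
  linarith

theorem component_dirac_le (α : Option (Fin 3)) :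
    p (component α (dirac P Q c)) ≤ 4 * diracBound P Q p c := by
  have hl := fun i β => le_diracBound_left (P := P) (Q := Q) p c i β
  have hr := fun β => le_diracBound_right (P := P) (Q := Q) p c β
  cases α with
  | none =>
    simp only [component_none, dirac, Fin.sum_univ_three, neg_add, sub_eq_add_neg]
    exact seminorm_four_le p ((map_neg_eq_map p _).trans_le (hl 0 (some 0)))
      ((map_neg_eq_map p _).trans_le (hl 1 (some 1)))
      ((map_neg_eq_map p _).trans_le (hl 2 (some 2))) ((map_neg_eq_map p _).trans_le (hr none))
  | some i =>
    simp only [component_some, dirac, sub_eq_add_neg]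
    exact seminorm_four_le p (hl (i + 1) (some (i + 2)))
      ((map_neg_eq_map p _).trans_le (hl (i + 2) (some (i + 1))))
      ((map_neg_eq_map p _).trans_le (hl i none)) (hr (some i))

theorem component_diracStar_le (α : Option (Fin 3)) :
    p (component α (diracStar P Q c)) ≤ 4 * diracBound P Q p c := by
  have hl := fun i β => le_diracBound_left (P := P) (Q := Q) p c i β
  have hr := fun β => le_diracBound_right (P := P) (Q := Q) p c β
  cases α with
  | none =>
    simp only [component_none, diracStar, Fin.sum_univ_three]
    exact seminorm_four_le p (hl 0 (some 0)) (hl 1 (some 1)) (hl 2 (some 2)) (hr none)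
  | some i =>
    simp only [component_some, diracStar, sub_eq_add_neg]
    exact seminorm_four_le p (hl (i + 1) (some (i + 2)))
      ((map_neg_eq_map p _).trans_le (hl (i + 2) (some (i + 1)))) (hl i none)
      ((map_neg_eq_map p _).trans_le (hr (some i)))

theorem card_option_fin_three : (Finset.univ : Finset (Option (Fin 3))).card = 4 := rfl

theorem sum_component_le {K : ℝ} {f : Option (Fin 3) → ℝ} (h : ∀ α, f α ≤ K) :
    ∑ α, f α ≤ 4 * K := by
  have := Finset.sum_le_card_nsmul Finset.univ f K fun α _ => h α
  rwa [card_option_fin_three, nsmul_eq_mul] at this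

theorem secNrm_dirac_le (k : Fin 3) :
    m.secNrm k (dirac P Q c) ≤ 16 * diracBound P Q (m.nrm k) c := by
  have := sum_component_le fun α => component_dirac_le (P := P) (Q := Q) (m.nrm k) c α
  linarith [m.secNrm_le_sum k (dirac P Q c)]

theorem secNrm_diracStar_le (k : Fin 3) :
    m.secNrm k (diracStar P Q c) ≤ 16 * diracBound P Q (m.nrm k) c := by
  have := sum_component_le fun α => component_diracStar_le (P := P) (Q := Q) (m.nrm k) c α
  linarith [m.secNrm_le_sum k (diracStar P Q c)]

/-- The Laplacian `∇^*∇ - (ad Φ)²`. It is nonnegative, as `ad Φ` is skew. -/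
def Configuration.lap : TestFun 𝔤 →ₗ[ℝ] TestFun 𝔤 :=
  -(∑ i, m.nabla i ∘ₗ m.nabla i) - m.adΦ ∘ₗ m.adΦ

theorem lap_apply (s : TestFun 𝔤) :
    m.lap s = -(∑ i, m.nabla i (m.nabla i s)) - m.adΦ (m.adΦ s) := by
  simp [Configuration.lap]

theorem l2_lap (s t : TestFun 𝔤) :
    l2 (m.lap s) t = ∑ i, l2 (m.nabla i s) (m.nabla i t) + l2 (m.adΦ s) (m.adΦ t) := by
  rw [lap_apply, l2_sub_left, l2_neg_left, l2_sum_left, l2_adΦ, ← Finset.sum_neg_distrib,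
    sub_neg_eq_add]
  simp only [l2_nabla m _ (m.nabla _ s), neg_neg]

/-- The curvature term in `D^* D`: up to signs, twice the Dirac-type operator in which `[∇ᵢΦ, ·]`
replaces `∇ᵢ`. -/
def Configuration.curvTerm (c : TestSection 𝔤) : TestSection 𝔤 :=
  (fun i => (2 : ℝ) • (dirac m.adDer 0 c).1 i, -((2 : ℝ) • (dirac m.adDer 0 c).2))

/-- Weitzenböck formula: for a monopole the curvature terms in `D D^*` cancel. -/
theorem D_Dstar {m : Configuration 𝔤} (hB : m.IsBogomolny) (c : TestSection 𝔤) :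
    m.D (m.Dstar c) = lift m.lap c := by
  have h0 : ∀ s, m.nabla 1 (m.nabla 2 s) = m.nabla 2 (m.nabla 1 s) + m.adDer 0 s := nabla_comm hB 0
  have h1 : ∀ s, m.nabla 2 (m.nabla 0 s) = m.nabla 0 (m.nabla 2 s) + m.adDer 1 s := nabla_comm hB 1
  have h2 : ∀ s, m.nabla 0 (m.nabla 1 s) = m.nabla 1 (m.nabla 0 s) + m.adDer 2 s := nabla_comm hB 2
  have e1 : (1 + 1 : Fin 3) = 2 := rfl
  have e2 : (1 + 2 : Fin 3) = 0 := rfl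
  have e3 : (2 + 1 : Fin 3) = 0 := rfl
  have e4 : (2 + 2 : Fin 3) = 1 := rfl
  refine section_ext fun α => ?_
  rw [component_lift, lap_apply, D_eq_dirac, Dstar_eq_diracStar]
  rcases α with _ | i
  · simp only [component_none, dirac, diracStar, Fin.sum_univ_three, map_sub, map_add, nabla_adΦ,
      e1, e2, e3, e4, zero_add, h0, h1, h2]
    abel
  · fin_cases i <;>
    · simp only [component_some, dirac, diracStar, Fin.sum_univ_three, map_sub, map_add, nabla_adΦ,
        e1, e2, e3, e4, zero_add, h0, h1, h2, Fin.zero_eta, Fin.mk_one, Fin.reduceFinMk]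
      abel

/-- Weitzenböck formula for `D^* D`. -/
theorem Dstar_D {m : Configuration 𝔤} (hB : m.IsBogomolny) (c : TestSection 𝔤) :
    m.Dstar (m.D c) = lift m.lap c + m.curvTerm c := by
  have h0 : ∀ s, m.nabla 1 (m.nabla 2 s) = m.nabla 2 (m.nabla 1 s) + m.adDer 0 s := nabla_comm hB 0
  have h1 : ∀ s, m.nabla 2 (m.nabla 0 s) = m.nabla 0 (m.nabla 2 s) + m.adDer 1 s := nabla_comm hB 1
  have h2 : ∀ s, m.nabla 0 (m.nabla 1 s) = m.nabla 1 (m.nabla 0 s) + m.adDer 2 s := nabla_comm hB 2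
  have e1 : (1 + 1 : Fin 3) = 2 := rfl
  have e2 : (1 + 2 : Fin 3) = 0 := rfl
  have e3 : (2 + 1 : Fin 3) = 0 := rfl
  have e4 : (2 + 2 : Fin 3) = 1 := rfl
  refine section_ext fun α => ?_
  rw [map_add, component_lift, lap_apply, D_eq_dirac, Dstar_eq_diracStar]
  rcases α with _ | i
  · simp only [component_none, dirac, diracStar, Configuration.curvTerm, Fin.sum_univ_three,
      map_sub, map_add, map_neg, nabla_adΦ, e1, e2, e3, e4, zero_add, h0, h1, h2,
      LinearMap.zero_apply, two_smul]
    abel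
  · fin_cases i <;>
    · simp only [component_some, dirac, diracStar, Configuration.curvTerm, Fin.sum_univ_three,
        map_sub, map_add, map_neg, nabla_adΦ, e1, e2, e3, e4, zero_add, h0, h1, h2, Fin.zero_eta,
        Fin.mk_one, Fin.reduceFinMk, LinearMap.zero_apply, two_smul]
      abel

theorem component_curvTerm_le (α : Option (Fin 3)) :
    p (component α (m.curvTerm c)) ≤ 8 * ∑ β, ∑ i, p (m.adDer i (component β c)) := by
  have h : p (component α (m.curvTerm c)) = 2 * p (component α (dirac m.adDer 0 c)) := by
    cases α with
    | none => simp [Configuration.curvTerm, map_smul_eq_mul]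
    | some i => simp [Configuration.curvTerm, map_smul_eq_mul]
  have h2 := component_dirac_le (P := m.adDer) (Q := 0) p c α
  simp only [diracBound, LinearMap.zero_apply, map_zero, add_zero] at h2
  rw [h]
  linarith

theorem sectionForm_zero_eq_sum (c c' : TestSection 𝔤) :
    m.sectionForm 0 c c' = ∑ α, l2 (component α c) (component α c') := by
  simp only [Configuration.sectionForm, Configuration.form, Fintype.sum_option, component_some,
    component_none]
  rw [add_comm]

/-- The energy `‖∇c‖² + ‖[Φ, c]‖²`. -/
def Configuration.energy (c : TestSection 𝔤) : ℝ :=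
  ∑ α, (∑ i, m.nrm 0 (m.nabla i (component α c)) ^ 2 + m.nrm 0 (m.adΦ (component α c)) ^ 2)

theorem l2_lap_self (s : TestFun 𝔤) :
    l2 (m.lap s) s = ∑ i, m.nrm 0 (m.nabla i s) ^ 2 + m.nrm 0 (m.adΦ s) ^ 2 := by
  simp only [l2_lap, Configuration.nrm_zero_sq]

theorem nrm_one_sq (s : TestFun 𝔤) : m.nrm 1 s ^ 2
    = ∑ i, m.nrm 0 (m.nabla i s) ^ 2 + m.nrm 0 (wt 1 s) ^ 2 + m.nrm 0 (m.adΦ s) ^ 2 := by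
  simp only [Configuration.nrm_zero_sq, m.nrm_sq 1]
  rfl

/-- By Hardy's inequality the energy controls the norm of `H₁`. The constant is `13 = 1 + 3 · 2²`.
-/
theorem nrm_one_sq_le (s : TestFun 𝔤) : m.nrm 1 s ^ 2
    ≤ 13 * (∑ i, m.nrm 0 (m.nabla i s) ^ 2 + m.nrm 0 (m.adΦ s) ^ 2) := by
  have h1 := pow_le_pow_left₀ (apply_nonneg _ _) (hardy m s) 2
  rw [mul_pow] at h1
  have h2 : (∑ i, m.nrm 0 (m.nabla i s)) ^ 2 ≤ 3 * ∑ i, m.nrm 0 (m.nabla i s) ^ 2 := by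
    simpa using sq_sum_le_card_mul_sum_sq (s := Finset.univ) (f := fun i => m.nrm 0 (m.nabla i s))
  rw [nrm_one_sq]
  nlinarith [sq_nonneg (m.nrm 0 (m.adΦ s))]

theorem secNrm_one_sq_le : m.secNrm 1 c ^ 2 ≤ 13 * m.energy c := by
  rw [m.secNrm_sq, Configuration.energy, Finset.mul_sum]
  exact Finset.sum_le_sum fun α _ => nrm_one_sq_le m _

theorem secNrm_zero_sq (c : TestSection 𝔤) : m.secNrm 0 c ^ 2 = m.sectionForm 0 c c :=
  norm_preH_sq m 0 c

theorem secNrm_Dstar_sq {m : Configuration 𝔤} (hB : m.IsBogomolny) (c : TestSection 𝔤) :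
    m.secNrm 0 (m.Dstar c) ^ 2 = m.energy c := by
  rw [secNrm_zero_sq, ← l2Section_D, D_Dstar hB, sectionForm_zero_eq_sum]
  simp only [component_lift, l2_lap_self]
  rfl

theorem secNrm_D_sq {m : Configuration 𝔤} (hB : m.IsBogomolny) (c : TestSection 𝔤) :
    m.secNrm 0 (m.D c) ^ 2
      = m.energy c + ∑ α, l2 (component α (m.curvTerm c)) (component α c) := by
  rw [secNrm_zero_sq, l2Section_D, Dstar_D hB, sectionForm_zero_eq_sum]
  simp only [map_add, component_lift, l2_add_right, l2_symm (component _ c) (m.lap _),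
    l2_lap_self, Finset.sum_add_distrib, l2_symm (component _ c) (component _ (m.curvTerm c))]
  simp only [Configuration.energy, Finset.sum_add_distrib]

theorem nrm_wt_one_le_nrm_one (s : TestFun 𝔤) : m.nrm 0 (wt 1 s) ≤ m.nrm 1 s := by
  refine le_of_sq_le_sq ?_ (apply_nonneg _ _)
  rw [nrm_one_sq]
  have : 0 ≤ ∑ i, m.nrm 0 (m.nabla i s) ^ 2 := Finset.sum_nonneg fun _ _ => sq_nonneg _
  nlinarith [sq_nonneg (m.nrm 0 (m.adΦ s))]

theorem nrm_adΦ_le_nrm_one (s : TestFun 𝔤) : m.nrm 0 (m.adΦ s) ≤ m.nrm 1 s := by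
  refine le_of_sq_le_sq ?_ (apply_nonneg _ _)
  rw [nrm_one_sq]
  have : 0 ≤ ∑ i, m.nrm 0 (m.nabla i s) ^ 2 := Finset.sum_nonneg fun _ _ => sq_nonneg _
  nlinarith [sq_nonneg (m.nrm 0 (wt 1 s))]

theorem nrm_nabla_le_nrm_one (i : Fin 3) (s : TestFun 𝔤) :
    m.nrm 0 (m.nabla i s) ≤ m.nrm 1 s := by
  refine le_of_sq_le_sq ?_ (apply_nonneg _ _)
  rw [nrm_one_sq]
  have := Finset.single_le_sum (f := fun i => m.nrm 0 (m.nabla i s) ^ 2)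
    (fun _ _ => sq_nonneg _) (Finset.mem_univ i)
  nlinarith [sq_nonneg (m.nrm 0 (wt 1 s)), sq_nonneg (m.nrm 0 (m.adΦ s))]

/-- The form `⟪[∇ᵢΦ, s], t⟫` is compact relative to the norm of `H₁`: the decay of `∇ᵢΦ` leaves a
weight `ρ⁻²` on `t`. -/
theorem abs_l2_adDer_le {C : ℝ} {m : Configuration 𝔤} (h : m.HasDecay C) (i : Fin 3)
    (s t : TestFun 𝔤) :
    |l2 (m.adDer i s) t| ≤ 4 * C * m.nrm 1 s * m.nrm 0 (wt 2 t) := by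
  -- the weight `ρ⁻²` is moved to `t` by replacing `s` with `ρ² s`
  let s' : TestFun 𝔤 := mulFun (fun x => rho x ^ 2) (contDiff_rho.pow 2) s
  have hw : ∀ (k : ℕ) (t' : TestFun 𝔤),
      wt (k + 2) (mulFun (fun x => rho x ^ 2) (contDiff_rho.pow 2) t') = wt k t' := fun k t' => by
    ext x
    change (rho x ^ (k + 2))⁻¹ • rho x ^ 2 • t'.1 x = (rho x ^ k)⁻¹ • t'.1 x
    rw [smul_smul]
    congr 1
    have := (rho_pos x).ne'
    field_simp
    ring
  have h1 : l2 (m.adDer i s) t = l2 (m.adDer i s') (wt 2 t) := by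
    simp only [l2]
    refine integral_congr_ae (.of_forall fun x => ?_)
    simp only [s', adDer_apply, mulFun_apply, wt_apply, lie_smul, real_inner_smul_left,
      real_inner_smul_right]
    have := (rho_pos x).ne'
    field_simp
  have h2 : m.adΦ s' = mulFun (fun x => rho x ^ 2) (contDiff_rho.pow 2) (m.adΦ s) := by
    ext x
    exact lie_smul _ _ _
  have h3 := nrm_adDer_le h i s'
  rw [h2, hw 0, hw 1, wt_zero] at h3
  have h4 : 2 * C * (m.nrm 0 (m.adΦ s) + m.nrm 0 (wt 1 s)) ≤ 2 * C * (m.nrm 1 s + m.nrm 1 s) :=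
    mul_le_mul_of_nonneg_left
      (add_le_add (nrm_adΦ_le_nrm_one m s) (nrm_wt_one_le_nrm_one m s)) (by linarith [h.nonneg])
  rw [h1]
  refine (abs_l2_le m _ _).trans (mul_le_mul_of_nonneg_right ?_ (apply_nonneg _ _))
  linarith

/-- There is no remainder, since `‖D^* c‖²` is the energy; in particular `D^*` is injective on `H₁`.
-/
theorem estimate_Dstar {m : Configuration 𝔤} (hB : m.IsBogomolny) (c : TestSection 𝔤) :
    m.secNrm 1 c ≤ 4 * m.secNrm 0 (m.Dstar c) := by
  refine le_of_sq_le_sq ?_ (mul_nonneg (by norm_num) (apply_nonneg _ _))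
  have h := secNrm_one_sq_le m c
  rw [← secNrm_Dstar_sq hB] at h
  nlinarith [sq_nonneg (m.secNrm 0 (m.Dstar c))]

/-- The curvature term in `‖D c‖²` is bounded by the product of the `H₁` norm and the norm of `ρ⁻²
c`, and the `H₁` norm is absorbed into the left-hand side. -/
theorem estimate_D {C : ℝ} {m : Configuration 𝔤} (hB : m.IsBogomolny) (h : m.HasDecay C) :
    ∃ K : ℝ, 0 ≤ K ∧ ∀ c, m.secNrm 1 c
      ≤ K * (m.secNrm 0 (m.D c) + ∑ α, m.nrm 0 (wt 2 (component α c))) := by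
  refine ⟨4 + 13 * (384 * C), by linarith [h.nonneg], fun c => ?_⟩
  set y := ∑ α, m.nrm 0 (wt 2 (component α c))
  set x := m.secNrm 1 c
  set a := m.secNrm 0 (m.D c)
  have hC := h.nonneg
  have hx : 0 ≤ x := apply_nonneg _ _
  have ha : 0 ≤ a := apply_nonneg _ _
  have hy : 0 ≤ y := Finset.sum_nonneg fun _ _ => apply_nonneg _ _
  have h1 : ∀ α, |l2 (component α (m.curvTerm c)) (component α c)|
      ≤ 384 * C * x * m.nrm 0 (wt 2 (component α c)) := fun α => by
    let q : Seminorm ℝ (TestFun 𝔤) := (normSeminorm ℝ ℝ).comp (l2B.flip (component α c))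
    have hq : ∀ s, q s = |l2 s (component α c)| := fun s => rfl
    have h2 := component_curvTerm_le m q c α
    rw [hq] at h2
    refine h2.trans ?_
    have h3 : ∀ β, ∑ i, q (m.adDer i (component β c))
        ≤ 12 * C * x * m.nrm 0 (wt 2 (component α c)) := fun β => by
      have h4 : ∀ i ∈ Finset.univ, q (m.adDer i (component β c))
          ≤ 4 * C * x * m.nrm 0 (wt 2 (component α c)) := fun i _ => by
        refine (abs_l2_adDer_le h i _ _).trans
          (mul_le_mul_of_nonneg_right ?_ (apply_nonneg _ _))
        exact mul_le_mul_of_nonneg_left (m.nrm_component_le 1 β c) (by linarith)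
      have h5 := Finset.sum_le_card_nsmul Finset.univ _ _ h4
      simp only [Finset.card_univ, Fintype.card_fin, nsmul_eq_mul] at h5
      push_cast at h5
      linarith
    have h6 := sum_component_le h3
    linarith
  have h7 : |∑ α, l2 (component α (m.curvTerm c)) (component α c)| ≤ 384 * C * x * y := by
    rw [Finset.mul_sum]
    exact (Finset.abs_sum_le_sum_abs _ _).trans (Finset.sum_le_sum fun α _ => h1 α)
  have h8 := secNrm_D_sq hB c
  have h9 := secNrm_one_sq_le m c
  have h10 := (abs_le.1 h7).1
  -- the linear term in `x` is absorbed: `x² ≤ p a² + q x y` gives `x ≤ √p a + q y`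
  have h11 : x ^ 2 ≤ 13 * a ^ 2 + 13 * (384 * C) * x * y := by
    simp only [x, a] at *
    linarith
  have hb : 0 ≤ 13 * (384 * C) := by linarith
  have h12 : x ≤ 4 * a + 13 * (384 * C) * y := by
    by_contra! hlt
    have hby : 0 ≤ 13 * (384 * C) * y := mul_nonneg hb hy
    nlinarith [mul_nonneg ha hby]
  nlinarith [mul_nonneg hb ha]

end Weitzenbock

/-! ### Second-order estimates -/

section SecondOrder

variable {𝔤 : Type*} [InvariantLieAlgebra 𝔤] [FiniteDimensional ℝ 𝔤] (m : Configuration 𝔤)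

theorem nrm_two_sq (s : TestFun 𝔤) : m.nrm 2 s ^ 2
    = ∑ i, ∑ j, m.nrm 0 (m.nabla i (m.nabla j s)) ^ 2 + ∑ i, m.nrm 0 (wt 1 (m.nabla i s)) ^ 2
      + ∑ i, m.nrm 0 (m.adΦ (m.nabla i s)) ^ 2 + m.nrm 0 (m.adΦ (m.adΦ s)) ^ 2
      + m.nrm 0 (wt 1 (m.adΦ s)) ^ 2 + m.nrm 0 (wt 2 s) ^ 2 := by
  simp only [Configuration.nrm_zero_sq, m.nrm_sq 2, ← adΦ_wt]
  rfl

theorem nrm_one_nabla_le (j : Fin 3) (s : TestFun 𝔤) : m.nrm 1 (m.nabla j s) ≤ m.nrm 2 s := by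
  refine le_of_sq_le_sq ?_ (apply_nonneg _ _)
  rw [nrm_one_sq, nrm_two_sq]
  have h1 : ∑ i, m.nrm 0 (m.nabla i (m.nabla j s)) ^ 2
      ≤ ∑ i, ∑ j, m.nrm 0 (m.nabla i (m.nabla j s)) ^ 2 := Finset.sum_le_sum fun i _ =>
    Finset.single_le_sum (f := fun j => m.nrm 0 (m.nabla i (m.nabla j s)) ^ 2)
      (fun _ _ => sq_nonneg _) (Finset.mem_univ j)
  have h2 := Finset.single_le_sum (f := fun i => m.nrm 0 (wt 1 (m.nabla i s)) ^ 2)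
    (fun _ _ => sq_nonneg _) (Finset.mem_univ j)
  have h3 := Finset.single_le_sum (f := fun i => m.nrm 0 (m.adΦ (m.nabla i s)) ^ 2)
    (fun _ _ => sq_nonneg _) (Finset.mem_univ j)
  nlinarith [sq_nonneg (m.nrm 0 (m.adΦ (m.adΦ s))), sq_nonneg (m.nrm 0 (wt 1 (m.adΦ s))),
    sq_nonneg (m.nrm 0 (wt 2 s))]

theorem nrm_two_lower (s : TestFun 𝔤) : m.nrm 0 (m.adΦ (m.adΦ s)) ≤ m.nrm 2 s ∧
    m.nrm 0 (wt 1 (m.adΦ s)) ≤ m.nrm 2 s ∧ m.nrm 0 (wt 2 s) ≤ m.nrm 2 s := by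
  have h1 : 0 ≤ ∑ i, ∑ j, m.nrm 0 (m.nabla i (m.nabla j s)) ^ 2 :=
    Finset.sum_nonneg fun _ _ => Finset.sum_nonneg fun _ _ => sq_nonneg _
  have h2 : 0 ≤ ∑ i, m.nrm 0 (wt 1 (m.nabla i s)) ^ 2 := Finset.sum_nonneg fun _ _ => sq_nonneg _
  have h3 : 0 ≤ ∑ i, m.nrm 0 (m.adΦ (m.nabla i s)) ^ 2 := Finset.sum_nonneg fun _ _ => sq_nonneg _
  have h4 := sq_nonneg (m.nrm 0 (m.adΦ (m.adΦ s)))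
  have h5 := sq_nonneg (m.nrm 0 (wt 1 (m.adΦ s)))
  have h6 := sq_nonneg (m.nrm 0 (wt 2 s))
  refine ⟨?_, ?_, ?_⟩ <;>
  · refine le_of_sq_le_sq ?_ (apply_nonneg _ _)
    rw [nrm_two_sq]
    linarith

theorem nrm_one_le_sum (s : TestFun 𝔤) : m.nrm 1 s
    ≤ ∑ i, m.nrm 0 (m.nabla i s) + m.nrm 0 (wt 1 s) + m.nrm 0 (m.adΦ s) := by
  have h1 : 0 ≤ ∑ i, m.nrm 0 (m.nabla i s) := Finset.sum_nonneg fun _ _ => apply_nonneg _ _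
  have h2 : 0 ≤ m.nrm 0 (wt 1 s) := apply_nonneg _ _
  have h3 : 0 ≤ m.nrm 0 (m.adΦ s) := apply_nonneg _ _
  refine le_of_sq_le_sq ?_ (by positivity)
  rw [nrm_one_sq]
  have h4 := sum_sq_le_sq_sum Finset.univ (f := fun i => m.nrm 0 (m.nabla i s))
    fun _ => apply_nonneg _ _
  nlinarith [mul_nonneg h1 h2, mul_nonneg h2 h3, mul_nonneg h1 h3]

theorem sum_fin_three_le {K : ℝ} {f : Fin 3 → ℝ} (h : ∀ i, f i ≤ K) : ∑ i, f i ≤ 3 * K := by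
  rw [Fin.sum_univ_three]
  linarith [h 0, h 1, h 2]

/-- The bracket with `Φ` is bounded from `H₂` to `H₁`. The commutator with `∇ᵢ` is controlled by the
term `ρ⁻² s` in the norm of `H₂`. -/
theorem nrm_one_adΦ_le {C : ℝ} {m : Configuration 𝔤} (h : m.HasDecay C) (s : TestFun 𝔤) :
    m.nrm 1 (m.adΦ s) ≤ (5 + 3 * (‖bracketL (𝔤 := 𝔤)‖ * C)) * m.nrm 2 s := by
  obtain ⟨h1, h2, h3⟩ := nrm_two_lower m s
  have h4 : ∀ i, m.nrm 0 (m.nabla i (m.adΦ s))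
      ≤ m.nrm 2 s + ‖bracketL (𝔤 := 𝔤)‖ * C * m.nrm 2 s := fun i => by
    rw [nabla_adΦ]
    refine (map_add_le_add _ _ _).trans (add_le_add ?_ ?_)
    · exact (nrm_adΦ_le_nrm_one m _).trans (nrm_one_nabla_le m i s)
    · exact (nrm_adDer_le' h i s).trans (mul_le_mul_of_nonneg_left h3
        (mul_nonneg (norm_nonneg (bracketL (𝔤 := 𝔤))) h.nonneg))
  have h5 := sum_fin_three_le h4
  have h6 := nrm_one_le_sum m (m.adΦ s)
  linarith

theorem nabla_wt_one (i : Fin 3) (s : TestFun 𝔤) :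
    m.nabla i (wt 1 s) = wt 1 (m.nabla i s) - radial 3 i s := by
  ext x
  have h : (m.nabla i (wt 1 s)).1 x = _ := nabla_mulFun m i (contDiff_rho_inv_pow 1) s x
  change (m.nabla i (wt 1 s)).1 x = (wt 1 (m.nabla i s)).1 x - (radial 3 i s).1 x
  rw [h, fderiv_rho_inv_pow, wt_apply, radial, mulFun_apply, sub_eq_add_neg, ← neg_smul]
  simp

theorem nrm_radial_succ_le (k : ℕ) (i : Fin 3) (s : TestFun 𝔤) :
    m.nrm 0 (radial (k + 1) i s) ≤ m.nrm 0 (wt k s) := by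
  rw [← one_mul (m.nrm 0 (wt k s))]
  refine nrm_zero_le_of_pointwise' m zero_le_one fun x => ?_
  rw [radial, mulFun_apply, wt_apply, norm_smul, norm_smul, one_mul]
  refine mul_le_mul_of_nonneg_right ?_ (norm_nonneg _)
  have hr := rho_pos x
  rw [Real.norm_eq_abs, abs_mul, abs_of_pos (inv_pos.2 (pow_pos hr _)),
    Real.norm_of_nonneg (inv_nonneg.2 (pow_pos hr _).le), pow_succ, mul_inv,
    mul_comm (rho x ^ k)⁻¹, ← mul_assoc]
  refine mul_le_of_le_one_left (inv_nonneg.2 (pow_pos hr _).le) ?_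
  rw [← div_eq_mul_inv]
  exact div_le_one_of_le₀ ((abs_apply_le_norm x i).trans (norm_le_rho x)) hr.le

theorem nrm_one_wt_one_le (s : TestFun 𝔤) : m.nrm 1 (wt 1 s) ≤ 8 * m.nrm 2 s := by
  obtain ⟨h1, h2, h3⟩ := nrm_two_lower m s
  have h4 : ∀ i, m.nrm 0 (m.nabla i (wt 1 s)) ≤ 2 * m.nrm 2 s := fun i => by
    rw [nabla_wt_one]
    have h5 := map_sub_le_add (m.nrm 0) (wt 1 (m.nabla i s)) (radial 3 i s)
    have h6 := (nrm_wt_one_le_nrm_one m _).trans (nrm_one_nabla_le m i s)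
    have h7 := nrm_radial_succ_le m 2 i s
    simp only [Nat.reduceAdd] at h7
    linarith
  have h5 := sum_fin_three_le h4
  have h6 := nrm_one_le_sum m (wt 1 s)
  rw [wt_wt, adΦ_wt] at h6
  simp only [Nat.reduceAdd] at h6
  linarith

theorem add_sq_le_of_hardy {q S t a w W : ℝ} (hS : 0 ≤ S) (ha : 0 ≤ a) (hw : 0 ≤ w) (hW : 0 ≤ W)
    (hq : q ≤ S ^ 2) (ht : t ≤ a ^ 2) (h : W ≤ 2 * w + 2 * S) :
    q + t + W ^ 2 ≤ (5 * (S + a + w)) ^ 2 := by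
  have h1 := pow_le_pow_left₀ hW h 2
  nlinarith [mul_nonneg hS hw, mul_nonneg hS ha, mul_nonneg hw ha, sq_nonneg S, sq_nonneg a,
    sq_nonneg w]

/-- The norm of `H₂` is controlled by the norms of `∇ⱼ s` and `[Φ, s]` in `H₁`; the term `ρ⁻² s`,
which these do not contain, is recovered from `hardy_two` up to a term `ρ⁻³ s`. -/
theorem nrm_two_le (s : TestFun 𝔤) : m.nrm 2 s
    ≤ 5 * (∑ i, m.nrm 1 (m.nabla i s) + m.nrm 1 (m.adΦ s) + m.nrm 0 (wt 3 s)) := by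
  have hS : 0 ≤ ∑ i, m.nrm 1 (m.nabla i s) := Finset.sum_nonneg fun _ _ => apply_nonneg _ _
  have ha : 0 ≤ m.nrm 1 (m.adΦ s) := apply_nonneg _ _
  have hw : 0 ≤ m.nrm 0 (wt 3 s) := apply_nonneg _ _
  have h1 : ∑ i, ∑ j, m.nrm 0 (m.nabla i (m.nabla j s)) ^ 2 + ∑ i, m.nrm 0 (wt 1 (m.nabla i s)) ^ 2
      + ∑ i, m.nrm 0 (m.adΦ (m.nabla i s)) ^ 2 = ∑ i, m.nrm 1 (m.nabla i s) ^ 2 := by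
    rw [Finset.sum_comm, ← Finset.sum_add_distrib, ← Finset.sum_add_distrib]
    exact Finset.sum_congr rfl fun i _ => (nrm_one_sq m _).symm
  have h2 : m.nrm 0 (m.adΦ (m.adΦ s)) ^ 2 + m.nrm 0 (wt 1 (m.adΦ s)) ^ 2
      ≤ m.nrm 1 (m.adΦ s) ^ 2 := by
    rw [nrm_one_sq]
    have : 0 ≤ ∑ i, m.nrm 0 (m.nabla i (m.adΦ s)) ^ 2 := Finset.sum_nonneg fun _ _ => sq_nonneg _
    linarith
  have h3 := hardy_two m s
  have h4 : ∑ i, m.nrm 0 (wt 1 (m.nabla i s)) ≤ ∑ i, m.nrm 1 (m.nabla i s) :=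
    Finset.sum_le_sum fun i _ => nrm_wt_one_le_nrm_one m _
  have h6 := sum_sq_le_sq_sum Finset.univ (f := fun i => m.nrm 1 (m.nabla i s))
    fun _ => apply_nonneg _ _
  have h7 := add_sq_le_of_hardy hS ha hw (apply_nonneg _ _) h6 h2
    (W := m.nrm 0 (wt 2 s)) (by linarith)
  refine le_of_sq_le_sq (le_of_eq_of_le ?_ h7) (by linarith)
  rw [nrm_two_sq, ← h1]
  ring

/-- The commutators of covariant derivatives in arbitrary directions, for which only the cyclic ones
need to be computed. -/
theorem nrm_nabla_comm_le {m : Configuration 𝔤} (hB : m.IsBogomolny) (i j : Fin 3)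
    (s : TestFun 𝔤) :
    m.nrm 0 (m.nabla i (m.nabla j s) - m.nabla j (m.nabla i s)) ≤ ∑ k, m.nrm 0 (m.adDer k s) := by
  have hk : ∀ k, m.nrm 0 (m.adDer k s) ≤ ∑ k, m.nrm 0 (m.adDer k s) := fun k =>
    Finset.single_le_sum (f := fun k => m.nrm 0 (m.adDer k s)) (fun _ _ => apply_nonneg _ _)
      (Finset.mem_univ k)
  have h0 : m.nabla 1 (m.nabla 2 s) - m.nabla 2 (m.nabla 1 s) = m.adDer 0 s :=
    sub_eq_of_eq_add' (nabla_comm hB 0 s)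
  have h1 : m.nabla 2 (m.nabla 0 s) - m.nabla 0 (m.nabla 2 s) = m.adDer 1 s :=
    sub_eq_of_eq_add' (nabla_comm hB 1 s)
  have h2 : m.nabla 0 (m.nabla 1 s) - m.nabla 1 (m.nabla 0 s) = m.adDer 2 s :=
    sub_eq_of_eq_add' (nabla_comm hB 2 s)
  have h0' := map_sub_rev (m.nrm 0) (m.nabla 1 (m.nabla 2 s)) (m.nabla 2 (m.nabla 1 s))
  have h1' := map_sub_rev (m.nrm 0) (m.nabla 2 (m.nabla 0 s)) (m.nabla 0 (m.nabla 2 s))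
  have h2' := map_sub_rev (m.nrm 0) (m.nabla 0 (m.nabla 1 s)) (m.nabla 1 (m.nabla 0 s))
  rw [h0] at h0'
  rw [h1] at h1'
  rw [h2] at h2'
  have hz : 0 ≤ ∑ k, m.nrm 0 (m.adDer k s) := Finset.sum_nonneg fun _ _ => apply_nonneg _ _
  fin_cases i <;> fin_cases j <;>
    simp only [Fin.zero_eta, Fin.mk_one, Fin.reduceFinMk, sub_self, map_zero, hz, h0, h1, h2, hk,
      ← h0', ← h1', ← h2']

/-- The remainder in the second-order estimates. Compared with the norm of `H₂`, every term carries
an additional factor `ρ⁻¹`. -/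
def Configuration.remainder (c : TestSection 𝔤) : ℝ :=
  ∑ α, (∑ i, m.nrm 0 (wt 2 (m.nabla i (component α c))) + m.nrm 0 (wt 2 (m.adΦ (component α c)))
    + m.nrm 0 (wt 3 (component α c)))

theorem remainder_terms_le (c : TestSection 𝔤) :
    (∀ i, ∑ α, m.nrm 0 (wt 2 (m.nabla i (component α c))) ≤ m.remainder c) ∧
    ∑ α, m.nrm 0 (wt 2 (m.adΦ (component α c))) ≤ m.remainder c ∧
    ∑ α, m.nrm 0 (wt 3 (component α c)) ≤ m.remainder c ∧
    ∑ α, (m.nrm 0 (wt 2 (m.adΦ (component α c))) + m.nrm 0 (wt 3 (component α c)))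
      ≤ m.remainder c := by
  have n : ∀ t, 0 ≤ m.nrm 0 t := fun t => apply_nonneg _ _
  have hi : ∀ α i, m.nrm 0 (wt 2 (m.nabla i (component α c)))
      ≤ ∑ i, m.nrm 0 (wt 2 (m.nabla i (component α c))) := fun α i =>
    Finset.single_le_sum (f := fun i => m.nrm 0 (wt 2 (m.nabla i (component α c))))
      (fun _ _ => n _) (Finset.mem_univ i)
  have hs : ∀ α, 0 ≤ ∑ i, m.nrm 0 (wt 2 (m.nabla i (component α c))) := fun α =>
    Finset.sum_nonneg fun _ _ => n _
  refine ⟨fun i => ?_, ?_, ?_, ?_⟩ <;> refine Finset.sum_le_sum fun α _ => ?_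
  · linarith [hi α i, n (wt 2 (m.adΦ (component α c))), n (wt 3 (component α c))]
  · linarith [hs α, n (wt 3 (component α c))]
  · linarith [hs α, n (wt 2 (m.adΦ (component α c)))]
  · linarith [hs α]

/-- The commutator terms are part of the remainder; this is where maximal symmetry breaking is
needed. -/
theorem sum_nrm_adDer_le {C : ℝ} {m : Configuration 𝔤} (h : m.HasDecay C) (c : TestSection 𝔤) :
    ∑ α, ∑ k, m.nrm 0 (m.adDer k (component α c)) ≤ 6 * C * m.remainder c := by
  calc ∑ α, ∑ k, m.nrm 0 (m.adDer k (component α c))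
      ≤ ∑ α, 3 * (2 * C * (m.nrm 0 (wt 2 (m.adΦ (component α c)))
          + m.nrm 0 (wt 3 (component α c)))) :=
        Finset.sum_le_sum fun α _ => sum_fin_three_le fun k => nrm_adDer_le h k _
    _ = 6 * C * ∑ α, (m.nrm 0 (wt 2 (m.adΦ (component α c)))
          + m.nrm 0 (wt 3 (component α c))) := by
        rw [Finset.mul_sum]
        exact Finset.sum_congr rfl fun α _ => by ring
    _ ≤ _ := mul_le_mul_of_nonneg_left (remainder_terms_le m c).2.2.2 (by linarith [h.nonneg])

/-- The second-order estimate follows from the first-order one by commuting the operator with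
`∇ⱼ` and `[Φ, ·]`, the commutators being brackets with `∇Φ`. -/
theorem estimate_two {C K : ℝ} {m : Configuration 𝔤} (hB : m.IsBogomolny) (h : m.HasDecay C)
    (T : TestSection 𝔤 → TestSection 𝔤)
    (hT : ∀ S c, m.secNrm 0 (T (lift S c)) ≤ m.secNrm 0 (lift S (T c)) + 16 *
      diracBound (fun i => m.nabla i ∘ₗ S - S ∘ₗ m.nabla i) (m.adΦ ∘ₗ S - S ∘ₗ m.adΦ) (m.nrm 0) c)
    (hK : 0 ≤ K) (h1 : ∀ c, m.secNrm 1 c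
      ≤ K * (m.secNrm 0 (T c) + ∑ α, m.nrm 0 (wt 2 (component α c)))) :
    ∃ K' : ℝ, 0 ≤ K' ∧ ∀ c, m.secNrm 2 c ≤ K' * (m.secNrm 1 (T c) + m.remainder c) := by
  have hC := h.nonneg
  set L := K * (4 + (1 + 64 * (6 * C)))
  have hL : 0 ≤ L := by positivity
  refine ⟨20 * (4 * L + 1), by positivity, fun c => ?_⟩
  have hr0 : 0 ≤ m.remainder c := Finset.sum_nonneg fun _ _ => add_nonneg (add_nonneg
    (Finset.sum_nonneg fun _ _ => apply_nonneg _ _) (apply_nonneg _ _)) (apply_nonneg _ _)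
  have hn0 : 0 ≤ m.secNrm 1 (T c) := apply_nonneg _ _
  have n : ∀ t, 0 ≤ m.nrm 0 t := fun t => apply_nonneg _ _
  obtain ⟨r1, r2, r3, -⟩ := remainder_terms_le m c
  have hb := sum_nrm_adDer_le h c
  have lower : ∀ S : TestFun 𝔤 →ₗ[ℝ] TestFun 𝔤, (∀ s, m.nrm 0 (S s) ≤ m.nrm 1 s) →
      m.secNrm 0 (lift S (T c)) ≤ 4 * m.secNrm 1 (T c) := fun S hS => by
    refine (m.secNrm_le_sum 0 _).trans (sum_component_le fun α => ?_)
    rw [component_lift]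
    exact (hS _).trans (m.nrm_component_le 1 α _)
  have step : ∀ S : TestFun 𝔤 →ₗ[ℝ] TestFun 𝔤, (∀ s, m.nrm 0 (S s) ≤ m.nrm 1 s) →
      diracBound (fun i => m.nabla i ∘ₗ S - S ∘ₗ m.nabla i) (m.adΦ ∘ₗ S - S ∘ₗ m.adΦ) (m.nrm 0) c
        ≤ 4 * ∑ α, ∑ k, m.nrm 0 (m.adDer k (component α c)) →
      ∑ α, m.nrm 0 (wt 2 (S (component α c))) ≤ m.remainder c →
      ∀ α, m.nrm 1 (S (component α c)) ≤ L * (m.secNrm 1 (T c) + m.remainder c) :=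
    fun S hS hd hr α => by
      have h2 := m.nrm_component_le 1 α (lift S c)
      have h3 := h1 (lift S c)
      simp only [component_lift] at h2 h3
      refine h2.trans (h3.trans ?_)
      rw [mul_assoc]
      refine mul_le_mul_of_nonneg_left ?_ hK
      have h4 := hT S c
      have h5 := lower S hS
      nlinarith [mul_nonneg hC hn0]
  have hsum : ∀ α, m.nrm 0 (wt 3 (component α c)) ≤ m.remainder c := fun α =>
    (Finset.single_le_sum (f := fun α => m.nrm 0 (wt 3 (component α c))) (fun _ _ => n _)
      (Finset.mem_univ α)).trans r3
  have hnab : ∀ j α, m.nrm 1 (m.nabla j (component α c))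
      ≤ L * (m.secNrm 1 (T c) + m.remainder c) := fun j =>
    step (m.nabla j) (nrm_nabla_le_nrm_one m j) (by
      rw [diracBound, Finset.mul_sum]
      refine Finset.sum_le_sum fun α _ => ?_
      have h2 := sum_fin_three_le fun i => nrm_nabla_comm_le hB i j (component α c)
      have h3 : m.nrm 0 ((m.adΦ ∘ₗ m.nabla j - m.nabla j ∘ₗ m.adΦ) (component α c))
          ≤ ∑ k, m.nrm 0 (m.adDer k (component α c)) := by
        have h4 : (m.adΦ ∘ₗ m.nabla j - m.nabla j ∘ₗ m.adΦ) (component α c)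
            = -m.adDer j (component α c) := by
          simp only [LinearMap.sub_apply, LinearMap.comp_apply, nabla_adΦ]
          abel
        rw [h4, map_neg_eq_map]
        exact Finset.single_le_sum (f := fun k => m.nrm 0 (m.adDer k (component α c)))
          (fun _ _ => n _) (Finset.mem_univ j)
      simp only [LinearMap.sub_apply, LinearMap.comp_apply] at h2 h3 ⊢
      linarith) (r1 j)
  have hΦ : ∀ α, m.nrm 1 (m.adΦ (component α c)) ≤ L * (m.secNrm 1 (T c) + m.remainder c) :=
    step m.adΦ (nrm_adΦ_le_nrm_one m) (by
      rw [diracBound, Finset.mul_sum]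
      refine Finset.sum_le_sum fun α _ => ?_
      have h4 : ∀ i, (m.nabla i ∘ₗ m.adΦ - m.adΦ ∘ₗ m.nabla i) (component α c)
          = m.adDer i (component α c) := fun i => by
        simp only [LinearMap.sub_apply, LinearMap.comp_apply, nabla_adΦ]
        abel
      have h5 : (m.adΦ ∘ₗ m.adΦ - m.adΦ ∘ₗ m.adΦ) (component α c) = 0 := by
        rw [LinearMap.sub_apply]
        exact sub_self _
      simp only [h4, h5, map_zero, add_zero]
      have : 0 ≤ ∑ k, m.nrm 0 (m.adDer k (component α c)) := Finset.sum_nonneg fun _ _ => n _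
      linarith) r2
  have hcomp : ∀ α, m.nrm 2 (component α c)
      ≤ 5 * ((4 * L + 1) * (m.secNrm 1 (T c) + m.remainder c)) := fun α => by
    have h2 := nrm_two_le m (component α c)
    have h3 := sum_fin_three_le fun j => hnab j α
    have h4 := hΦ α
    have h5 := hsum α
    linarith
  have := sum_component_le hcomp
  linarith [m.secNrm_le_sum 2 c]

theorem secNrm_D_lift_le (S : TestFun 𝔤 →ₗ[ℝ] TestFun 𝔤) (c : TestSection 𝔤) :
    m.secNrm 0 (m.D (lift S c)) ≤ m.secNrm 0 (lift S (m.D c)) + 16 *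
      diracBound (fun i => m.nabla i ∘ₗ S - S ∘ₗ m.nabla i) (m.adΦ ∘ₗ S - S ∘ₗ m.adΦ)
        (m.nrm 0) c := by
  rw [D_eq_dirac, dirac_lift]
  exact (map_add_le_add _ _ _).trans (add_le_add le_rfl (secNrm_dirac_le m c 0))

theorem secNrm_Dstar_lift_le (S : TestFun 𝔤 →ₗ[ℝ] TestFun 𝔤) (c : TestSection 𝔤) :
    m.secNrm 0 (m.Dstar (lift S c)) ≤ m.secNrm 0 (lift S (m.Dstar c)) + 16 *
      diracBound (fun i => m.nabla i ∘ₗ S - S ∘ₗ m.nabla i) (m.adΦ ∘ₗ S - S ∘ₗ m.adΦ)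
        (m.nrm 0) c := by
  rw [Dstar_eq_diracStar, diracStar_lift]
  exact (map_add_le_add _ _ _).trans (add_le_add le_rfl (secNrm_diracStar_le m c 0))

theorem diracBound_zero_le (c : TestSection 𝔤) :
    diracBound m.nabla m.adΦ (m.nrm 0) c ≤ 16 * m.secNrm 1 c := by
  have : ∀ β, ∑ i, m.nrm 0 (m.nabla i (component β c)) + m.nrm 0 (m.adΦ (component β c))
      ≤ 4 * m.secNrm 1 c := fun β => by
    have h1 := sum_fin_three_le fun i => nrm_nabla_le_nrm_one m i (component β c)
    linarith [nrm_adΦ_le_nrm_one m (component β c), m.nrm_component_le 1 β c]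
  have := sum_component_le this
  rw [diracBound]
  linarith

theorem diracBound_one_le {C : ℝ} {m : Configuration 𝔤} (h : m.HasDecay C) (c : TestSection 𝔤) :
    diracBound m.nabla m.adΦ (m.nrm 1) c
      ≤ 4 * (8 + 3 * (‖bracketL (𝔤 := 𝔤)‖ * C)) * m.secNrm 2 c := by
  have hb : 0 ≤ ‖bracketL (𝔤 := 𝔤)‖ * C := mul_nonneg (norm_nonneg (bracketL (𝔤 := 𝔤))) h.nonneg
  have : ∀ β, ∑ i, m.nrm 1 (m.nabla i (component β c)) + m.nrm 1 (m.adΦ (component β c))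
      ≤ (8 + 3 * (‖bracketL (𝔤 := 𝔤)‖ * C)) * m.secNrm 2 c := fun β => by
    have h1 := sum_fin_three_le fun i => nrm_one_nabla_le m i (component β c)
    have h2 := nrm_one_adΦ_le h (component β c)
    have h3 := mul_le_mul_of_nonneg_left (m.nrm_component_le 2 β c)
      (by linarith : 0 ≤ 8 + 3 * (‖bracketL (𝔤 := 𝔤)‖ * C))
    linarith
  have := sum_component_le this
  rw [diracBound]
  linarith

end SecondOrder

/-! ### Translations, averages and mollification -/

section Mollifier

variable {𝔤 : Type*} [InvariantLieAlgebra 𝔤] [FiniteDimensional ℝ 𝔤] (m : Configuration 𝔤)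

/-- The partial derivative `∂ᵢ` on test functions. -/
def pd (i : Fin 3) : TestFun 𝔤 →ₗ[ℝ] TestFun 𝔤 where
  toFun s := ⟨fun x => fderiv ℝ s.1 x (e i),
    (s.2.1.fderiv_right (m := ∞) (by simp)).clm_apply contDiff_const,
    s.2.2.fderiv_apply (𝕜 := ℝ) (e i)⟩
  map_add' s t := by
    ext x
    simp only [Submodule.coe_add, Pi.add_apply,
      fderiv_add (testFun_differentiableAt s x) (testFun_differentiableAt t x), add_apply]
  map_smul' r s := by
    ext x
    simp only [Submodule.coe_smul, Pi.smul_apply,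
      fderiv_const_smul (testFun_differentiableAt s x), smul_apply, RingHom.id_apply]

theorem pd_apply (i : Fin 3) (s : TestFun 𝔤) (x : E3) :
    (pd i s).1 x = fderiv ℝ s.1 x (e i) := rfl

/-- Multiplication by a smooth field of endomorphisms. -/
def endMul (B : E3 → 𝔤 →L[ℝ] 𝔤) (hB : ContDiff ℝ ∞ B) : TestFun 𝔤 →ₗ[ℝ] TestFun 𝔤 where
  toFun s := ⟨fun x => B x (s.1 x), hB.clm_apply s.2.1, s.2.2.mono fun x hx => by
    simp only [Function.mem_support] at hx ⊢
    exact fun h => hx (by rw [h, map_zero])⟩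
  map_add' s t := by ext x; exact map_add _ _ _
  map_smul' r s := by ext x; exact map_smul _ _ _

theorem endMul_apply (B : E3 → 𝔤 →L[ℝ] 𝔤) (hB : ContDiff ℝ ∞ B) (s : TestFun 𝔤) (x : E3) :
    (endMul B hB s).1 x = B x (s.1 x) := rfl

/-- Translation of test functions. -/
def translate (t : E3) : TestFun 𝔤 →ₗ[ℝ] TestFun 𝔤 where
  toFun s := ⟨fun x => s.1 (x - t), s.2.1.comp (contDiff_id.sub contDiff_const),
    s.2.2.comp_homeomorph (Homeomorph.subRight t)⟩
  map_add' _ _ := rfl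
  map_smul' _ _ := rfl

theorem translate_apply (t : E3) (s : TestFun 𝔤) (x : E3) :
    (translate t s).1 x = s.1 (x - t) := rfl

theorem pd_translate (i : Fin 3) (t : E3) (s : TestFun 𝔤) :
    pd i (translate t s) = translate t (pd i s) := by
  ext x
  have h := fderiv_comp_sub (𝕜 := ℝ) (f := s.1) (x := x) t
  exact congrArg (fun L : E3 →L[ℝ] 𝔤 => L (e i)) h

theorem nrm_zero_translate (t : E3) (s : TestFun 𝔤) :
    m.nrm 0 (translate t s) = m.nrm 0 s := by
  refine (sq_eq_sq₀ (apply_nonneg _ _) (apply_nonneg _ _)).1 ?_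
  rw [m.nrm_zero_sq, m.nrm_zero_sq]
  exact integral_sub_right_eq_self (fun x => inner ℝ (s.1 x) (s.1 x)) t

/-- Minkowski's inequality for the `L²` norm of a weighted average of test functions. -/
theorem nrm_zero_average_le {T : Type*} [TopologicalSpace T] [R1Space T] [MeasurableSpace T]
    [OpensMeasurableSpace T] (μ : Measure T) [IsFiniteMeasureOnCompacts μ] {φ : T → ℝ}
    (hφ : Continuous φ) (hφc : HasCompactSupport φ) (hφ0 : ∀ t, 0 ≤ φ t) (g : T → TestFun 𝔤)
    (hg : Continuous fun p : E3 × T => (g p.2).1 p.1) {v : TestFun 𝔤}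
    (hv : ∀ x, v.1 x = ∫ t, φ t • (g t).1 x ∂μ) {K : ℝ}
    (hK : ∀ t, φ t ≠ 0 → m.nrm 0 (g t) ≤ K) : m.nrm 0 v ≤ K * ∫ t, φ t ∂μ := by
  have hint : ∀ x, Integrable (fun t => φ t • (g t).1 x) μ := fun x => by
    refine Continuous.integrable_of_hasCompactSupport ?_ (hφc.smul_right)
    exact hφ.smul (hg.comp (Continuous.prodMk_right x))
  have hφi : Integrable φ μ := hφ.integrable_of_hasCompactSupport hφc
  have hsq : m.nrm 0 v ^ 2 = ∫ t, φ t * l2 v (g t) ∂μ := by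
    rw [m.nrm_zero_sq]
    have h1 : l2 v v = ∫ x, ∫ t, φ t * inner ℝ (v.1 x) ((g t).1 x) ∂μ := by
      refine integral_congr_ae (.of_forall fun x => ?_)
      change inner ℝ (v.1 x) (v.1 x) = _
      nth_rewrite 2 [hv x]
      rw [← integral_inner (hint x)]
      simp only [real_inner_smul_right]
    rw [h1, integral_integral_swap_of_hasCompactSupport]
    · refine integral_congr_ae (.of_forall fun t => ?_)
      exact integral_const_mul _ _
    · exact (hφ.comp continuous_snd).mul ((v.2.1.continuous.comp continuous_fst).inner hg)
    · refine HasCompactSupport.of_support_subset_isCompact (v.2.2.prod hφc) fun p hp => ?_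
      simp only [Function.mem_support, Function.uncurry] at hp
      refine ⟨subset_tsupport _ fun h => hp ?_, subset_tsupport _ fun h => hp ?_⟩
      · rw [h, inner_zero_left, mul_zero]
      · rw [h, zero_mul]
  have hle : m.nrm 0 v ^ 2 ≤ m.nrm 0 v * (K * ∫ t, φ t ∂μ) := by
    rw [hsq, ← mul_assoc, mul_comm (_ * K), ← integral_mul_const]
    refine (Real.le_norm_self _).trans (norm_integral_le_of_norm_le (hφi.mul_const _)
      (.of_forall fun t => ?_))
    rw [Real.norm_eq_abs, abs_mul, abs_of_nonneg (hφ0 t)]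
    rcases eq_or_ne (φ t) 0 with h | h
    · simp [h]
    · refine mul_le_mul_of_nonneg_left ((abs_l2_le m v (g t)).trans ?_) (hφ0 t)
      exact mul_le_mul_of_nonneg_left (hK t h) (apply_nonneg _ _)
  rcases (apply_nonneg (m.nrm 0) v).eq_or_lt' with h | h
  · by_cases hz : ∃ t, φ t ≠ 0
    · obtain ⟨t, ht⟩ := hz
      rw [h]
      exact mul_nonneg ((apply_nonneg _ _).trans (hK t ht)) (integral_nonneg hφ0)
    · push Not at hz
      simp [h, hz]
  · exact le_of_mul_le_mul_left (by rwa [← sq]) h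

/-- Finite differences are controlled by first derivatives. -/
theorem nrm_zero_translate_sub_le (t : E3) (s : TestFun 𝔤) :
    m.nrm 0 (translate t s - s) ≤ ‖t‖ * ∑ i, m.nrm 0 (pd i s) := by
  let b : ContDiffBump (0 : ℝ) := ⟨1, 2, one_pos, one_lt_two⟩
  have hb : ∀ τ ∈ Ioc (0 : ℝ) 1, b τ = 1 := fun τ hτ =>
    b.one_of_mem_closedBall (by simpa [abs_of_pos hτ.1] using hτ.2)
  let w : TestFun 𝔤 := -∑ i, t i • pd i s
  have hw : ∀ x, w.1 x = -fderiv ℝ s.1 x t := fun x => by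
    have h1 : w.1 x = -∑ i, t i • fderiv ℝ s.1 x (e i) := by
      simp [w, pd_apply]
    rw [h1]
    conv_rhs => rw [eq_sum_smul_e t]
    simp
  have h := nrm_zero_average_le m (volume.restrict (Ioc (0 : ℝ) 1)) b.continuous
    b.hasCompactSupport (fun _ => b.nonneg) (fun τ => translate (τ • t) w)
    (v := translate t s - s) (K := ‖t‖ * ∑ i, m.nrm 0 (pd i s)) ?_ ?_ ?_
  · refine h.trans_eq ?_
    rw [setIntegral_congr_fun measurableSet_Ioc hb]
    simp
  · simp only [translate_apply]
    exact w.2.1.continuous.comp (by fun_prop)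
  · intro x
    have h2 : ∀ τ ∈ uIcc (0 : ℝ) 1,
        HasDerivAt (fun τ : ℝ => s.1 (x - τ • t)) (w.1 (x - τ • t)) τ := fun τ _ => by
      have h3 : HasDerivAt (fun τ : ℝ => x - τ • t) (-t) τ := by
        simpa using ((hasDerivAt_id τ).smul_const t).const_sub x
      have h4 := (testFun_differentiableAt s (x - τ • t)).hasFDerivAt.comp_hasDerivAt τ h3
      rw [hw, ← map_neg]
      exact h4
    have h5 := intervalIntegral.integral_eq_sub_of_hasDerivAt h2
      (Continuous.intervalIntegrable (w.2.1.continuous.comp (by fun_prop)) _ _)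
    rw [intervalIntegral.integral_of_le zero_le_one] at h5
    change s.1 (x - t) - s.1 x = _
    rw [setIntegral_congr_fun (g := fun τ => w.1 (x - τ • t)) measurableSet_Ioc, h5]
    · simp
    · intro τ hτ
      simp only [hb τ hτ, one_smul, translate_apply]
  · intro τ _
    rw [nrm_zero_translate]
    refine (map_neg_eq_map (m.nrm 0) _).trans_le ((Finset.le_sum_of_subadditive (m.nrm 0)
      (map_zero _).le (map_add_le_add _) _ _).trans ?_)
    rw [Finset.mul_sum]
    refine Finset.sum_le_sum fun i _ => ?_
    rw [map_smul_eq_mul]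
    exact mul_le_mul_of_nonneg_right (abs_apply_le_norm t i) (apply_nonneg _ _)

/-- Mollification: convolution with the normalised bump function `f`. -/
def mollify (f : ContDiffBump (0 : E3)) : TestFun 𝔤 →ₗ[ℝ] TestFun 𝔤 where
  toFun s := ⟨convolution (f.normed volume) s.1 (ContinuousLinearMap.lsmul ℝ ℝ) volume,
    s.2.2.contDiff_convolution_right _ f.continuous_normed.locallyIntegrable s.2.1,
    f.hasCompactSupport_normed.convolution _ s.2.2⟩
  map_add' s t := Subtype.ext <| ConvolutionExists.distrib_add
    (s.2.2.convolutionExists_right _ f.continuous_normed.locallyIntegrable s.2.1.continuous)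
    (t.2.2.convolutionExists_right _ f.continuous_normed.locallyIntegrable t.2.1.continuous)
  map_smul' _ _ := Subtype.ext convolution_smul

theorem mollify_apply (f : ContDiffBump (0 : E3)) (s : TestFun 𝔤) (x : E3) :
    (mollify f s).1 x = ∫ t, f.normed volume t • (translate t s).1 x := convolution_lsmul

theorem pd_mollify (f : ContDiffBump (0 : E3)) (i : Fin 3) (s : TestFun 𝔤) :
    pd i (mollify f s) = mollify f (pd i s) := by
  ext x
  have hf : LocallyIntegrable (f.normed volume) volume := f.continuous_normed.locallyIntegrable
  have h := (s.2.2.hasFDerivAt_convolution_right (ContinuousLinearMap.lsmul ℝ ℝ) hf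
    (s.2.1.of_le (by exact_mod_cast le_top)) x).fderiv
  refine (congrArg (fun L : E3 →L[ℝ] 𝔤 => L (e i)) h).trans ?_
  exact convolution_precompR_apply _ hf (s.2.2.fderiv (𝕜 := ℝ))
    (s.2.1.continuous_fderiv (by simp)) x (e i)

theorem normed_ne_zero {f : ContDiffBump (0 : E3)} {t : E3} (h : f.normed volume t ≠ 0) :
    ‖t‖ < f.rOut := by
  have h1 : t ∈ Function.support (f.normed volume) := h
  rw [f.support_normed_eq] at h1
  simpa using h1

/-- Mollification preserves control of the support. -/
theorem mollify_eq_zero {f : ContDiffBump (0 : E3)} {s : TestFun 𝔤} {r : ℝ}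
    (hs : ∀ x, r < ‖x‖ → s.1 x = 0) {x : E3} (hx : r + f.rOut < ‖x‖) :
    (mollify f s).1 x = 0 := by
  rw [mollify_apply]
  refine integral_eq_zero_of_ae (.of_forall fun t => ?_)
  rcases eq_or_ne (f.normed volume t) 0 with h | h
  · simp [h]
  · have h1 := normed_ne_zero h
    have h2 := norm_sub_norm_le x t
    simp [translate_apply, hs (x - t) (by linarith)]

/-- An `L²` bound for an average against the mollifier. -/
theorem nrm_zero_le_of_eq_mollified (f : ContDiffBump (0 : E3)) (g : E3 → TestFun 𝔤)
    (hg : Continuous fun p : E3 × E3 => (g p.2).1 p.1) {v : TestFun 𝔤}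
    (hv : ∀ x, v.1 x = ∫ t, f.normed volume t • (g t).1 x) {K : ℝ}
    (hK : ∀ t, ‖t‖ < f.rOut → m.nrm 0 (g t) ≤ K) : m.nrm 0 v ≤ K := by
  refine (nrm_zero_average_le m volume f.continuous_normed f.hasCompactSupport_normed
    f.nonneg_normed g hg hv fun t ht => hK t (normed_ne_zero ht)).trans_eq ?_
  rw [f.integral_normed, mul_one]

theorem continuous_translate (s : TestFun 𝔤) :
    Continuous fun p : E3 × E3 => (translate p.2 s).1 p.1 :=
  s.2.1.continuous.comp (continuous_fst.sub continuous_snd)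

theorem integrable_normed_smul_translate (f : ContDiffBump (0 : E3)) (s : TestFun 𝔤) (x : E3) :
    Integrable fun t => f.normed volume t • (translate t s).1 x :=
  (f.continuous_normed.smul ((continuous_translate s).comp
    (Continuous.prodMk_right x))).integrable_of_hasCompactSupport
    f.hasCompactSupport_normed.smul_right

theorem nrm_zero_mollify_le (f : ContDiffBump (0 : E3)) (s : TestFun 𝔤) :
    m.nrm 0 (mollify f s) ≤ m.nrm 0 s :=
  nrm_zero_le_of_eq_mollified m f (fun t => translate t s) (continuous_translate s)
    (mollify_apply f s) fun t _ => (nrm_zero_translate m t s).le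

theorem nrm_zero_mollify_sub_le (f : ContDiffBump (0 : E3)) (s : TestFun 𝔤) :
    m.nrm 0 (mollify f s - s) ≤ f.rOut * ∑ i, m.nrm 0 (pd i s) := by
  refine nrm_zero_le_of_eq_mollified m f (fun t => translate t s - s)
    ((continuous_translate s).sub (s.2.1.continuous.comp continuous_fst)) (fun x => ?_)
    fun t ht => (nrm_zero_translate_sub_le m t s).trans
      (mul_le_mul_of_nonneg_right ht.le (Finset.sum_nonneg fun i _ => apply_nonneg _ _))
  have h : ∀ t, f.normed volume t • (translate t s - s).1 x
      = f.normed volume t • (translate t s).1 x - f.normed volume t • s.1 x :=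
    fun t => smul_sub _ _ _
  simp only [h]
  rw [integral_sub (integrable_normed_smul_translate f s x) (f.integrable_normed.smul_const _),
    integral_smul_const, f.integral_normed, one_smul, ← mollify_apply]
  rfl

/-- Mollification almost commutes with multiplication operators, on functions supported in a
fixed ball. -/
theorem exists_commutator_mollify_le {B : E3 → 𝔤 →L[ℝ] 𝔤} (hB : ContDiff ℝ ∞ B) (r : ℝ) {κ : ℝ}
    (hκ : 0 < κ) : ∃ ε > 0, ∀ f : ContDiffBump (0 : E3), f.rOut ≤ ε → ∀ w : TestFun 𝔤,
      (∀ x, r < ‖x‖ → w.1 x = 0) →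
      m.nrm 0 (endMul B hB (mollify f w) - mollify f (endMul B hB w)) ≤ κ * m.nrm 0 w := by
  obtain ⟨ε, hε, h⟩ := Metric.uniformContinuousOn_iff.1
    ((isCompact_closedBall (0 : E3) (r + 1)).uniformContinuousOn_of_continuous
      hB.continuous.continuousOn) κ hκ
  refine ⟨min ε 1, lt_min hε one_pos, fun f hf w hw => ?_⟩
  refine nrm_zero_le_of_eq_mollified m f
    (fun t => endMul B hB (translate t w) - translate t (endMul B hB w)) ?_ (fun x => ?_)
    fun t ht => ?_
  · exact ((hB.continuous.comp continuous_fst).clm_apply (continuous_translate w)).sub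
      (continuous_translate (endMul B hB w))
  · have h1 : ∀ t, f.normed volume t •
        (endMul B hB (translate t w) - translate t (endMul B hB w)).1 x
        = B x (f.normed volume t • (translate t w).1 x)
          - f.normed volume t • (translate t (endMul B hB w)).1 x := fun t => by
      rw [map_smul]
      exact smul_sub _ _ _
    simp only [h1]
    rw [integral_sub ((B x).integrable_comp (integrable_normed_smul_translate f w x))
      (integrable_normed_smul_translate f _ x),
      (B x).integral_comp_comm (integrable_normed_smul_translate f w x), ← mollify_apply,
      ← mollify_apply]
    rfl
  · rw [← nrm_zero_translate m t w]
    refine nrm_zero_le_of_pointwise' m hκ.le fun x => ?_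
    change ‖B x (w.1 (x - t)) - B (x - t) (w.1 (x - t))‖ ≤ κ * ‖w.1 (x - t)‖
    by_cases hx : r < ‖x - t‖
    · simp [hw _ hx]
    · push Not at hx
      have ht1 : ‖t‖ < 1 := ht.trans_le (hf.trans (min_le_right _ _))
      have ht2 : ‖t‖ < ε := ht.trans_le (hf.trans (min_le_left _ _))
      have hx' := norm_sub_norm_le x t
      rw [← sub_apply]
      refine (ContinuousLinearMap.le_opNorm _ _).trans
        (mul_le_mul_of_nonneg_right ?_ (norm_nonneg _))
      rw [← dist_eq_norm]
      refine (h x ?_ (x - t) ?_ ?_).le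
      · simp only [mem_closedBall_zero_iff]; linarith
      · simp only [mem_closedBall_zero_iff]; linarith
      · rwa [dist_self_sub_right]

/-- The test function `y ↦ φ (x - y) X`, where `φ` is the mollifier; pairing with it evaluates
the mollification at `x`. -/
def kernelAt (f : ContDiffBump (0 : E3)) (x : E3) (X : 𝔤) : TestFun 𝔤 :=
  ⟨fun y => f.normed volume (x - y) • X,
    (f.contDiff_normed.comp (contDiff_const.sub contDiff_id)).smul contDiff_const,
    (f.hasCompactSupport_normed.comp_homeomorph (Homeomorph.subLeft x)).smul_right⟩

theorem kernelAt_eq_translate (f : ContDiffBump (0 : E3)) (x y : E3) (X : 𝔤) :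
    kernelAt f x X = translate (x - y) (kernelAt f y X) := by
  ext z
  change f.normed volume (x - z) • X = f.normed volume (y - (z - (x - y))) • X
  congr 2
  abel

theorem inner_mollify (f : ContDiffBump (0 : E3)) (s : TestFun 𝔤) (x : E3) (X : 𝔤) :
    inner ℝ ((mollify f s).1 x) X = l2 s (kernelAt f x X) := by
  rw [real_inner_comm, mollify_apply, ← integral_inner (integrable_normed_smul_translate f s x)]
  rw [← integral_sub_left_eq_self _ volume x]
  refine integral_congr_ae (.of_forall fun y => ?_)
  change inner ℝ X (f.normed volume (x - y) • s.1 (x - (x - y)))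
    = inner ℝ (s.1 y) (f.normed volume (x - y) • X)
  rw [sub_sub_cancel, real_inner_smul_right, real_inner_smul_right, real_inner_comm]

end Mollifier

/-! ### Localisation and Rellich compactness -/

section Rellich

variable {𝔤 : Type*} [InvariantLieAlgebra 𝔤] [FiniteDimensional ℝ 𝔤] (m : Configuration 𝔤)

theorem contDiff_bracketL {s : E3 → 𝔤} (hs : ContDiff ℝ ∞ s) :
    ContDiff ℝ ∞ fun x => bracketL (s x) := (bracketL (𝔤 := 𝔤)).contDiff.comp hs

theorem nabla_eq_pd_add (i : Fin 3) (s : TestFun 𝔤) :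
    m.nabla i s = pd i s + endMul _ (contDiff_bracketL (m.smooth_A i)) s := rfl

theorem exists_nrm_zero_endMul_le {B : E3 → 𝔤 →L[ℝ] 𝔤} (hB : ContDiff ℝ ∞ B) (r : ℝ) :
    ∃ C, 0 ≤ C ∧ ∀ w : TestFun 𝔤, (∀ x, r < ‖x‖ → w.1 x = 0) →
      m.nrm 0 (endMul B hB w) ≤ C * m.nrm 0 w := by
  obtain ⟨C, hC⟩ := (isCompact_closedBall (0 : E3) r).exists_bound_of_continuousOn
    hB.continuous.continuousOn
  refine ⟨|C|, abs_nonneg C, fun w hw => nrm_zero_le_of_pointwise' m (abs_nonneg C) fun x => ?_⟩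
  rw [endMul_apply]
  by_cases hx : r < ‖x‖
  · simp [hw x hx]
  · refine ((B x).le_opNorm _).trans (mul_le_mul_of_nonneg_right ?_ (norm_nonneg _))
    exact (hC x (by simpa using hx)).trans (le_abs_self C)

/-- The first order Sobolev norm with respect to the product connection. -/
def Configuration.flatNrm (s : TestFun 𝔤) : ℝ := ∑ i, m.nrm 0 (pd i s) + m.nrm 0 s

theorem sum_pd_le_flatNrm (s : TestFun 𝔤) : ∑ i, m.nrm 0 (pd i s) ≤ m.flatNrm s :=
  le_add_of_nonneg_right (apply_nonneg _ _)

theorem nrm_zero_le_flatNrm (s : TestFun 𝔤) : m.nrm 0 s ≤ m.flatNrm s :=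
  le_add_of_nonneg_left (Finset.sum_nonneg fun _ _ => apply_nonneg _ _)

theorem flatNrm_nonneg (s : TestFun 𝔤) : 0 ≤ m.flatNrm s :=
  (apply_nonneg _ _).trans (nrm_zero_le_flatNrm m s)

/-- On a bounded region the norm of `H₁` is dominated by the flat Sobolev norm. -/
theorem exists_nrm_one_le_flatNrm (r : ℝ) : ∃ C, 0 ≤ C ∧ ∀ w : TestFun 𝔤,
    (∀ x, r < ‖x‖ → w.1 x = 0) → m.nrm 1 w ≤ C * m.flatNrm w := by
  choose CA hCA hA using fun i =>
    exists_nrm_zero_endMul_le m (contDiff_bracketL (m.smooth_A i)) r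
  obtain ⟨CΦ, hCΦ, hΦ⟩ := exists_nrm_zero_endMul_le m (contDiff_bracketL m.smooth_Φ) r
  have hsum : 0 ≤ ∑ i, CA i := Finset.sum_nonneg fun i _ => hCA i
  refine ⟨1 + ∑ i, CA i + 1 + CΦ, by positivity, fun w hw => (nrm_one_le_sum m w).trans ?_⟩
  have h0 := nrm_zero_le_flatNrm m w
  have h1 : ∑ i, m.nrm 0 (m.nabla i w) ≤ m.flatNrm w + (∑ i, CA i) * m.flatNrm w := by
    refine (Finset.sum_le_sum fun i _ => (map_add_le_add (m.nrm 0) (pd i w) _).trans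
      (add_le_add le_rfl (hA i w hw))).trans ?_
    rw [Finset.sum_add_distrib, ← Finset.sum_mul]
    exact add_le_add (sum_pd_le_flatNrm m w) (mul_le_mul_of_nonneg_left h0 hsum)
  have h2 : m.nrm 0 (wt 1 w) ≤ m.flatNrm w := by
    refine (nrm_wt_le m (Nat.zero_le 1) w).trans ?_
    rwa [wt_zero]
  have h3 : m.nrm 0 (m.adΦ w) ≤ CΦ * m.flatNrm w :=
    (hΦ w hw).trans (mul_le_mul_of_nonneg_left h0 hCΦ)
  linarith

/-- On a bounded region, where the weight `ρ⁻¹` is bounded below, the flat Sobolev norm is dominated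
by the norm of `H₁`. -/
theorem exists_flatNrm_le_nrm_one (r : ℝ) : ∃ C, 0 ≤ C ∧ ∀ w : TestFun 𝔤,
    (∀ x, r < ‖x‖ → w.1 x = 0) → m.flatNrm w ≤ C * m.nrm 1 w := by
  choose CA hCA hA using fun i =>
    exists_nrm_zero_endMul_le m (contDiff_bracketL (m.smooth_A i)) r
  have hsum : 0 ≤ ∑ i, CA i := Finset.sum_nonneg fun i _ => hCA i
  refine ⟨3 + (∑ i, CA i + 1) * (1 + |r|), by positivity, fun w hw => ?_⟩
  have h0 : m.nrm 0 w ≤ (1 + |r|) * m.nrm 1 w := by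
    refine (nrm_zero_le_of_pointwise' m (t := wt 1 w) (by positivity) fun x => ?_).trans
      (mul_le_mul_of_nonneg_left (nrm_wt_one_le_nrm_one m w) (by positivity))
    by_cases hx : r < ‖x‖
    · simp [hw x hx, wt_apply]
    · have h1 := rho_le_of_norm_le (abs_nonneg r) ((not_lt.1 hx).trans (le_abs_self r))
      rw [wt_apply, norm_smul, pow_one, Real.norm_of_nonneg (inv_nonneg.2 (rho_pos x).le),
        ← mul_assoc]
      refine le_mul_of_one_le_left (norm_nonneg _) ?_
      rw [← div_eq_mul_inv, one_le_div (rho_pos x)]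
      exact h1
  have h1 : ∑ i, m.nrm 0 (pd i w) ≤ 3 * m.nrm 1 w + (∑ i, CA i) * m.nrm 0 w := by
    have h2 : ∀ i, m.nrm 0 (pd i w) ≤ m.nrm 1 w + CA i * m.nrm 0 w := fun i => by
      have h3 : pd i w = m.nabla i w - endMul _ (contDiff_bracketL (m.smooth_A i)) w := by
        rw [nabla_eq_pd_add, add_sub_cancel_right]
      rw [h3]
      exact (map_sub_le_add _ _ _).trans (add_le_add (nrm_nabla_le_nrm_one m i w) (hA i w hw))
    refine (Finset.sum_le_sum fun i _ => h2 i).trans ?_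
    rw [Finset.sum_add_distrib, ← Finset.sum_mul]
    simp
  have h4 := mul_le_mul_of_nonneg_left h0 (add_nonneg hsum zero_le_one)
  rw [Configuration.flatNrm]
  linarith

theorem contDiff_fderiv_e {f : E3 → ℝ} (hf : ContDiff ℝ ∞ f) (i : Fin 3) :
    ContDiff ℝ ∞ fun x => fderiv ℝ f x (e i) :=
  (hf.fderiv_right (m := ∞) (by simp)).clm_apply contDiff_const

theorem nabla_mulFun' (i : Fin 3) {f : E3 → ℝ} (hf : ContDiff ℝ ∞ f) (s : TestFun 𝔤) :
    m.nabla i (mulFun f hf s) = mulFun f hf (m.nabla i s) + mulFun _ (contDiff_fderiv_e hf i) s :=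
  Subtype.ext <| funext fun x => nabla_mulFun m i hf s x

theorem adΦ_mulFun {f : E3 → ℝ} (hf : ContDiff ℝ ∞ f) (s : TestFun 𝔤) :
    m.adΦ (mulFun f hf s) = mulFun f hf (m.adΦ s) :=
  Subtype.ext <| funext fun _ => lie_smul _ _ _

theorem wt_mulFun (n : ℕ) {f : E3 → ℝ} (hf : ContDiff ℝ ∞ f) (s : TestFun 𝔤) :
    wt n (mulFun f hf s) = mulFun f hf (wt n s) :=
  Subtype.ext <| funext fun _ => smul_comm _ _ _

theorem nrm_zero_mulFun_le {f : E3 → ℝ} (hf : ContDiff ℝ ∞ f) {C : ℝ} (hC : 0 ≤ C) (n : ℕ)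
    (h : ∀ x, |f x| ≤ C * (rho x ^ n)⁻¹) (s : TestFun 𝔤) :
    m.nrm 0 (mulFun f hf s) ≤ C * m.nrm 0 (wt n s) := by
  refine nrm_zero_le_of_pointwise' m hC fun x => ?_
  rw [mulFun_apply, wt_apply, norm_smul, norm_smul, ← mul_assoc,
    Real.norm_of_nonneg (inv_nonneg.2 (pow_pos (rho_pos x) n).le)]
  exact mul_le_mul_of_nonneg_right (h x) (norm_nonneg _)

theorem exists_abs_le_mul_rho_inv {f : E3 → ℝ} (hf : Continuous f) (hc : HasCompactSupport f)
    (n : ℕ) : ∃ C, 0 ≤ C ∧ ∀ x, |f x| ≤ C * (rho x ^ n)⁻¹ := by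
  obtain ⟨C, hC⟩ := (hc.mul_left (f := fun x => rho x ^ n)).exists_bound_of_continuous
    ((contDiff_rho.continuous.pow n).mul hf)
  refine ⟨C, (norm_nonneg _).trans (hC 0), fun x => ?_⟩
  have h := hC x
  have hr := pow_pos (rho_pos x) n
  rw [Pi.mul_apply, norm_mul, Real.norm_of_nonneg hr.le, Real.norm_eq_abs] at h
  rwa [← div_eq_mul_inv, le_div_iff₀ hr, mul_comm]

theorem exists_nrm_one_mulFun_le {f : E3 → ℝ} (hf : ContDiff ℝ ∞ f) (hc : HasCompactSupport f) :
    ∃ C, 0 ≤ C ∧ ∀ s : TestFun 𝔤, m.nrm 1 (mulFun f hf s) ≤ C * m.nrm 1 s := by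
  obtain ⟨C, hC, h⟩ := exists_abs_le_mul_rho_inv hf.continuous hc 0
  choose K hK hd using fun i => exists_abs_le_mul_rho_inv (contDiff_fderiv_e hf i).continuous
    (hc.fderiv_apply (𝕜 := ℝ) (e i)) 1
  have hsum : 0 ≤ ∑ i, K i := Finset.sum_nonneg fun i _ => hK i
  refine ⟨5 * C + ∑ i, K i, by positivity, fun s => (nrm_one_le_sum m _).trans ?_⟩
  have h0 : ∀ t : TestFun 𝔤, m.nrm 0 (mulFun f hf t) ≤ C * m.nrm 0 t := fun t => by
    simpa only [wt_zero] using nrm_zero_mulFun_le m hf hC 0 h t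
  have h1 : ∀ i, m.nrm 0 (m.nabla i (mulFun f hf s)) ≤ C * m.nrm 1 s + K i * m.nrm 1 s :=
    fun i => by
    rw [nabla_mulFun']
    refine (map_add_le_add _ _ _).trans (add_le_add ((h0 _).trans ?_)
      ((nrm_zero_mulFun_le m _ (hK i) 1 (hd i) s).trans ?_))
    · exact mul_le_mul_of_nonneg_left (nrm_nabla_le_nrm_one m i s) hC
    · exact mul_le_mul_of_nonneg_left (nrm_wt_one_le_nrm_one m s) (hK i)
  have h2 : m.nrm 0 (wt 1 (mulFun f hf s)) ≤ C * m.nrm 1 s := by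
    rw [wt_mulFun]
    exact (h0 _).trans (mul_le_mul_of_nonneg_left (nrm_wt_one_le_nrm_one m s) hC)
  have h3 : m.nrm 0 (m.adΦ (mulFun f hf s)) ≤ C * m.nrm 1 s := by
    rw [adΦ_mulFun]
    exact (h0 _).trans (mul_le_mul_of_nonneg_left (nrm_adΦ_le_nrm_one m s) hC)
  have h4 := Finset.sum_le_sum fun i (_ : i ∈ Finset.univ) => h1 i
  rw [Finset.sum_add_distrib] at h4
  have h5 := Finset.sum_mul Finset.univ K (m.nrm 1 s)
  simp only [Finset.sum_const, Finset.card_univ, Fintype.card_fin, nsmul_eq_mul] at h4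
  push_cast at h4
  linarith

theorem nrm_zero_le_of_bounded {r : ℝ} {w : TestFun 𝔤} (hw : ∀ x, r < ‖x‖ → w.1 x = 0) {M : ℝ}
    (hM : 0 ≤ M) (h : ∀ x, ‖w.1 x‖ ≤ M) :
    m.nrm 0 w ≤ √(volume.real (Metric.closedBall (0 : E3) r)) * M := by
  refine le_of_sq_le_sq ?_ (by positivity)
  rw [m.nrm_zero_sq, mul_pow, Real.sq_sqrt measureReal_nonneg]
  have h1 : l2 w w = ∫ x in Metric.closedBall (0 : E3) r, inner ℝ (w.1 x) (w.1 x) := by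
    refine (setIntegral_eq_integral_of_forall_compl_eq_zero fun x hx => ?_).symm
    rw [hw x (by simpa using hx), inner_zero_left]
  rw [h1, mul_comm]
  refine (Real.le_norm_self _).trans (norm_setIntegral_le_of_norm_le_const
    measure_closedBall_lt_top fun x _ => ?_)
  rw [real_inner_self_eq_norm_sq, Real.norm_of_nonneg (sq_nonneg _)]
  exact pow_le_pow_left₀ (norm_nonneg _) (h x) 2

theorem norm_le_sum_abs_inner (Y : 𝔤) :
    ‖Y‖ ≤ ∑ b, |inner ℝ Y (stdOrthonormalBasis ℝ 𝔤 b)| := by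
  conv_lhs => rw [← (stdOrthonormalBasis ℝ 𝔤).sum_repr' Y]
  refine (norm_sum_le _ _).trans (Finset.sum_le_sum fun b _ => ?_)
  rw [norm_smul, (stdOrthonormalBasis ℝ 𝔤).norm_eq_one, mul_one, Real.norm_eq_abs,
    real_inner_comm]

/-- The standard bump function with inner radius `r / 2` and outer radius `r`. -/
def bump (r : ℝ) (hr : 0 < r) : ContDiffBump (0 : E3) := ⟨r / 2, r, half_pos hr, half_lt_self hr⟩

/-- The mollification of `w` at `x` is close to the one at a nearby point `y`. -/
theorem abs_l2_kernelAt_le (f : ContDiffBump (0 : E3)) (w : TestFun 𝔤) (x y : E3) (X : 𝔤) :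
    |l2 w (kernelAt f x X)| ≤ |l2 w (kernelAt f y X)|
      + m.nrm 0 w * (‖x - y‖ * ∑ i, m.nrm 0 (pd i (kernelAt f 0 X))) := by
  have h2 : l2 w (kernelAt f x X) = l2 w (kernelAt f y X)
      + l2 w (translate (x - y) (kernelAt f y X) - kernelAt f y X) := by
    rw [← l2_add_right, add_sub_cancel, ← kernelAt_eq_translate]
  have h3 : ∀ i, m.nrm 0 (pd i (kernelAt f y X)) = m.nrm 0 (pd i (kernelAt f 0 X)) := fun i => by
    rw [kernelAt_eq_translate f y 0, pd_translate, nrm_zero_translate]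
  have h4 := nrm_zero_translate_sub_le m (x - y) (kernelAt f y X)
  simp only [h3] at h4
  rw [h2]
  exact (abs_add_le _ _).trans (add_le_add le_rfl ((abs_l2_le m _ _).trans
    (mul_le_mul_of_nonneg_left h4 (apply_nonneg _ _))))

/-- After mollification at a fixed scale, the `L²` norm of functions supported in a fixed ball is
controlled by approximate evaluations at the points of a finite net. -/
theorem exists_nrm_zero_mollify_le (f : ContDiffBump (0 : E3)) (r : ℝ) {ε : ℝ} (hε : 0 < ε) :
    ∃ (ι : Type) (_ : Fintype ι) (t : ι → TestFun 𝔤), ∀ w : TestFun 𝔤,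
      (∀ x, r < ‖x‖ → w.1 x = 0) →
      m.nrm 0 (mollify f w) ≤ ε * m.nrm 0 w + ∑ i, |l2 w (t i)| := by
  obtain ⟨b, hb⟩ : ∃ b : Fin (Module.finrank ℝ 𝔤) → 𝔤, ∀ Y, ‖Y‖ ≤ ∑ j, |inner ℝ Y (b j)| :=
    ⟨stdOrthonormalBasis ℝ 𝔤, norm_le_sum_abs_inner⟩
  obtain ⟨V, hV, hVbound⟩ : ∃ V : ℝ, 0 ≤ V ∧ ∀ v : TestFun 𝔤,
      (∀ x, r + f.rOut < ‖x‖ → v.1 x = 0) → ∀ M, 0 ≤ M → (∀ x, ‖v.1 x‖ ≤ M) →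
        m.nrm 0 v ≤ V * M :=
    ⟨_, Real.sqrt_nonneg _, fun v hv M hM h => nrm_zero_le_of_bounded m hv hM h⟩
  obtain ⟨k, hk, hkdef⟩ : ∃ k : Fin (Module.finrank ℝ 𝔤) → ℝ, (∀ j, 0 ≤ k j) ∧
      ∀ j, ∑ i, m.nrm 0 (pd i (kernelAt f 0 (b j))) = k j :=
    ⟨_, fun j => Finset.sum_nonneg fun _ _ => apply_nonneg _ _, fun j => rfl⟩
  have hK : 0 ≤ ∑ j, k j := Finset.sum_nonneg fun j _ => hk j
  -- the mesh `η` of the net is chosen so that `V * (η * ∑ j, k j) ≤ ε`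
  obtain ⟨η, hη, hηK⟩ : ∃ η : ℝ, 0 < η ∧ V * (η * ∑ j, k j) ≤ ε := by
    refine ⟨ε / (V * (∑ j, k j) + 1), by positivity, ?_⟩
    have h1 : ε / (V * (∑ j, k j) + 1) * (V * (∑ j, k j) + 1) = ε :=
      div_mul_cancel₀ _ (by positivity)
    have h2 : 0 ≤ ε / (V * (∑ j, k j) + 1) := by positivity
    nlinarith
  obtain ⟨F, -, hFfin, hF⟩ := (isCompact_closedBall (0 : E3) (r + f.rOut)).finite_cover_balls hη
  have : Fintype F := hFfin.fintype
  refine ⟨F × Fin (Module.finrank ℝ 𝔤), inferInstance,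
    fun p => V • kernelAt f p.1 (b p.2), fun w hw => ?_⟩
  have hw0 : 0 ≤ m.nrm 0 w := apply_nonneg _ _
  have hS : 0 ≤ ∑ p : F × Fin (Module.finrank ℝ 𝔤), |l2 w (kernelAt f p.1 (b p.2))| :=
    Finset.sum_nonneg fun _ _ => abs_nonneg _
  have hJ0 : ∀ x, r + f.rOut < ‖x‖ → (mollify f w).1 x = 0 := fun x hx => mollify_eq_zero hw hx
  have hsup : ∀ x, ‖(mollify f w).1 x‖ ≤
      ∑ p : F × Fin (Module.finrank ℝ 𝔤), |l2 w (kernelAt f p.1 (b p.2))|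
        + m.nrm 0 w * (η * ∑ j, k j) := fun x => by
    by_cases hx : r + f.rOut < ‖x‖
    · rw [hJ0 x hx, norm_zero]
      positivity
    · obtain ⟨y, hy, hxy⟩ := mem_iUnion₂.1 (hF (show x ∈ Metric.closedBall (0 : E3) _ by
        simpa using hx))
      rw [Metric.mem_ball, dist_eq_norm] at hxy
      have h1 : ∀ j, |inner ℝ ((mollify f w).1 x) (b j)| ≤ |l2 w (kernelAt f y (b j))|
          + m.nrm 0 w * (η * k j) := fun j => by
        rw [inner_mollify]
        refine (abs_l2_kernelAt_le m f w x y (b j)).trans (add_le_add le_rfl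
          (mul_le_mul_of_nonneg_left ?_ hw0))
        rw [hkdef]
        exact mul_le_mul_of_nonneg_right hxy.le (hk j)
      refine (hb _).trans ((Finset.sum_le_sum fun j _ => h1 j).trans ?_)
      rw [Finset.sum_add_distrib, ← Finset.mul_sum, ← Finset.mul_sum, Fintype.sum_prod_type]
      have h2 : ∀ z : F, 0 ≤ ∑ j, |l2 w (kernelAt f z (b j))| := fun z =>
        Finset.sum_nonneg fun _ _ => abs_nonneg _
      exact add_le_add_left (Finset.single_le_sum (fun z _ => h2 z)
        (Finset.mem_univ (⟨y, hy⟩ : F))) _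
  refine (hVbound _ hJ0 _ (by positivity) hsup).trans ?_
  simp only [l2_smul_right, abs_mul, abs_of_nonneg hV, ← Finset.mul_sum]
  nlinarith [mul_le_mul_of_nonneg_right hηK hw0]

/-- Rellich's theorem on a ball: the inclusion of `W^{1,2}` in `L²` is controlled, up to a small
multiple of the norm, by finitely many functionals. -/
theorem exists_local_rellich (r : ℝ) {ε : ℝ} (hε : 0 < ε) :
    ∃ (ι : Type) (_ : Fintype ι) (t : ι → TestFun 𝔤), ∀ w : TestFun 𝔤,
      (∀ x, r < ‖x‖ → w.1 x = 0) → m.nrm 0 w ≤ ε * m.flatNrm w + ∑ i, |l2 w (t i)| := by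
  obtain ⟨ι, _, t, ht⟩ := exists_nrm_zero_mollify_le m (bump ε hε) r hε
  refine ⟨ι, inferInstance, t, fun w hw => ?_⟩
  have h2 : m.nrm 0 (mollify (bump ε hε) w - w) ≤ ε * ∑ i, m.nrm 0 (pd i w) :=
    nrm_zero_mollify_sub_le m (bump ε hε) w
  have h3 : m.nrm 0 w ≤ m.nrm 0 (mollify (bump ε hε) w) + m.nrm 0 (mollify (bump ε hε) w - w) := by
    have := map_sub_le_add (m.nrm 0) (mollify (bump ε hε) w) (mollify (bump ε hε) w - w)
    rwa [sub_sub_cancel] at this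
  have h4 := ht w hw
  rw [Configuration.flatNrm]
  linarith

/-- The cutoff function of radius `R`: it is `1` for `‖x‖ ≤ R` and `0` for `‖x‖ ≥ 2 R`. -/
def cutoff (R : ℝ) (x : E3) : ℝ := bump 2 two_pos (R⁻¹ • x)

theorem contDiff_cutoff (R : ℝ) : ContDiff ℝ ∞ (cutoff R) :=
  (bump 2 two_pos).contDiff.comp (contDiff_id.const_smul R⁻¹)

theorem cutoff_eq_one {R : ℝ} (hR : 0 < R) {x : E3} (hx : ‖x‖ ≤ R) : cutoff R x = 1 := by
  refine (bump 2 two_pos).one_of_mem_closedBall ?_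
  rw [mem_closedBall_zero_iff, norm_smul, norm_inv, Real.norm_of_nonneg hR.le,
    inv_mul_le_iff₀ hR]
  change ‖x‖ ≤ R * (2 / 2)
  simpa

theorem two_lt_norm_inv_smul {R : ℝ} (hR : 0 < R) {x : E3} (hx : 2 * R < ‖x‖) :
    2 < ‖R⁻¹ • x‖ := by
  rwa [norm_smul, norm_inv, Real.norm_of_nonneg hR.le, lt_inv_mul_iff₀ hR, mul_comm]

theorem bump_eq_zero {x : E3} (hx : 2 < ‖x‖) : bump 2 two_pos x = 0 :=
  (bump 2 two_pos).zero_of_le_dist (by rw [dist_zero_right]; exact hx.le)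

theorem cutoff_eq_zero {R : ℝ} (hR : 0 < R) {x : E3} (hx : 2 * R < ‖x‖) : cutoff R x = 0 :=
  bump_eq_zero (two_lt_norm_inv_smul hR hx)

theorem hasCompactSupport_cutoff {R : ℝ} (hR : 0 < R) : HasCompactSupport (cutoff R) :=
  HasCompactSupport.intro (isCompact_closedBall (0 : E3) (2 * R)) fun x hx =>
    cutoff_eq_zero hR (by simpa using hx)

theorem abs_one_sub_cutoff_le {R : ℝ} (x : E3) : |1 - cutoff R x| ≤ 1 := by
  have h0 : 0 ≤ cutoff R x := (bump 2 two_pos).nonneg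
  have h1 : cutoff R x ≤ 1 := (bump 2 two_pos).le_one
  rw [abs_le]
  constructor <;> linarith

/-- Rellich's theorem for the weighted inclusion of `H₁` in `L²`: the weight `ρ⁻²` gains a factor
`ρ⁻¹` over the one in the norm of `H₁`, so that only a bounded region matters. -/
theorem exists_rellich {ε : ℝ} (hε : 0 < ε) :
    ∃ (ι : Type) (_ : Fintype ι) (t : ι → TestFun 𝔤), ∀ s : TestFun 𝔤,
      m.nrm 0 (wt 2 s) ≤ ε * m.nrm 1 s + ∑ i, |l2 s (t i)| := by
  let R : ℝ := 2 / ε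
  have hR : 0 < R := by positivity
  have hχ := contDiff_cutoff R
  obtain ⟨C, hC, h1⟩ := exists_nrm_one_mulFun_le m hχ (hasCompactSupport_cutoff hR)
  obtain ⟨K, hK, h2⟩ := exists_flatNrm_le_nrm_one m (2 * R)
  obtain ⟨ι, _, t, ht⟩ := exists_local_rellich m (2 * R)
    (show 0 < ε / 2 / (K * C + 1) by positivity)
  refine ⟨ι, inferInstance, fun i => mulFun _ hχ (t i), fun s => ?_⟩
  let w := mulFun _ hχ s
  have hw : ∀ x, 2 * R < ‖x‖ → w.1 x = 0 := fun x hx => by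
    change cutoff R x • s.1 x = 0
    rw [cutoff_eq_zero hR hx, zero_smul]
  have hs : 0 ≤ m.nrm 1 s := apply_nonneg _ _
  have h3 : m.nrm 0 (wt 2 s) ≤ m.nrm 0 w + m.nrm 0 (wt 2 (s - w)) := by
    have h4 : wt 2 s = wt 2 w + wt 2 (s - w) := by rw [← map_add, add_sub_cancel]
    have h5 := nrm_wt_le m (Nat.zero_le 2) w
    rw [wt_zero] at h5
    rw [h4]
    exact (map_add_le_add _ _ _).trans (add_le_add h5 le_rfl)
  have h4 : m.nrm 0 (wt 2 (s - w)) ≤ ε / 2 * m.nrm 1 s := by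
    refine (nrm_zero_le_of_pointwise' m (t := wt 1 s) (by positivity) fun x => ?_).trans
      (mul_le_mul_of_nonneg_left (nrm_wt_one_le_nrm_one m s) (by positivity))
    have h5 : (wt 2 (s - w)).1 x = ((rho x)⁻¹ * (1 - cutoff R x)) • (wt 1 s).1 x := by
      change (rho x ^ 2)⁻¹ • (s.1 x - cutoff R x • s.1 x) = _ • ((rho x ^ 1)⁻¹ • s.1 x)
      rw [smul_smul, show s.1 x - cutoff R x • s.1 x = (1 - cutoff R x) • s.1 x by
        rw [sub_smul, one_smul], smul_smul]
      congr 1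
      rw [pow_one, pow_two, mul_inv]
      ring
    rw [h5, norm_smul, norm_mul, Real.norm_eq_abs (1 - _), norm_inv,
      Real.norm_of_nonneg (rho_pos x).le]
    refine mul_le_mul_of_nonneg_right ?_ (norm_nonneg _)
    by_cases hx : ‖x‖ ≤ R
    · rw [cutoff_eq_one hR hx, sub_self, abs_zero, mul_zero]
      positivity
    · refine (mul_le_of_le_one_right (inv_nonneg.2 (rho_pos x).le)
        (abs_one_sub_cutoff_le x)).trans ?_
      rw [show ε / 2 = R⁻¹ by simp [R]]
      exact inv_anti₀ hR ((not_le.1 hx).le.trans (norm_le_rho x))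
  have h5 : ∀ i, l2 s (mulFun _ hχ (t i)) = l2 w (t i) := fun i =>
    integral_congr_ae (.of_forall fun x => by
      change inner ℝ (s.1 x) (cutoff R x • (t i).1 x) = inner ℝ (cutoff R x • s.1 x) ((t i).1 x)
      rw [real_inner_smul_left, real_inner_smul_right])
  have h6 := ht w hw
  simp only [h5]
  have h7 : ε / 2 / (K * C + 1) * m.flatNrm w ≤ ε / 2 * m.nrm 1 s := by
    rw [div_mul_eq_mul_div, div_le_iff₀ (by positivity), mul_assoc]
    refine mul_le_mul_of_nonneg_left ?_ (by positivity)
    have h8 := (h2 w hw).trans (mul_le_mul_of_nonneg_left (h1 s) hK)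
    nlinarith
  linarith

theorem l2_eq_l2_wt_rho (s t : TestFun 𝔤) :
    l2 s t = l2 (wt 1 s) (mulFun rho contDiff_rho t) :=
  integral_congr_ae (.of_forall fun x => by
    change inner ℝ (s.1 x) (t.1 x) = inner ℝ ((rho x ^ 1)⁻¹ • s.1 x) (rho x • t.1 x)
    rw [real_inner_smul_left, real_inner_smul_right, pow_one,
      inv_mul_cancel_left₀ (rho_pos x).ne'])

/-- Pairing with a test function is continuous on `H₁`. -/
theorem abs_l2_le_nrm_one (s t : TestFun 𝔤) :
    |l2 s t| ≤ m.nrm 0 (mulFun rho contDiff_rho t) * m.nrm 1 s := by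
  rw [l2_eq_l2_wt_rho, mul_comm]
  exact (abs_l2_le m _ _).trans
    (mul_le_mul_of_nonneg_right (nrm_wt_one_le_nrm_one m s) (apply_nonneg _ _))

/-- Multiplication by `ρ⁻²` is compact from `H₁` to `L²`. -/
theorem finiteRankControlled_wt_two (α : Option (Fin 3)) :
    FiniteRankControlled fun c : PreH m 1 => m.nrm 0 (wt 2 (component α c)) := fun ε hε => by
  obtain ⟨ι, _, t, ht⟩ := exists_rellich m hε
  let l : ι → PreH m 1 →ₗ[ℝ] ℝ := fun i =>
    (l2B.flip (t i)).comp (component α : TestSection 𝔤 →ₗ[ℝ] TestFun 𝔤)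
  have hl : ∀ i c, ‖l i c‖ ≤ m.nrm 0 (mulFun rho contDiff_rho (t i)) * ‖c‖ := fun i c =>
    (abs_l2_le_nrm_one m (component α c) (t i)).trans
      (mul_le_mul_of_nonneg_left (m.nrm_component_le 1 α c) (apply_nonneg _ _))
  refine ⟨ι, inferInstance, fun i => (l i).mkContinuous _ (hl i), fun c => (ht _).trans ?_⟩
  exact add_le_add (mul_le_mul_of_nonneg_left (m.nrm_component_le 1 α c) hε.le) le_rfl

theorem secNrm_lift_le {j k : Fin 3} {T : TestFun 𝔤 →ₗ[ℝ] TestFun 𝔤} {C : ℝ} (hC : 0 ≤ C)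
    (h : ∀ s, m.nrm k (T s) ≤ C * m.nrm j s) (c : TestSection 𝔤) :
    m.secNrm k (lift T c) ≤ C * m.secNrm j c := by
  refine le_of_sq_le_sq ?_ (mul_nonneg hC (apply_nonneg _ _))
  rw [mul_pow, m.secNrm_sq, m.secNrm_sq, Finset.mul_sum]
  refine Finset.sum_le_sum fun α _ => ?_
  rw [component_lift, ← mul_pow]
  exact pow_le_pow_left₀ (apply_nonneg _ _) (h _) 2

theorem finiteRankControlled_wt_two_lift {T : TestFun 𝔤 →ₗ[ℝ] TestFun 𝔤} {C : ℝ} (hC : 0 ≤ C)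
    (h : ∀ s, m.nrm 1 (T s) ≤ C * m.nrm 2 s) (α : Option (Fin 3)) :
    FiniteRankControlled fun c : PreH m 2 => m.nrm 0 (wt 2 (T (component α c))) := by
  refine ((finiteRankControlled_wt_two m α).comp (Y := PreH m 1) (X := PreH m 2)
    (lift T : TestSection 𝔤 →ₗ[ℝ] TestSection 𝔤) (fun c => secNrm_lift_le m hC h c)).mono
    fun c => ?_
  exact (congrArg (fun s => m.nrm 0 (wt 2 s)) (component_lift T α c)).ge

/-- Every term of the remainder is `ρ⁻² T c` with `T = ∇ᵢ`, `[Φ, ·]` or `ρ⁻¹`, which are bounded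
from `H₂` to `H₁`. -/
theorem finiteRankControlled_remainder {C : ℝ} {m : Configuration 𝔤} (h : m.HasDecay C) :
    FiniteRankControlled fun c : PreH m 2 => m.remainder c := by
  have hC := h.nonneg
  refine FiniteRankControlled.sum _ fun α _ => ((FiniteRankControlled.sum _ fun i _ =>
    finiteRankControlled_wt_two_lift m zero_le_one (T := m.nabla i) (fun s => ?_) α).add
    (finiteRankControlled_wt_two_lift m (by positivity) (nrm_one_adΦ_le h) α)).add ?_
  · rw [one_mul]
    exact nrm_one_nabla_le m i s
  · have := finiteRankControlled_wt_two_lift m (by norm_num) (nrm_one_wt_one_le m) α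
    simpa only [wt_wt] using this

end Rellich

/-! ### Density of the range of the Laplacian -/

section Density

variable {𝔤 : Type*} [InvariantLieAlgebra 𝔤] [FiniteDimensional ℝ 𝔤] (m : Configuration 𝔤)

theorem l2_lap_comm (s t : TestFun 𝔤) : l2 (m.lap s) t = l2 (m.lap t) s := by
  rw [l2_lap, l2_lap, l2_symm (m.adΦ s)]
  simp only [l2_symm (m.nabla _ s)]

theorem l2_lap_self_le (s : TestFun 𝔤) : l2 (m.lap s) s ≤ m.nrm 1 s ^ 2 := by
  rw [l2_lap_self, nrm_one_sq]
  nlinarith [sq_nonneg (m.nrm 0 (wt 1 s))]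

theorem nrm_one_sq_le_l2_lap (s : TestFun 𝔤) : m.nrm 1 s ^ 2 ≤ 13 * l2 (m.lap s) s := by
  rw [l2_lap_self]
  exact nrm_one_sq_le m s

/-- Dirichlet's principle: an almost minimiser of `½ ⟨Δ u, u⟩ - ⟨f, u⟩` solves `Δ u = f` up to a
small error in the dual of `H₁`. -/
theorem exists_approx_weak_solution (f : TestFun 𝔤) :
    ∃ K, 0 ≤ K ∧ ∀ δ > 0, ∃ u : TestFun 𝔤, m.nrm 1 u ≤ K ∧
      ∀ s, |l2 (m.lap u - f) s| ≤ δ * m.nrm 1 s := by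
  obtain ⟨k, hk, hf⟩ : ∃ k, 0 ≤ k ∧ ∀ s, |l2 f s| ≤ k * m.nrm 1 s :=
    ⟨_, apply_nonneg _ _, fun s => by rw [l2_symm]; exact abs_l2_le_nrm_one m s f⟩
  let F : TestFun 𝔤 → ℝ := fun u => 1 / 2 * l2 (m.lap u) u - l2 f u
  have hF : ∀ u, 1 / 26 * m.nrm 1 u ^ 2 - k * m.nrm 1 u ≤ F u := fun u => by
    have h1 := nrm_one_sq_le_l2_lap m u
    have h2 := (le_abs_self _).trans (hf u)
    simp only [F]
    linarith
  have hbdd : BddBelow (range F) := by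
    refine ⟨-7 * k ^ 2, ?_⟩
    rintro _ ⟨u, rfl⟩
    nlinarith [hF u, sq_nonneg (m.nrm 1 u - 13 * k)]
  refine ⟨26 * (1 + k), by positivity, fun δ hδ => ?_⟩
  have hη : 0 < min (δ ^ 2 / 2) 1 := by positivity
  obtain ⟨_, ⟨u, rfl⟩, hu⟩ := exists_lt_of_csInf_lt (range_nonempty F) (lt_add_of_pos_right _ hη)
  have hmin : ∀ v, F u ≤ F v + min (δ ^ 2 / 2) 1 := fun v => by
    have := csInf_le hbdd (mem_range_self v)
    linarith
  refine ⟨u, ?_, fun s => ?_⟩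
  · have h1 := hmin 0
    have h2 : F 0 = 0 := by simp [F, l2]
    have h3 := hF u
    have h4 := min_le_right (δ ^ 2 / 2) 1
    have h5 : 0 ≤ m.nrm 1 u := apply_nonneg _ _
    by_contra h
    push Not at h
    have h6 : 26 * (1 + k) * m.nrm 1 u < m.nrm 1 u * m.nrm 1 u :=
      mul_lt_mul_of_pos_right h (by nlinarith)
    nlinarith
  -- a quadratic polynomial in `τ` which is nonnegative has nonpositive discriminant
  · have hquad : ∀ τ : ℝ, 0 ≤ 1 / 2 * l2 (m.lap s) s * (τ * τ) + l2 (m.lap u - f) s * τ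
        + min (δ ^ 2 / 2) 1 := fun τ => by
      have h1 := hmin (u + τ • s)
      have h2 : F (u + τ • s) = F u + 1 / 2 * l2 (m.lap s) s * (τ * τ)
          + l2 (m.lap u - f) s * τ := by
        simp only [F, map_add, map_smul, l2_add, l2_smul, l2_add_right, l2_smul_right,
          l2_sub_left, l2_lap_comm m s u]
        ring
      linarith
    have h3 := discrim_le_zero hquad
    have h4 := l2_lap_self_le m s
    have h5 : min (δ ^ 2 / 2) 1 * l2 (m.lap s) s ≤ δ ^ 2 / 2 * m.nrm 1 s ^ 2 :=
      (mul_le_mul_of_nonneg_left h4 hη.le).trans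
        (mul_le_mul_of_nonneg_right (min_le_left _ _) (sq_nonneg _))
    rw [discrim] at h3
    refine abs_le_of_sq_le_sq ?_ (mul_nonneg hδ.le (apply_nonneg _ _))
    rw [mul_pow]
    linarith

/-- The operator `T` almost commutes with mollification at small scales, as an operator of first
order on functions supported in the ball of radius `r`. -/
def Configuration.AlmostCommutes (r : ℝ) (T : TestFun 𝔤 →ₗ[ℝ] TestFun 𝔤) : Prop :=
  ∀ κ > 0, ∃ ε > 0, ∀ f : ContDiffBump (0 : E3), f.rOut ≤ ε → ∀ w : TestFun 𝔤,
    (∀ x, r < ‖x‖ → w.1 x = 0) →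
    m.nrm 0 (T (mollify f w) - mollify f (T w)) ≤ κ * m.flatNrm w

section AlmostCommutes

variable {m} {r : ℝ}

theorem Configuration.AlmostCommutes.add {S T : TestFun 𝔤 →ₗ[ℝ] TestFun 𝔤}
    (hS : m.AlmostCommutes r S) (hT : m.AlmostCommutes r T) : m.AlmostCommutes r (S + T) :=
  fun κ hκ => by
  obtain ⟨ε, hε, h⟩ := hS (κ / 2) (half_pos hκ)
  obtain ⟨ε', hε', h'⟩ := hT (κ / 2) (half_pos hκ)
  refine ⟨min ε ε', lt_min hε hε', fun f hf w hw => ?_⟩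
  have h1 := h f (hf.trans (min_le_left _ _)) w hw
  have h2 := h' f (hf.trans (min_le_right _ _)) w hw
  have h3 : (S + T) (mollify f w) - mollify f ((S + T) w)
      = (S (mollify f w) - mollify f (S w)) + (T (mollify f w) - mollify f (T w)) := by
    simp only [LinearMap.add_apply, map_add]
    abel
  rw [h3]
  exact (map_add_le_add _ _ _).trans (by linarith)

theorem Configuration.AlmostCommutes.neg {T : TestFun 𝔤 →ₗ[ℝ] TestFun 𝔤}
    (hT : m.AlmostCommutes r T) : m.AlmostCommutes r (-T) := fun κ hκ => by
  obtain ⟨ε, hε, h⟩ := hT κ hκ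
  refine ⟨ε, hε, fun f hf w hw => ?_⟩
  have h3 : (-T) (mollify f w) - mollify f ((-T) w) = -(T (mollify f w) - mollify f (T w)) := by
    simp only [LinearMap.neg_apply, map_neg]
    abel
  rw [h3, map_neg_eq_map]
  exact h f hf w hw

theorem Configuration.AlmostCommutes.sum {ι : Type*} (u : Finset ι)
    {T : ι → TestFun 𝔤 →ₗ[ℝ] TestFun 𝔤} (hT : ∀ i ∈ u, m.AlmostCommutes r (T i)) :
    m.AlmostCommutes r (∑ i ∈ u, T i) := by
  refine Finset.sum_induction _ (m.AlmostCommutes r) (fun _ _ => .add) (fun κ hκ => ?_) hT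
  refine ⟨1, one_pos, fun f _ w _ => ?_⟩
  simpa using mul_nonneg hκ.le (flatNrm_nonneg m w)

theorem almostCommutes_endMul {B : E3 → 𝔤 →L[ℝ] 𝔤} (hB : ContDiff ℝ ∞ B) :
    m.AlmostCommutes r (endMul B hB) := fun κ hκ => by
  obtain ⟨ε, hε, h⟩ := exists_commutator_mollify_le m hB r hκ
  exact ⟨ε, hε, fun f hf w hw => (h f hf w hw).trans
    (mul_le_mul_of_nonneg_left (nrm_zero_le_flatNrm m w) hκ.le)⟩

theorem pd_eq_zero (i : Fin 3) {w : TestFun 𝔤} (hw : ∀ x, r < ‖x‖ → w.1 x = 0) (x : E3)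
    (hx : r < ‖x‖) : (pd i w).1 x = 0 := by
  have h : w.1 =ᶠ[nhds x] fun _ => 0 :=
    (continuous_norm.continuousAt.eventually (lt_mem_nhds hx)).mono fun y hy => hw y hy
  rw [pd_apply, h.fderiv_eq]
  simp

theorem almostCommutes_endMul_pd {B : E3 → 𝔤 →L[ℝ] 𝔤} (hB : ContDiff ℝ ∞ B) (i : Fin 3) :
    m.AlmostCommutes r (endMul B hB ∘ₗ pd i) := fun κ hκ => by
  obtain ⟨ε, hε, h⟩ := exists_commutator_mollify_le m hB r hκ
  refine ⟨ε, hε, fun f hf w hw => ?_⟩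
  rw [LinearMap.comp_apply, LinearMap.comp_apply, pd_mollify]
  refine (h f hf (pd i w) (pd_eq_zero i hw)).trans (mul_le_mul_of_nonneg_left ?_ hκ.le)
  exact (Finset.single_le_sum (f := fun i => m.nrm 0 (pd i w)) (fun _ _ => apply_nonneg _ _)
    (Finset.mem_univ i)).trans (sum_pd_le_flatNrm m w)

theorem almostCommutes_pd_pd (i : Fin 3) : m.AlmostCommutes r (pd i ∘ₗ pd i) := fun κ hκ => by
  refine ⟨1, one_pos, fun f _ w _ => ?_⟩
  rw [LinearMap.comp_apply, LinearMap.comp_apply, pd_mollify, pd_mollify, sub_self, map_zero]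
  exact mul_nonneg hκ.le (flatNrm_nonneg m w)

end AlmostCommutes

theorem contDiff_fderiv_endMul {B : E3 → 𝔤 →L[ℝ] 𝔤} (hB : ContDiff ℝ ∞ B) (i : Fin 3) :
    ContDiff ℝ ∞ fun x => fderiv ℝ B x (e i) :=
  (hB.fderiv_right (m := ∞) (by simp)).clm_apply contDiff_const

theorem pd_endMul {B : E3 → 𝔤 →L[ℝ] 𝔤} (hB : ContDiff ℝ ∞ B) (i : Fin 3) (s : TestFun 𝔤) :
    pd i (endMul B hB s) = endMul B hB (pd i s) + endMul _ (contDiff_fderiv_endMul hB i) s := by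
  ext x
  have h := fderiv_clm_apply (hB.differentiable (by simp) x) (testFun_differentiableAt s x)
  refine (congrArg (fun L : E3 →L[ℝ] 𝔤 => L (e i)) h).trans ?_
  simp only [add_apply, ContinuousLinearMap.comp_apply, ContinuousLinearMap.flip_apply]
  rfl

/-- Expansion of `∇ᵢ∇ᵢ` into multiplication operators and partial derivatives, with the derivatives
acting first. -/
theorem nabla_nabla_eq (i : Fin 3) : m.nabla i ∘ₗ m.nabla i
    = pd i ∘ₗ pd i + endMul _ (contDiff_bracketL (m.smooth_A i)) ∘ₗ pd i
      + endMul _ (contDiff_fderiv_endMul (contDiff_bracketL (m.smooth_A i)) i)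
      + endMul _ (contDiff_bracketL (m.smooth_A i)) ∘ₗ pd i
      + endMul _ ((contDiff_bracketL (m.smooth_A i)).clm_comp
        (contDiff_bracketL (m.smooth_A i))) := by
  refine LinearMap.ext fun s => ?_
  simp only [LinearMap.comp_apply, LinearMap.add_apply]
  rw [nabla_eq_pd_add, nabla_eq_pd_add, map_add, map_add, pd_endMul]
  simp only [← add_assoc]
  rfl

/-- Friedrichs' lemma for the Laplacian. -/
theorem almostCommutes_lap (r : ℝ) : m.AlmostCommutes r m.lap := by
  have h1 : m.lap = -(∑ i, m.nabla i ∘ₗ m.nabla i) + -endMul _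
      ((contDiff_bracketL m.smooth_Φ).clm_comp (contDiff_bracketL m.smooth_Φ)) :=
    LinearMap.ext fun s => sub_eq_add_neg _ _
  rw [h1]
  refine (Configuration.AlmostCommutes.sum _ fun i _ => ?_).neg.add (almostCommutes_endMul _).neg
  rw [nabla_nabla_eq]
  exact ((((almostCommutes_pd_pd i).add (almostCommutes_endMul_pd _ i)).add
    (almostCommutes_endMul _)).add (almostCommutes_endMul_pd _ i)).add (almostCommutes_endMul _)

theorem lap_mulFun {f : E3 → ℝ} (hf : ContDiff ℝ ∞ f) (s : TestFun 𝔤) :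
    m.lap (mulFun f hf s) - mulFun f hf (m.lap s)
      = -∑ i, ((2 : ℝ) • mulFun _ (contDiff_fderiv_e hf i) (m.nabla i s)
        + mulFun _ (contDiff_fderiv_e (contDiff_fderiv_e hf i) i) s) := by
  simp only [lap_apply, nabla_mulFun', adΦ_mulFun, map_sub, map_neg, map_sum, map_add,
    Finset.sum_add_distrib, two_smul]
  abel

theorem fderiv_cutoff (R : ℝ) (i : Fin 3) (x : E3) : fderiv ℝ (cutoff R) x (e i)
    = R⁻¹ * fderiv ℝ (bump 2 two_pos : E3 → ℝ) (R⁻¹ • x) (e i) := by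
  have h := fderiv_comp_smul (𝕜 := ℝ) (f := (bump 2 two_pos : E3 → ℝ)) (x := x) R⁻¹
  exact congrArg (fun L : E3 →L[ℝ] ℝ => L (e i)) h

theorem fderiv_fderiv_cutoff (R : ℝ) (i : Fin 3) (x : E3) :
    fderiv ℝ (fun y => fderiv ℝ (cutoff R) y (e i)) x (e i)
      = R⁻¹ * (R⁻¹ * fderiv ℝ (fun y => fderiv ℝ (bump 2 two_pos : E3 → ℝ) y (e i))
        (R⁻¹ • x) (e i)) := by
  have hsm := contDiff_fderiv_e (bump 2 two_pos).contDiff i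
  have h := fderiv_comp_smul (𝕜 := ℝ)
    (f := fun y => fderiv ℝ (bump 2 two_pos : E3 → ℝ) y (e i)) (x := x) R⁻¹
  simp only [fderiv_cutoff]
  have hd : DifferentiableAt ℝ
      (fun y : E3 => fderiv ℝ (bump 2 two_pos : E3 → ℝ) (R⁻¹ • y) (e i)) x :=
    (hsm.comp (contDiff_id.const_smul R⁻¹)).differentiable (by simp) x
  rw [fderiv_const_mul hd, h]
  simp

/-- The second derivatives of the cutoff are `O(R⁻²)` on a region where `ρ = O(R)`, so that one
factor `R⁻¹` can be exchanged for the weight `ρ⁻¹` of `H₁`. -/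
theorem exists_fderiv_cutoff_le : ∃ K, 0 ≤ K ∧ ∀ R, 1 ≤ R → ∀ i x,
    |fderiv ℝ (cutoff R) x (e i)| ≤ K / R ∧
    |fderiv ℝ (fun y => fderiv ℝ (cutoff R) y (e i)) x (e i)| ≤ K / R * (rho x ^ 1)⁻¹ := by
  have hb := (bump 2 two_pos).contDiff (n := ⊤)
  have hc := (bump 2 two_pos).hasCompactSupport
  choose K hK h using fun i => exists_abs_le_mul_rho_inv (contDiff_fderiv_e hb i).continuous
    (hc.fderiv_apply (𝕜 := ℝ) (e i)) 0
  choose L hL h' using fun i => exists_abs_le_mul_rho_inv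
    (contDiff_fderiv_e (contDiff_fderiv_e hb i) i).continuous
    ((hc.fderiv_apply (𝕜 := ℝ) (e i)).fderiv_apply (𝕜 := ℝ) (e i)) 1
  refine ⟨∑ i, K i + ∑ i, L i, add_nonneg (Finset.sum_nonneg fun i _ => hK i)
    (Finset.sum_nonneg fun i _ => hL i), fun R hR i x => ⟨?_, ?_⟩⟩
  · have hR0 : 0 < R := one_pos.trans_le hR
    rw [fderiv_cutoff, abs_mul, abs_of_pos (inv_pos.2 hR0), div_eq_inv_mul]
    refine mul_le_mul_of_nonneg_left ?_ (inv_pos.2 hR0).le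
    have h1 := h i (R⁻¹ • x)
    rw [pow_zero, inv_one, mul_one] at h1
    have h2 := Finset.single_le_sum (fun i _ => hK i) (Finset.mem_univ i)
    have h3 := Finset.sum_nonneg fun i (_ : i ∈ Finset.univ) => hL i
    linarith
  · have hR0 : 0 < R := one_pos.trans_le hR
    rw [fderiv_fderiv_cutoff, abs_mul, abs_of_pos (inv_pos.2 hR0), div_eq_inv_mul, mul_assoc]
    refine mul_le_mul_of_nonneg_left ?_ (inv_pos.2 hR0).le
    have h1 := h' i (R⁻¹ • x)
    have h2 := Finset.single_le_sum (fun i _ => hL i) (Finset.mem_univ i)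
    have h3 := Finset.sum_nonneg fun i (_ : i ∈ Finset.univ) => hK i
    -- `ρ (x) ≤ R ρ (x / R)` for `R ≥ 1` converts one factor `R⁻¹` into the weight
    have h4 : rho x ≤ R * rho (R⁻¹ • x) := by
      rw [rho, Real.sqrt_le_left (mul_nonneg hR0.le (rho_pos _).le), mul_pow, rho_sq, norm_smul,
        norm_inv, Real.norm_of_nonneg hR0.le, mul_pow, inv_pow, mul_add,
        mul_inv_cancel_left₀ (pow_pos hR0 2).ne']
      nlinarith
    rw [abs_mul, abs_of_pos (inv_pos.2 hR0)]
    have h5 : R⁻¹ * (rho (R⁻¹ • x) ^ 1)⁻¹ ≤ (rho x ^ 1)⁻¹ := by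
      rw [pow_one, pow_one, ← mul_inv]
      exact inv_anti₀ (rho_pos x) h4
    calc _ ≤ R⁻¹ * (L i * (rho (R⁻¹ • x) ^ 1)⁻¹) :=
          mul_le_mul_of_nonneg_left h1 (inv_pos.2 hR0).le
      _ = L i * (R⁻¹ * (rho (R⁻¹ • x) ^ 1)⁻¹) := by ring
      _ ≤ L i * (rho x ^ 1)⁻¹ := mul_le_mul_of_nonneg_left h5 (hL i)
      _ ≤ _ := mul_le_mul_of_nonneg_right (by linarith)
        (inv_nonneg.2 (pow_pos (rho_pos x) 1).le)

/-- Cutting off at radius `R` costs an error `O(1/R)` in `L²`. -/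
theorem exists_commutator_cutoff_le : ∃ K, 0 ≤ K ∧ ∀ R, 1 ≤ R → ∀ s : TestFun 𝔤,
    m.nrm 0 (m.lap (mulFun _ (contDiff_cutoff R) s) - mulFun _ (contDiff_cutoff R) (m.lap s))
      ≤ K / R * m.nrm 1 s := by
  obtain ⟨K, hK, h⟩ := exists_fderiv_cutoff_le
  refine ⟨9 * K, by positivity, fun R hR s => ?_⟩
  have hKR : 0 ≤ K / R := div_nonneg hK (zero_le_one.trans hR)
  rw [lap_mulFun, map_neg_eq_map]
  refine (Finset.le_sum_of_subadditive (m.nrm 0) (map_zero _).le (map_add_le_add _) _ _).trans ?_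
  have h1 : ∀ i, m.nrm 0 ((2 : ℝ) • mulFun _ (contDiff_fderiv_e (contDiff_cutoff R) i)
        (m.nabla i s)
      + mulFun _ (contDiff_fderiv_e (contDiff_fderiv_e (contDiff_cutoff R) i) i) s)
      ≤ 3 * (K / R * m.nrm 1 s) := fun i => by
    have h2 := nrm_zero_mulFun_le m (contDiff_fderiv_e (contDiff_cutoff R) i) hKR 0
      (fun x => by simpa using (h R hR i x).1) (m.nabla i s)
    rw [wt_zero] at h2
    have h3 := nrm_zero_mulFun_le m (contDiff_fderiv_e (contDiff_fderiv_e (contDiff_cutoff R) i) i)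
      hKR 1 (fun x => (h R hR i x).2) s
    refine (map_add_le_add _ _ _).trans ?_
    rw [map_smul_eq_mul, Real.norm_of_nonneg zero_le_two]
    have h4 := mul_le_mul_of_nonneg_left (nrm_nabla_le_nrm_one m i s) hKR
    have h5 := mul_le_mul_of_nonneg_left (nrm_wt_one_le_nrm_one m s) hKR
    linarith
  refine (Finset.sum_le_sum fun i _ => h1 i).trans_eq ?_
  simp
  ring

theorem kernelAt_eq_zero {f : ContDiffBump (0 : E3)} {x y : E3} (X : 𝔤)
    (hy : ‖x‖ + f.rOut < ‖y‖) : (kernelAt f x X).1 y = 0 := by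
  have h : f.normed volume (x - y) = 0 := by
    by_contra h
    have h1 := normed_ne_zero h
    have h2 := norm_sub_norm_le y x
    rw [norm_sub_rev] at h2
    linarith
  change f.normed volume (x - y) • X = 0
  rw [h, zero_smul]

theorem flatNrm_kernelAt (f : ContDiffBump (0 : E3)) (x : E3) (X : 𝔤) :
    m.flatNrm (kernelAt f x X) = m.flatNrm (kernelAt f 0 X) := by
  rw [kernelAt_eq_translate f x 0]
  simp only [Configuration.flatNrm, pd_translate, nrm_zero_translate]

/-- At a fixed scale, mollification after a cutoff is bounded from the dual of `H₁` to `L²`. -/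
theorem exists_nrm_zero_mollify_cutoff_le (f : ContDiffBump (0 : E3)) {R : ℝ} (hR : 0 < R) :
    ∃ C, 0 ≤ C ∧ ∀ (g : TestFun 𝔤) (δ : ℝ), 0 ≤ δ → (∀ s, |l2 g s| ≤ δ * m.nrm 1 s) →
      m.nrm 0 (mollify f (mulFun _ (contDiff_cutoff R) g)) ≤ C * δ := by
  obtain ⟨C₁, hC₁, h1⟩ := exists_nrm_one_mulFun_le m (contDiff_cutoff R)
    (hasCompactSupport_cutoff hR)
  obtain ⟨C₂, hC₂, h2⟩ := exists_nrm_one_le_flatNrm m (2 * R + f.rOut + f.rOut)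
  obtain ⟨b, hb⟩ : ∃ b : Fin (Module.finrank ℝ 𝔤) → 𝔤, ∀ Y, ‖Y‖ ≤ ∑ j, |inner ℝ Y (b j)| :=
    ⟨stdOrthonormalBasis ℝ 𝔤, norm_le_sum_abs_inner⟩
  obtain ⟨k, hk, hkdef⟩ : ∃ k, 0 ≤ k ∧ ∑ j, m.flatNrm (kernelAt f 0 (b j)) = k :=
    ⟨_, Finset.sum_nonneg fun _ _ => flatNrm_nonneg m _, rfl⟩
  have hV := Real.sqrt_nonneg (volume.real (Metric.closedBall (0 : E3) (2 * R + f.rOut)))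
  refine ⟨√(volume.real (Metric.closedBall (0 : E3) (2 * R + f.rOut))) * (C₁ * C₂ * k),
    by positivity, fun g δ hδ hg => ?_⟩
  have hsupp : ∀ x, 2 * R < ‖x‖ → (mulFun _ (contDiff_cutoff R) g).1 x = 0 := fun x hx => by
    rw [mulFun_apply, cutoff_eq_zero hR hx, zero_smul]
  have hJ : ∀ x, 2 * R + f.rOut < ‖x‖ →
      (mollify f (mulFun _ (contDiff_cutoff R) g)).1 x = 0 := fun x hx => mollify_eq_zero hsupp hx
  rw [mul_assoc]
  refine nrm_zero_le_of_bounded m hJ (by positivity) fun x => ?_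
  by_cases hx : 2 * R + f.rOut < ‖x‖
  · rw [hJ x hx, norm_zero]
    positivity
  · have h3 : ∀ j, |inner ℝ ((mollify f (mulFun _ (contDiff_cutoff R) g)).1 x) (b j)|
        ≤ δ * (C₁ * (C₂ * m.flatNrm (kernelAt f 0 (b j)))) := fun j => by
      have h4 : l2 (mulFun _ (contDiff_cutoff R) g) (kernelAt f x (b j))
          = l2 g (mulFun _ (contDiff_cutoff R) (kernelAt f x (b j))) :=
        integral_congr_ae (.of_forall fun y => by
          simp only [mulFun_apply, real_inner_smul_left, real_inner_smul_right])
      rw [inner_mollify, h4, ← flatNrm_kernelAt m f x]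
      refine (hg _).trans (mul_le_mul_of_nonneg_left ((h1 _).trans
        (mul_le_mul_of_nonneg_left (h2 _ fun y hy => kernelAt_eq_zero _ ?_) hC₁)) hδ)
      linarith
    refine (hb _).trans ((Finset.sum_le_sum fun j _ => h3 j).trans_eq ?_)
    rw [← Finset.mul_sum, ← Finset.mul_sum, ← Finset.mul_sum, hkdef]
    ring

/-- The Laplacian of a configuration has dense range in `L²`: the approximate weak solutions are
cut off and mollified. -/
theorem exists_nrm_zero_lap_sub_le (f : TestFun 𝔤) {η : ℝ} (hη : 0 < η) :
    ∃ c : TestFun 𝔤, m.nrm 0 (m.lap c - f) ≤ η := by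
  obtain ⟨B, hB, hsol⟩ := exists_approx_weak_solution m f
  obtain ⟨K, hK, hcut⟩ := exists_commutator_cutoff_le m
  obtain ⟨R₀, hR₀⟩ : ∃ R₀, ∀ x, R₀ < ‖x‖ → f.1 x = 0 := by
    obtain ⟨R₀, h⟩ := f.2.2.isCompact.isBounded.exists_norm_le
    exact ⟨R₀, fun x hx => image_eq_zero_of_notMem_tsupport fun hx' => hx.not_ge (h x hx')⟩
  -- the radius of the cutoff, then the scale of the mollifier, then the accuracy of the solution
  obtain ⟨R, hR1, hRR, hRK⟩ : ∃ R : ℝ, 1 ≤ R ∧ R₀ ≤ R ∧ K / R * B ≤ η / 4 := by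
    refine ⟨max 1 (max R₀ (K * B / (η / 4))), le_max_left _ _,
      (le_max_left _ _).trans (le_max_right _ _), ?_⟩
    rw [div_mul_eq_mul_div, div_le_iff₀ (lt_max_of_lt_left one_pos), mul_comm (η / 4),
      ← div_le_iff₀ (by positivity)]
    exact (le_max_right _ _).trans (le_max_right _ _)
  have hR : 0 < R := one_pos.trans_le hR1
  let χ : TestFun 𝔤 →ₗ[ℝ] TestFun 𝔤 := mulFun _ (contDiff_cutoff R)
  have hχf : χ f = f := by
    ext x
    change cutoff R x • f.1 x = f.1 x
    by_cases hx : ‖x‖ ≤ R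
    · rw [cutoff_eq_one hR hx, one_smul]
    · rw [hR₀ x (hRR.trans_lt (not_le.1 hx)), smul_zero]
  obtain ⟨C₁, hC₁, h1⟩ := exists_flatNrm_le_nrm_one m (2 * R)
  obtain ⟨C₂, hC₂, h2⟩ := exists_nrm_one_mulFun_le m (contDiff_cutoff R)
    (hasCompactSupport_cutoff hR)
  obtain ⟨ε₀, hε₀, hcomm⟩ := almostCommutes_lap m (2 * R) (η / 4 / (C₁ * (C₂ * B) + 1))
    (by positivity)
  obtain ⟨D, hD, hDdef⟩ : ∃ D, 0 ≤ D ∧ ∑ i, m.nrm 0 (pd i f) = D :=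
    ⟨_, Finset.sum_nonneg fun _ _ => apply_nonneg _ _, rfl⟩
  let ε := min ε₀ (η / 4 / (D + 1))
  have hε : 0 < ε := by positivity
  let φ := bump ε hε
  obtain ⟨C₃, hC₃, h3⟩ := exists_nrm_zero_mollify_cutoff_le m φ hR
  obtain ⟨u, huB, hu⟩ := hsol (η / 4 / (C₃ + 1)) (by positivity)
  have hw : ∀ x, 2 * R < ‖x‖ → (χ u).1 x = 0 := fun x hx => by
    change cutoff R x • u.1 x = 0
    rw [cutoff_eq_zero hR hx, zero_smul]
  refine ⟨mollify φ (χ u), ?_⟩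
  -- commutator with the mollifier, commutator with the cutoff, defect of the weak solution, and
  -- mollification error of `f`
  have hsplit : m.lap (mollify φ (χ u)) - f
      = (m.lap (mollify φ (χ u)) - mollify φ (m.lap (χ u)))
        + mollify φ (m.lap (χ u) - χ (m.lap u)) + mollify φ (χ (m.lap u - f))
        + (mollify φ f - f) := by
    rw [map_sub χ, hχf, map_sub, map_sub]
    abel
  have e1 : m.nrm 0 (m.lap (mollify φ (χ u)) - mollify φ (m.lap (χ u))) ≤ η / 4 := by
    refine (hcomm φ (min_le_left _ _) (χ u) hw).trans ?_
    rw [div_mul_eq_mul_div, div_le_iff₀ (by positivity)]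
    refine mul_le_mul_of_nonneg_left ?_ (by positivity)
    have e2 := (h1 _ hw).trans (mul_le_mul_of_nonneg_left ((h2 u).trans
      (mul_le_mul_of_nonneg_left huB hC₂)) hC₁)
    linarith
  have e2 : m.nrm 0 (mollify φ (m.lap (χ u) - χ (m.lap u))) ≤ η / 4 :=
    (nrm_zero_mollify_le m φ _).trans ((hcut R hR1 u).trans
      ((mul_le_mul_of_nonneg_left huB (div_nonneg hK hR.le)).trans hRK))
  have e3 : m.nrm 0 (mollify φ (χ (m.lap u - f))) ≤ η / 4 := by
    refine (h3 _ _ (by positivity) hu).trans ?_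
    rw [mul_div_assoc', div_le_iff₀ (by positivity)]
    nlinarith
  have e4 : m.nrm 0 (mollify φ f - f) ≤ η / 4 := by
    refine (nrm_zero_mollify_sub_le m φ f).trans ?_
    rw [hDdef]
    refine (mul_le_mul_of_nonneg_right (min_le_right _ _) hD).trans ?_
    rw [div_mul_eq_mul_div, div_le_iff₀ (by positivity)]
    nlinarith
  rw [hsplit]
  have e5 := map_add_le_add (m.nrm 0) (m.lap (mollify φ (χ u)) - mollify φ (m.lap (χ u)))
    (mollify φ (m.lap (χ u) - χ (m.lap u)))
  have e6 := map_add_le_add (m.nrm 0) ((m.lap (mollify φ (χ u)) - mollify φ (m.lap (χ u)))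
    + mollify φ (m.lap (χ u) - χ (m.lap u))) (mollify φ (χ (m.lap u - f)))
  refine (map_add_le_add _ _ _).trans ?_
  linarith

end Density

/-! ### Fredholm properties of the extended operators -/

section Fredholm

variable {𝔤 : Type*} [InvariantLieAlgebra 𝔤] [FiniteDimensional ℝ 𝔤] {m : Configuration 𝔤}

/-- `T'` is the extension of the operator `T` on test sections to `H_j → H_k`. -/
def IsExtension {j k : Fin 3} (T : TestSection 𝔤 →ₗ[ℝ] TestSection 𝔤)
    (T' : H m j →L[ℝ] H m k) : Prop :=
  ∀ c, T' (toH m j c) = toH m k (T c)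

theorem norm_toH (k : Fin 3) (c : TestSection 𝔤) : ‖toH m k c‖ = m.secNrm k c :=
  UniformSpace.Completion.norm_coe (E := PreH m k) c

theorem toH_sub (k : Fin 3) (c c' : TestSection 𝔤) :
    toH m k (c - c') = toH m k c - toH m k c' :=
  UniformSpace.Completion.coe_sub (α := PreH m k) c c'

theorem exists_isExtension {j k : Fin 3} (T : TestSection 𝔤 →ₗ[ℝ] TestSection 𝔤) {C : ℝ}
    (hT : ∀ c, m.secNrm k (T c) ≤ C * m.secNrm j c) :
    ∃ T' : H m j →L[ℝ] H m k, IsExtension T T' :=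
  exists_completion_extension (P := PreH m j) (Q := PreH m k) T hT

theorem IsExtension.comp {i j k : Fin 3} {S T : TestSection 𝔤 →ₗ[ℝ] TestSection 𝔤}
    {S' : H m j →L[ℝ] H m k} {T' : H m i →L[ℝ] H m j} (hS : IsExtension S S')
    (hT : IsExtension T T') : IsExtension (S ∘ₗ T) (S'.comp T') := fun c => by
  rw [ContinuousLinearMap.comp_apply, hT c, hS]
  rfl

theorem IsExtension.isClosed_range {j k : Fin 3} {T : TestSection 𝔤 →ₗ[ℝ] TestSection 𝔤}
    {T' : H m j →L[ℝ] H m k} (hT : IsExtension T T') {C : ℝ} {p : TestSection 𝔤 → ℝ}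
    (hp : FiniteRankControlled fun c : PreH m j => p c)
    (h : ∀ c, m.secNrm j c ≤ C * m.secNrm k (T c) + p c) : IsClosed (T'.range : Set (H m k)) := by
  obtain ⟨ι, _, l, hl⟩ := exists_estimate_on_completion (P := PreH m j) (Q := PreH m k) T T' hT hp h
  exact isClosed_range_of_estimate T' l hl

theorem IsExtension.isFredholm {j k : Fin 3} {T : TestSection 𝔤 →ₗ[ℝ] TestSection 𝔤}
    {T' : H m j →L[ℝ] H m k} (hT : IsExtension T T') {C : ℝ} {p : TestSection 𝔤 → ℝ}
    (hp : FiniteRankControlled fun c : PreH m j => p c)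
    (h : ∀ c, m.secNrm j c ≤ C * m.secNrm k (T c) + p c) (hr : T'.range.CoFG) :
    T'.IsFredholm := by
  obtain ⟨ι, _, l, hl⟩ := exists_estimate_on_completion (P := PreH m j) (Q := PreH m k) T T' hT hp h
  exact isFredholm_of_estimate T' l hl hr

theorem isFredholm_of_comp {X Y Z : Type*} [NormedAddCommGroup X] [NormedSpace ℝ X]
    [NormedAddCommGroup Y] [NormedSpace ℝ Y] [NormedAddCommGroup Z] [NormedSpace ℝ Z]
    {S : Y →L[ℝ] Z} {T : X →L[ℝ] Y} (hS : S.IsFredholm) (hST : (S.comp T).IsFredholm) :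
    T.IsFredholm := by
  obtain ⟨v, hv⟩ := hS.exists_isQuasiInverse
  obtain ⟨w, hw⟩ := hST.exists_isQuasiInverse
  exact .of_isQuasiInverse (v := w.comp S) (LinearMap.IsQuasiInverse.of_comp_right hv hw)

/-- An extension of the Laplacian with closed range is onto, since its range is dense. -/
theorem surjective_of_lap {T : TestSection 𝔤 →ₗ[ℝ] TestSection 𝔤} (hlap : ∀ c, T c = lift m.lap c)
    {j : Fin 3} {T' : H m j →L[ℝ] H m 0} (hT : IsExtension T T')
    (hc : IsClosed (T'.range : Set (H m 0))) : Function.Surjective T' := by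
  have h1 : ∀ g, toH m 0 g ∈ (T'.range : Set (H m 0)) := fun g => by
    rw [← hc.closure_eq, Metric.mem_closure_iff]
    intro ε hε
    choose s hs using fun α =>
      exists_nrm_zero_lap_sub_le m (component α g) (show 0 < ε / 8 by positivity)
    let c : TestSection 𝔤 := (fun i => s (some i), s none)
    have hcs : ∀ α, component α c = s α := fun α => by cases α <;> rfl
    refine ⟨T' (toH m j c), ⟨_, rfl⟩, ?_⟩
    rw [hT c, hlap, dist_comm, dist_eq_norm, ← toH_sub, norm_toH]
    have h2 := sum_component_le (f := fun α => m.nrm 0 (component α (lift m.lap c - g)))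
      (K := ε / 8) fun α => by
        simp only [map_sub, component_lift, hcs]
        exact hs α
    linarith [m.secNrm_le_sum 0 (lift m.lap c - g)]
  have h2 : (T'.range : Set (H m 0)) = univ :=
    eq_univ_of_univ_subset (((denseRange_toH m 0).closure_range.symm.subset).trans
      (hc.closure_subset_iff.2 (range_subset_iff.2 h1)))
  exact fun y => h2.symm.subset (mem_univ y)

/-- `D` and `D^*` are bounded from `H₁` to `H₀`. -/
theorem exists_secNrm_zero_le (m : Configuration 𝔤) : ∃ C : ℝ, ∀ c,
    m.secNrm 0 (m.D c) ≤ C * m.secNrm 1 c ∧ m.secNrm 0 (m.Dstar c) ≤ C * m.secNrm 1 c := by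
  refine ⟨16 * 16, fun c => ?_⟩
  have h := diracBound_zero_le m c
  rw [D_eq_dirac, Dstar_eq_diracStar]
  have h1 := secNrm_dirac_le (P := m.nabla) (Q := m.adΦ) m c 0
  have h2 := secNrm_diracStar_le (P := m.nabla) (Q := m.adΦ) m c 0
  constructor <;> linarith

/-- `D` and `D^*` are bounded from `H₂` to `H₁`. -/
theorem exists_secNrm_one_le {C : ℝ} (h : m.HasDecay C) : ∃ C : ℝ, ∀ c,
    m.secNrm 1 (m.D c) ≤ C * m.secNrm 2 c ∧ m.secNrm 1 (m.Dstar c) ≤ C * m.secNrm 2 c := by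
  refine ⟨16 * (4 * (8 + 3 * (‖bracketL (𝔤 := 𝔤)‖ * C))), fun c => ?_⟩
  have h0 := diracBound_one_le h c
  rw [D_eq_dirac, Dstar_eq_diracStar]
  have h1 := secNrm_dirac_le (P := m.nabla) (Q := m.adΦ) m c 1
  have h2 := secNrm_diracStar_le (P := m.nabla) (Q := m.adΦ) m c 1
  constructor <;> linarith

/-- The zeroth order remainder in the first-order estimate is compact. -/
theorem finiteRankControlled_sum_wt_two (m : Configuration 𝔤) :
    FiniteRankControlled fun c : PreH m 1 => ∑ α, m.nrm 0 (wt 2 (component α c)) :=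
  FiniteRankControlled.sum _ fun α _ => finiteRankControlled_wt_two m α

/-- The curvature term, which is the difference of `D^* D` and `D D^*`, is compact from `H₂` to
`H₀`. -/
theorem finiteRankControlled_curvTerm {C : ℝ} (h : m.HasDecay C) :
    FiniteRankControlled fun c : PreH m 2 => m.secNrm 0 (m.curvTerm c) := by
  refine ((finiteRankControlled_remainder h).const_mul
    (show 0 ≤ 32 * (6 * C) by have := h.nonneg; positivity)).mono fun c => ?_
  have h1 := sum_component_le fun α => component_curvTerm_le m (m.nrm 0) c α
  have h2 := sum_nrm_adDer_le h c
  have h3 := m.secNrm_le_sum 0 (m.curvTerm c)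
  linarith

/-- Two a priori estimates and the decay of the Higgs field give all the Fredholm properties:
`D D^*` is onto, `D^* D` is a compact perturbation of it, and the first-order operators are
factors of these. -/
theorem isFredholm_extensions {C : ℝ} (hB : m.IsBogomolny) (h : m.HasDecay C)
    {D₁ Ds₁ : H m 1 →L[ℝ] H m 0} {D₂ Ds₂ : H m 2 →L[ℝ] H m 1}
    (hD₁ : IsExtension m.D D₁) (hDs₁ : IsExtension m.Dstar Ds₁)
    (hD₂ : IsExtension m.D D₂) (hDs₂ : IsExtension m.Dstar Ds₂) :
    (D₁.IsFredholm ∧ Ds₁.IsFredholm ∧ D₂.IsFredholm ∧ Ds₂.IsFredholm) ∧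
      (D₁.comp Ds₂).IsFredholm ∧ (Ds₁.comp D₂).IsFredholm := by
  obtain ⟨K, hK, eD⟩ := estimate_D hB h
  have eDs := estimate_Dstar hB
  obtain ⟨K₁, hK₁, eD2⟩ := estimate_two hB h m.D (secNrm_D_lift_le m) hK eD
  obtain ⟨K₂, hK₂, eDs2⟩ := estimate_two hB h m.Dstar (secNrm_Dstar_lift_le m)
    (show (0 : ℝ) ≤ 4 by norm_num) fun c => by
      have h0 : 0 ≤ ∑ α, m.nrm 0 (wt 2 (component α c)) :=
        Finset.sum_nonneg fun _ _ => apply_nonneg _ _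
      linarith [eDs c]
  obtain ⟨M, hbd⟩ := exists_secNrm_one_le h
  have hrem := finiteRankControlled_remainder h
  have hsum := finiteRankControlled_sum_wt_two m
  have hsumDs : FiniteRankControlled fun c : PreH m 2 =>
      ∑ α, m.nrm 0 (wt 2 (component α (m.Dstar c))) :=
    hsum.comp (X := PreH m 2) (Y := PreH m 1) (m.Dstar : TestSection 𝔤 →ₗ[ℝ] TestSection 𝔤)
      fun c => (hbd c).2
  have hzero : FiniteRankControlled fun _ : PreH m 1 => (0 : ℝ) := by
    simpa using FiniteRankControlled.sum (X := PreH m 1) (∅ : Finset Empty)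
      (p := fun _ _ => 0) (by simp)
  have hDDs := hD₁.comp hDs₂
  have hDsD := hDs₁.comp hD₂
  have eDDs : ∀ c, m.secNrm 2 c ≤ K₂ * K * m.secNrm 0 ((m.D ∘ₗ m.Dstar) c)
      + (K₂ * K * ∑ α, m.nrm 0 (wt 2 (component α (m.Dstar c))) + K₂ * m.remainder c) :=
    fun c => by
      have h1 := mul_le_mul_of_nonneg_left (eD (m.Dstar c)) hK₂
      have h2 := eDs2 c
      rw [LinearMap.comp_apply]
      linarith
  have pDDs := (hsumDs.const_mul (mul_nonneg hK₂ hK)).add (hrem.const_mul hK₂)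
  have eDsD : ∀ c, m.secNrm 2 c ≤ K₁ * 4 * m.secNrm 0 ((m.Dstar ∘ₗ m.D) c)
      + K₁ * m.remainder c := fun c => by
    have h1 := mul_le_mul_of_nonneg_left (eDs (m.D c)) hK₁
    have h2 := eD2 c
    rw [LinearMap.comp_apply]
    linarith
  have pDsD := hrem.const_mul hK₁
  have surj : Function.Surjective (D₁.comp Ds₂) :=
    surjective_of_lap (D_Dstar hB) hDDs (hDDs.isClosed_range pDDs eDDs)
  -- the difference of the two products is the curvature term
  have hdiff : FiniteRankControlled fun x => ‖(D₁.comp Ds₂) x - (Ds₁.comp D₂) x‖ := by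
    refine FiniteRankControlled.completion (P := PreH m 2) (by fun_prop) ?_
    refine (finiteRankControlled_curvTerm h).mono fun c => ?_
    have h1 : ∀ c : TestSection 𝔤, (D₁.comp Ds₂) (toH m 2 c) - (Ds₁.comp D₂) (toH m 2 c)
        = toH m 0 (-m.curvTerm c) := fun c => by
      rw [hDDs c, hDsD c, ← toH_sub, LinearMap.comp_apply, LinearMap.comp_apply, D_Dstar hB,
        Dstar_D hB, sub_add_cancel_left]
    refine (congrArg norm (h1 c)).trans_le ?_
    rw [norm_toH, map_neg_eq_map]
  have cofg : (Ds₁.comp D₂).range.CoFG :=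
    cofg_range_of_perturbation _ _ surj hdiff (hDsD.isClosed_range pDsD eDsD)
  have top {X Y : Type _} [NormedAddCommGroup X] [NormedSpace ℝ X] [NormedAddCommGroup Y]
      [NormedSpace ℝ Y] {T : X →L[ℝ] Y} (hT : Function.Surjective T) : T.range.CoFG := by
    rw [LinearMap.range_eq_top.2 hT]
    exact Submodule.CoFG.top
  have F1 : (D₁.comp Ds₂).IsFredholm := hDDs.isFredholm pDDs eDDs (top surj)
  have F2 : (Ds₁.comp D₂).IsFredholm := hDsD.isFredholm pDsD eDsD cofg
  have F3 : D₁.IsFredholm := hD₁.isFredholm (hsum.const_mul hK)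
    (fun c => (eD c).trans_eq (mul_add _ _ _)) (top fun y => (surj y).imp' Ds₂ fun _ hx => hx)
  have F4 : Ds₁.IsFredholm := hDs₁.isFredholm (C := 4) hzero (fun c => by linarith [eDs c])
    (cofg.of_le (LinearMap.range_comp_le_range _ _))
  exact ⟨⟨F3, F4, isFredholm_of_comp F4 F2, isFredholm_of_comp F3 F1⟩, F1, F2⟩

end Fredholm
end BogomolnyMonopole

end

theorem mainTheorem4 {𝔤 : Type*} [InvariantLieAlgebra 𝔤] [FiniteDimensional ℝ 𝔤]
    (m : BogomolnyMonopole.Configuration 𝔤) (hB : m.IsBogomolny) (hE : m.FiniteEnergy)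
    (R : ℝ) (u : E3 → 𝔤 →L[ℝ] 𝔤) (a : Fin 3 → E3 → 𝔤) (Φinf κ : E3 → 𝔤)
    (hA : m.HasAsymptotics R u a Φinf κ) (hS : BogomolnyMonopole.MaximalSymmetryBreaking Φinf) :
    (BogomolnyMonopole.ContinuousFredholm m 1 0 m.D ∧
      BogomolnyMonopole.ContinuousFredholm m 1 0 m.Dstar ∧
      BogomolnyMonopole.ContinuousFredholm m 2 1 m.D ∧
      BogomolnyMonopole.ContinuousFredholm m 2 1 m.Dstar) ∧
    (BogomolnyMonopole.ContinuousFredholm m 2 0 (m.D ∘ₗ m.Dstar) ∧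
      BogomolnyMonopole.ContinuousFredholm m 2 0 (m.Dstar ∘ₗ m.D)) := by
  obtain ⟨C, h⟩ := hA.exists_hasDecay hS
  obtain ⟨C₀, h₀⟩ := BogomolnyMonopole.exists_secNrm_zero_le m
  obtain ⟨C₁, h₁⟩ := BogomolnyMonopole.exists_secNrm_one_le h
  obtain ⟨D₁, hD₁⟩ := BogomolnyMonopole.exists_isExtension m.D fun c => (h₀ c).1
  obtain ⟨Ds₁, hDs₁⟩ := BogomolnyMonopole.exists_isExtension m.Dstar fun c => (h₀ c).2
  obtain ⟨D₂, hD₂⟩ := BogomolnyMonopole.exists_isExtension m.D fun c => (h₁ c).1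
  obtain ⟨Ds₂, hDs₂⟩ := BogomolnyMonopole.exists_isExtension m.Dstar fun c => (h₁ c).2
  obtain ⟨⟨F1, F2, F3, F4⟩, F5, F6⟩ :=
    BogomolnyMonopole.isFredholm_extensions hB h hD₁ hDs₁ hD₂ hDs₂
  exact ⟨⟨⟨D₁, hD₁, F1⟩, ⟨Ds₁, hDs₁, F2⟩, ⟨D₂, hD₂, F3⟩, ⟨Ds₂, hDs₂, F4⟩⟩,
    ⟨_, hD₁.comp hDs₂, F5⟩, ⟨_, hDs₁.comp hD₂, F6⟩⟩
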